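/- All algebras are over $\mathbb C$; $m$ is multiplication and $T(a\otimes b)=b\otimes a$. A quasi-Hopf algebra is a unital associative algebra $H$ with algebra homomorphisms $\varepsilon:H\to\mathbb C$, $\Delta:H\to H\otimes H$, an invertible $\Phi=\sum X\otimes Y\otimes Z\in H^{\otimes 3}$ (with $\Phi^{-1}=\sum\bar X\otimes\bar Y\otimes\bar Z$), a linear bijective anti-homomorphism $S:H\to H$ and $\alpha,\beta\in H$ such that $(\varepsilon\otimes1)\Delta=1=(1\otimes\varepsilon)\Delta$, $(1\otimes\Delta)\Delta(a)=\Phi^{-1}(\Delta\otimes1)\Delta(a)\,\Phi$, $(\Delta\otimes1\otimes1)\Phi\,(1\otimes1\otimes\Delta)\Phi=(\Phi\otimes1)\,(1\otimes\Delta\otimes1)\Phi\,(1\otimes\Phi)$, $(1\otimes\varepsilon\otimes1)\Phi=1$, $\sum S(X)\alpha Y\beta S(Z)=1=\sum\bar X\beta S(\bar Y)\alpha\bar Z$, $\sum S(a_{(1)})\alpha a_{(2)}=\varepsilon(a)\alpha$ and $\sum a_{(1)}\beta S(a_{(2)})=\varepsilon(a)\beta$. A twist is an invertible $F\in H\otimes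 H$ with $(\varepsilon\otimes1)F=1=(1\otimes\varepsilon)F$. For invertible $F\in H\otimes H$ put $\Delta_F(a)=F\Delta(a)F^{-1}$, $\Phi_F=(F\otimes1)\,(\Delta\otimes1)F\;\Phi\;(1\otimes\Delta)F^{-1}\,(1\otimes F^{-1})$, $\alpha_F=m(1\otimes\alpha)(S\otimes1)F^{-1}$, $\beta_F=m(1\otimes\beta)(1\otimes S)F$. Let $H$ be a $*$-quasi-Hopf algebra: a quasi-Hopf algebra with an antilinear involution $\dagger$, $(ab)^\dagger=b^\dagger a^\dagger$ (extended to tensor powers by $(a\otimes b)^\dagger=a^\dagger\otimes b^\dagger$), and a twist $\Omega$ (a $*$-canonical element) such that $\varepsilon(a^\dagger)=\overline{\varepsilon(a)}$ and $$(1)\qquad \Delta(a)^\dagger=\Omega\,\Delta(a^\dagger)\,\Omega^{-1}\quad(a\in H),\qquad (\Phi^\dagger)^{-1}=\Phi_\Omega .$$ Define the Drinfeld twists $$F_\delta=\sum (S\otimes S)\big(T\Delta(X)\big)\;\gamma\;\Delta\big(Y\beta S(Z)\big),\qquad F_0=(S^{-1}\otimes S^{-1})\,T(F_\delta),$$ where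 $\gamma=\sum S(B)\alpha C\otimes S(A)\alpha D$ and $\sum A\otimes B\otimes C\otimes D=(\Phi^{-1}\otimes1)\,(\Delta\otimes1\otimes1)\Phi$. Put $\tilde S(a)=S^{-1}(a^\dagger)^\dagger$ and $\Omega^T=T(\Omega)$. Then $F_\delta$ and $F_0$ are invertible, and there is a unique invertible $w\in H$ with $w\,S^{-1}(\beta)^\dagger=\alpha_\Omega$, $\beta_\Omega\,w=S^{-1}(\alpha)^\dagger$ and $S(a)=w\tilde S(a)w^{-1}$ for all $a\in H$. The elements $$\Omega'=(F_\delta^\dagger)^{-1}\,\Omega\,F_\delta^{-1},\qquad \Omega_0=(F_0^\dagger)^{-1}\,\Omega\,F_0^{-1}$$ satisfy the relations (1) for $(\Delta_{F_\delta},\Phi_{F_\delta})$ and $(\Delta_{F_0},\Phi_{F_0})$ respectively; if moreover $\varepsilon(\alpha)=1$, then $F_\delta,F_0,\Omega',\Omega_0$ are all twists, so that $\Omega'$ and $\Omega_0$ are $*$-canonical elements of the structures twisted by $F_\delta$ and $F_0$. They are given explicitly by $$\Omega'=\big[S^{-1}(w^{-1})\otimes S^{-1}(w^{-1})\big]\,(S^{-1}\otimes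 S^{-1})(\Omega^T)^{-1}\;F_0\;\Delta(S^{-1}(w))\;F_\delta^{-1},$$ $$\Omega_0=(w^{-1}\otimes w^{-1})\,(S\otimes S)(\Omega^T)^{-1}\;F_\delta\;\Delta(w)\;F_0^{-1}.$$ -/

import Mathlib

open scoped TensorProduct

noncomputable section

namespace StarQuasiHopf

/-- The algebra `A ⊗ A`. -/
abbrev Tensor2 (A : Type*) [Ring A] [Algebra ℂ A] : Type _ := A ⊗[ℂ] A

/-- The algebra `A ⊗ A ⊗ A`, bracketed to the right. -/
abbrev Tensor3 (A : Type*) [Ring A] [Algebra ℂ A] : Type _ := A ⊗[ℂ] (A ⊗[ℂ] A)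

/-- The algebra `A ⊗ A ⊗ A ⊗ A`, bracketed to the right. -/
abbrev Tensor4 (A : Type*) [Ring A] [Algebra ℂ A] : Type _ := A ⊗[ℂ] (A ⊗[ℂ] (A ⊗[ℂ] A))

section TensorMaps

variable {A : Type*} [Ring A] [Algebra ℂ A]

/-- `F ↦ F ⊗ 1`, that is `a ⊗ b ↦ a ⊗ b ⊗ 1`. -/
def oneRight : Tensor2 A →ₐ[ℂ] Tensor3 A :=
  (Algebra.TensorProduct.assoc ℂ ℂ ℂ A A A).toAlgHom.comp Algebra.TensorProduct.includeLeft

/-- `F ↦ 1 ⊗ F`, that is `a ⊗ b ↦ 1 ⊗ a ⊗ b`. -/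
def oneLeft : Tensor2 A →ₐ[ℂ] Tensor3 A :=
  Algebra.TensorProduct.includeRight

/-- `Δ ⊗ 1 : A ⊗ A → A ⊗ A ⊗ A`. -/
def deltaLeft (Δ : A →ₐ[ℂ] Tensor2 A) : Tensor2 A →ₐ[ℂ] Tensor3 A :=
  (Algebra.TensorProduct.assoc ℂ ℂ ℂ A A A).toAlgHom.comp
    (Algebra.TensorProduct.map Δ (AlgHom.id ℂ A))

/-- `1 ⊗ Δ : A ⊗ A → A ⊗ A ⊗ A`. -/
def deltaRight (Δ : A →ₐ[ℂ] Tensor2 A) : Tensor2 A →ₐ[ℂ] Tensor3 A :=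
  Algebra.TensorProduct.map (AlgHom.id ℂ A) Δ

/-- `Δ ⊗ 1 ⊗ 1 : A ⊗ A ⊗ A → A ⊗ A ⊗ A ⊗ A`. -/
def deltaFirst (Δ : A →ₐ[ℂ] Tensor2 A) : Tensor3 A →ₐ[ℂ] Tensor4 A :=
  (Algebra.TensorProduct.assoc ℂ ℂ ℂ A A (Tensor2 A)).toAlgHom.comp
    (Algebra.TensorProduct.map Δ (AlgHom.id ℂ (Tensor2 A)))

/-- `1 ⊗ Δ ⊗ 1 : A ⊗ A ⊗ A → A ⊗ A ⊗ A ⊗ A`. -/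
def deltaSecond (Δ : A →ₐ[ℂ] Tensor2 A) : Tensor3 A →ₐ[ℂ] Tensor4 A :=
  Algebra.TensorProduct.map (AlgHom.id ℂ A) (deltaLeft Δ)

/-- `1 ⊗ 1 ⊗ Δ : A ⊗ A ⊗ A → A ⊗ A ⊗ A ⊗ A`. -/
def deltaThird (Δ : A →ₐ[ℂ] Tensor2 A) : Tensor3 A →ₐ[ℂ] Tensor4 A :=
  Algebra.TensorProduct.map (AlgHom.id ℂ A) (deltaRight Δ)

/-- `Φ ↦ Φ ⊗ 1`, that is `a ⊗ b ⊗ c ↦ a ⊗ b ⊗ c ⊗ 1`. -/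
def oneFourth : Tensor3 A →ₐ[ℂ] Tensor4 A :=
  Algebra.TensorProduct.map (AlgHom.id ℂ A) oneRight

/-- `Φ ↦ 1 ⊗ Φ`, that is `a ⊗ b ⊗ c ↦ 1 ⊗ a ⊗ b ⊗ c`. -/
def oneFirst : Tensor3 A →ₐ[ℂ] Tensor4 A :=
  Algebra.TensorProduct.includeRight

/-- `ε ⊗ 1 : A ⊗ A → A`. -/
def counitLeft (ε : A →ₐ[ℂ] ℂ) : Tensor2 A →ₐ[ℂ] A :=
  (Algebra.TensorProduct.lid ℂ A).toAlgHom.comp (Algebra.TensorProduct.map ε (AlgHom.id ℂ A))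

/-- `1 ⊗ ε : A ⊗ A → A`. -/
def counitRight (ε : A →ₐ[ℂ] ℂ) : Tensor2 A →ₐ[ℂ] A :=
  (Algebra.TensorProduct.rid ℂ ℂ A).toAlgHom.comp (Algebra.TensorProduct.map (AlgHom.id ℂ A) ε)

/-- `1 ⊗ ε ⊗ 1 : A ⊗ A ⊗ A → A ⊗ A`. -/
def counitMiddle (ε : A →ₐ[ℂ] ℂ) : Tensor3 A →ₐ[ℂ] Tensor2 A :=
  Algebra.TensorProduct.map (AlgHom.id ℂ A) (counitLeft ε)

/-- The flip `T : a ⊗ b ↦ b ⊗ a`. -/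
def tensorFlip : Tensor2 A ≃ₐ[ℂ] Tensor2 A :=
  Algebra.TensorProduct.comm ℂ A A

/-- The multiplication map `m : a ⊗ b ↦ a b`. -/
def mul2 : Tensor2 A →ₗ[ℂ] A := LinearMap.mul' ℂ A

/-- The iterated multiplication map `a ⊗ b ⊗ c ↦ a b c`. -/
def mul3 : Tensor3 A →ₗ[ℂ] A :=
  mul2 ∘ₗ TensorProduct.map LinearMap.id mul2

/-- `x ↦ f x * c`. -/
def thenMul {V : Type*} [AddCommGroup V] [Module ℂ V] (f : V →ₗ[ℂ] A) (c : A) : V →ₗ[ℂ] A :=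
  LinearMap.mulRight ℂ c ∘ₗ f

/-- `S ⊗ S` on `A ⊗ A`, for a linear map `S`. -/
def both (S : A →ₗ[ℂ] A) : Tensor2 A →ₗ[ℂ] Tensor2 A := TensorProduct.map S S

/-- The inner automorphism `a ↦ u a u⁻¹`. -/
def innerHom (u : Aˣ) : A →ₐ[ℂ] A :=
  AlgHom.ofLinearMap (LinearMap.mulRight ℂ (↑u⁻¹ : A) ∘ₗ LinearMap.mulLeft ℂ (u : A))
    (by simp)
    (by intro x y; simp [mul_assoc])

/-- The twisted co-product `Δ_F(a) = F Δ(a) F⁻¹`. -/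
def twistComul (Δ : A →ₐ[ℂ] Tensor2 A) (F : (Tensor2 A)ˣ) : A →ₐ[ℂ] Tensor2 A :=
  (innerHom F).comp Δ

/-- The twisted co-associator
`Φ_F = (F ⊗ 1) (Δ ⊗ 1)F Φ (1 ⊗ Δ)F⁻¹ (1 ⊗ F⁻¹)`. -/
def twistCoassoc (Δ : A →ₐ[ℂ] Tensor2 A) (Φ : (Tensor3 A)ˣ) (F : (Tensor2 A)ˣ) : (Tensor3 A)ˣ :=
  Units.map (oneRight (A := A)).toMonoidHom F * Units.map (deltaLeft Δ).toMonoidHom F * Φ *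
    Units.map (deltaRight Δ).toMonoidHom F⁻¹ * Units.map (oneLeft (A := A)).toMonoidHom F⁻¹

/-- An invertible `F ∈ A ⊗ A` is a twist if `(ε ⊗ 1)F = 1 = (1 ⊗ ε)F`. -/
def IsTwist (ε : A →ₐ[ℂ] ℂ) (F : (Tensor2 A)ˣ) : Prop :=
  counitLeft ε (F : Tensor2 A) = 1 ∧ counitRight ε (F : Tensor2 A) = 1

/-- The two relations between a conjugation `†` (written `star`), a co-product, a co-associator and
an invertible `Ω ∈ A ⊗ A`: `Δ(a)† = Ω Δ(a†) Ω⁻¹` and `(Φ†)⁻¹ = Φ_Ω`. -/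
def StarRelations [StarRing A] [StarModule ℂ A] (Δ : A →ₐ[ℂ] Tensor2 A) (Φ : (Tensor3 A)ˣ)
    (Ω : (Tensor2 A)ˣ) : Prop :=
  (∀ a : A, star (Δ a) = (Ω : Tensor2 A) * Δ (star a) * (↑Ω⁻¹ : Tensor2 A)) ∧
    (star Φ)⁻¹ = twistCoassoc Δ Φ Ω

end TensorMaps

/-- A quasi-Hopf algebra structure on the unital associative complex algebra `H`, with bijective
antipode. Co-associativity reads `(1 ⊗ Δ)Δ(a) = Φ⁻¹ (Δ ⊗ 1)Δ(a) Φ`. -/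
structure QuasiHopf (H : Type*) [Ring H] [Algebra ℂ H] where
  /-- the co-product `Δ` -/
  comul : H →ₐ[ℂ] Tensor2 H
  /-- the co-unit `ε` -/
  counit : H →ₐ[ℂ] ℂ
  /-- the co-associator `Φ = X ⊗ Y ⊗ Z`, with inverse `X̄ ⊗ Ȳ ⊗ Z̄` -/
  coassoc : (Tensor3 H)ˣ
  /-- the antipode `S` -/
  antipode : H ≃ₗ[ℂ] H
  /-- the canonical element `α` -/
  α : H
  /-- the canonical element `β` -/
  β : H
  counitLeft_comul : ∀ a, counitLeft counit (comul a) = a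
  counitRight_comul : ∀ a, counitRight counit (comul a) = a
  quasi_coassoc : ∀ a, deltaRight comul (comul a) =
    (↑coassoc⁻¹ : Tensor3 H) * deltaLeft comul (comul a) * (coassoc : Tensor3 H)
  pentagon : deltaFirst comul (coassoc : Tensor3 H) * deltaThird comul (coassoc : Tensor3 H) =
    oneFourth (coassoc : Tensor3 H) * deltaSecond comul (coassoc : Tensor3 H) *
      oneFirst (coassoc : Tensor3 H)
  counit_coassoc : counitMiddle counit (coassoc : Tensor3 H) = 1
  antipode_mul : ∀ a b, antipode (a * b) = antipode b * antipode a
  /-- `S(X) α Y β S(Z) = 1` -/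
  antipode_coassoc :
    mul3 (TensorProduct.map (thenMul antipode.toLinearMap α)
      (TensorProduct.map (thenMul LinearMap.id β) antipode.toLinearMap) (coassoc : Tensor3 H)) = 1
  /-- `X̄ β S(Ȳ) α Z̄ = 1` -/
  antipode_coassoc_inv :
    mul3 (TensorProduct.map (thenMul LinearMap.id β)
      (TensorProduct.map (thenMul antipode.toLinearMap α) LinearMap.id)
        (↑coassoc⁻¹ : Tensor3 H)) = 1
  /-- `S(a₁) α a₂ = ε(a) α` -/
  antipode_left : ∀ a,
    mul2 (TensorProduct.map (thenMul antipode.toLinearMap α) LinearMap.id (comul a)) =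
      counit a • α
  /-- `a₁ β S(a₂) = ε(a) β` -/
  antipode_right : ∀ a,
    mul2 (TensorProduct.map (thenMul LinearMap.id β) antipode.toLinearMap (comul a)) =
      counit a • β

namespace QuasiHopf

variable {H : Type*} [Ring H] [Algebra ℂ H] (Q : QuasiHopf H)

/-- The antipode `S` as a linear map. -/
def S : H →ₗ[ℂ] H := Q.antipode.toLinearMap

/-- The inverse antipode `S⁻¹` as a linear map. -/
def Sinv : H →ₗ[ℂ] H := Q.antipode.symm.toLinearMap

/-- `α_F = m (1 ⊗ α)(S ⊗ 1)F⁻¹`. -/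
def twistα (F : (Tensor2 H)ˣ) : H :=
  mul2 (TensorProduct.map (thenMul Q.S Q.α) LinearMap.id (↑F⁻¹ : Tensor2 H))

/-- `β_F = m (1 ⊗ β)(1 ⊗ S)F`. -/
def twistβ (F : (Tensor2 H)ˣ) : H :=
  mul2 (TensorProduct.map (thenMul LinearMap.id Q.β) Q.S (F : Tensor2 H))

/-- The linear map `a ⊗ b ⊗ c ⊗ d ↦ S(b) α c ⊗ S(a) α d`. -/
def gammaMap : Tensor4 H →ₗ[ℂ] Tensor2 H :=
  TensorProduct.map (mul2 ∘ₗ TensorProduct.map (thenMul Q.S Q.α) LinearMap.id)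
      (mul2 ∘ₗ TensorProduct.map (thenMul Q.S Q.α) LinearMap.id) ∘ₗ
    (TensorProduct.tensorTensorTensorComm ℂ H H H H).toLinearMap ∘ₗ
    TensorProduct.map (TensorProduct.comm ℂ H H).toLinearMap LinearMap.id ∘ₗ
    (TensorProduct.assoc ℂ H H (H ⊗[ℂ] H)).symm.toLinearMap

/-- `γ = S(B) α C ⊗ S(A) α D`, where `A ⊗ B ⊗ C ⊗ D = (Φ⁻¹ ⊗ 1) (Δ ⊗ 1 ⊗ 1)Φ`. -/
def gamma : Tensor2 H :=
  Q.gammaMap (oneFourth (↑Q.coassoc⁻¹ : Tensor3 H) *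
    deltaFirst Q.comul (Q.coassoc : Tensor3 H))

/-- The Drinfeld twist `F_δ = (S ⊗ S)Δᵀ(X) γ Δ(Y β S(Z))`. -/
def drinfeldTwist : Tensor2 H :=
  mul2 (TensorProduct.map
    (thenMul (both Q.S ∘ₗ (tensorFlip (A := H)).toLinearMap ∘ₗ Q.comul.toLinearMap) Q.gamma)
    (Q.comul.toLinearMap ∘ₗ mul2 ∘ₗ TensorProduct.map (thenMul LinearMap.id Q.β) Q.S)
    (Q.coassoc : Tensor3 H))

/-- The second Drinfeld twist `F₀ = (S⁻¹ ⊗ S⁻¹)F_δᵀ`. -/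
def secondDrinfeldTwist : Tensor2 H :=
  both Q.Sinv (tensorFlip Q.drinfeldTwist)

variable [StarRing H] [StarModule ℂ H]

/-- `H`, with the conjugation `star`, is a `*`-quasi-Hopf algebra with `*`-canonical
element `Ω`. -/
structure IsStarCanonical (Ω : (Tensor2 H)ˣ) : Prop where
  counit_star : ∀ a, Q.counit (star a) = star (Q.counit a)
  isTwist : IsTwist Q.counit Ω
  relations : StarRelations Q.comul Q.coassoc Ω

/-- `S̃(a) = S⁻¹(a†)†`. -/
def Stilde (a : H) : H := star (Q.Sinv (star a))

/-- The relations that characterise the invertible element `w`: `w S⁻¹(β)† = α_Ω`,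
`β_Ω w = S⁻¹(α)†` and `S(a) = w S̃(a) w⁻¹`. -/
structure IsConjugator (Ω : (Tensor2 H)ˣ) (w : Hˣ) : Prop where
  alpha : (w : H) * star (Q.Sinv Q.β) = Q.twistα Ω
  beta : Q.twistβ Ω * (w : H) = star (Q.Sinv Q.α)
  antipode : ∀ a, Q.S a = (w : H) * Q.Stilde a * (↑w⁻¹ : H)

end QuasiHopf

end StarQuasiHopf

end

open StarQuasiHopf

/-! The proof rests on uniqueness of antipodes in a relative form. For a homomorphism f : H → B, an
antipode along f is an anti-homomorphism s : H → B with elements a, b that satisfy the antipode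
axioms with f in place of the identity. Two antipodes (s, a, b) and (s', a', b') along the same f
differ by a unit u with u s(x) = s'(x) u, u a = a' and b' u = b. The first two relations already
force u = s'(X) a' f(Y) b s(Z) (`IsAntipode.exists_unit`, `IsAntipode.eq_link`).

This is applied repeatedly. Along Δ, both ΔS with (Δ(α), Δ(β)) and (S ⊗ S)TΔ with Drinfeld's (γ, δ)
are antipodes (`isAntipode_flipAntipode`). Their comparison unit is F_δ, so F_δ is invertible, F_δ
Δ(α) = γ and δ F_δ = Δ(β). Along the identity of the quasi-bialgebra twisted by Ω, both S with (α_Ω,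
β_Ω) and S̃ with (S⁻¹(β)†, S⁻¹(α)†) are antipodes, the latter because † carries the axioms of H to
those of its twist; the comparison unit is w. If ε(α) = 1, then (ε ⊗ 1)F_δ and (1 ⊗ ε)F_δ satisfy
the relations that characterise 1.

Finally, along Δ_Ω, the elements (w ⊗ w)(F₀†)⁻¹ Ω Δ(w⁻¹) Ω⁻¹ and (S ⊗ S)T(Ω⁻¹) F_δ Ω⁻¹ both
intertwine Δ_Ω S with (S ⊗ S)TΔ_Ω and carry Δ_Ω(α_Ω) to the twisted γ, hence agree
(`IsConjugator.star_inv_flipSinv`). Solving for (F₀†)⁻¹ Ω gives the formula for Ω₀; applying (S⁻¹ ⊗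
S⁻¹)T gives the one for Ω'. That Ω' and Ω₀ satisfy (1) is formal, since twists compose.

Sweedler sums are replaced by legs: elements of tensor powers are evaluated at commuting
homomorphisms into an algebra R, and a linear map E on R encodes a word such as s(x) a y b s(z). An
antipode axiom then says that, under E, the convolution of two legs may be replaced by the co-unit
when it stands leftmost, or rightmost, in the product. -/

noncomputable section

namespace StarQuasiHopf

/-! ### Commuting homomorphisms as legs, and linear maps that absorb them -/

section

section CommutingHoms

variable {R A B C : Type*} [Ring R] [Algebra ℂ R] [Ring A] [Algebra ℂ A] [Ring B] [Algebra ℂ B]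
  [Ring C] [Algebra ℂ C]

/-- The images of two algebra homomorphisms commute. -/
class CommHoms (i : A →ₐ[ℂ] R) (j : B →ₐ[ℂ] R) : Prop where
  comm : ∀ a b, Commute (i a) (j b)

instance CommHoms.symm (i : A →ₐ[ℂ] R) (j : B →ₐ[ℂ] R) [h : CommHoms i j] : CommHoms j i :=
  ⟨fun a b => (h.comm b a).symm⟩

/-- `a ⊗ b ↦ i a * j b`, for commuting `i` and `j`. -/
def pair (i : A →ₐ[ℂ] R) (j : B →ₐ[ℂ] R) [CommHoms i j] : A ⊗[ℂ] B →ₐ[ℂ] R :=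
  Algebra.TensorProduct.lift i j CommHoms.comm

@[simp]
theorem pair_tmul (i : A →ₐ[ℂ] R) (j : B →ₐ[ℂ] R) [CommHoms i j] (a : A) (b : B) :
    pair i j (a ⊗ₜ b) = i a * j b := rfl

theorem commute_pair {i : A →ₐ[ℂ] R} {j : B →ₐ[ℂ] R} [CommHoms i j] {u : R}
    (hi : ∀ a, Commute u (i a)) (hj : ∀ b, Commute u (j b)) (t : A ⊗[ℂ] B) :
    Commute u (pair i j t) := by
  induction t using TensorProduct.induction_on with
  | zero => simp
  | tmul a b => exact (hi a).mul_right (hj b)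
  | add x y hx hy => rw [map_add]; exact hx.add_right hy

instance (i : A →ₐ[ℂ] R) (j : B →ₐ[ℂ] R) (k : C →ₐ[ℂ] R) [CommHoms i j] [CommHoms k i]
    [CommHoms k j] : CommHoms k (pair i j) :=
  ⟨fun a => commute_pair (CommHoms.comm a) (CommHoms.comm a)⟩

instance (i : A →ₐ[ℂ] R) (j : B →ₐ[ℂ] R) (k : C →ₐ[ℂ] R) [CommHoms i j] [CommHoms i k]
    [CommHoms j k] : CommHoms (pair i j) k :=
  ⟨fun a b => (commute_pair (fun c => (CommHoms.comm (i := i) (j := k) c b).symm)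
    (fun c => (CommHoms.comm (i := j) (j := k) c b).symm) a).symm⟩

theorem pair_intertwine {i i' : A →ₐ[ℂ] R} {j j' : B →ₐ[ℂ] R} [CommHoms i j] [CommHoms i' j']
    {u : R} (hi : ∀ a, u * i a = i' a * u) (hj : ∀ b, u * j b = j' b * u) (t : A ⊗[ℂ] B) :
    u * pair i j t = pair i' j' t * u := by
  induction t using TensorProduct.induction_on with
  | zero => simp
  | tmul a b => rw [pair_tmul, pair_tmul, ← mul_assoc, hi, mul_assoc, hj, mul_assoc]
  | add x y hx hy => rw [map_add, map_add, mul_add, add_mul, hx, hy]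

theorem pair_assoc (i : A →ₐ[ℂ] R) (j : B →ₐ[ℂ] R) (k : C →ₐ[ℂ] R) [CommHoms i j] [CommHoms i k]
    [CommHoms j k] (t : (A ⊗[ℂ] B) ⊗[ℂ] C) :
    pair i (pair j k) (Algebra.TensorProduct.assoc ℂ ℂ ℂ A B C t) = pair (pair i j) k t := by
  induction t using TensorProduct.induction_on with
  | zero => simp
  | tmul x c =>
    induction x using TensorProduct.induction_on with
    | zero => simp
    | tmul a b => simp [mul_assoc]
    | add x y hx hy => rw [TensorProduct.add_tmul, map_add, map_add, map_add, hx, hy]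
  | add x y hx hy => rw [map_add, map_add, map_add, hx, hy]

variable {V : Type*} [AddCommGroup V] [Module ℂ V]

/-- `i` and `j` agree under `E` as leftmost factors. -/
def LeftEq (E : R →ₗ[ℂ] V) (i j : A →ₐ[ℂ] R) : Prop := ∀ a r, E (i a * r) = E (j a * r)

/-- `i` and `j` agree under `E` as rightmost factors. -/
def RightEq (E : R →ₗ[ℂ] V) (i j : A →ₐ[ℂ] R) : Prop := ∀ a r, E (r * i a) = E (r * j a)

/-- A leg can be absorbed from behind a factor with which it commutes; this extends absorption to
the interior of a product. -/
theorem LeftEq.mulLeft {E : R →ₗ[ℂ] V} {i j : A →ₐ[ℂ] R} (h : LeftEq E i j) {u : R}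
    (hi : ∀ a, Commute u (i a)) (hj : ∀ a, Commute u (j a)) :
    LeftEq (E ∘ₗ LinearMap.mulLeft ℂ u) i j := fun a r => by
  have := h a (u * r)
  rw [← mul_assoc, ← mul_assoc, ← (hi a).eq, ← (hj a).eq] at this
  simpa [mul_assoc] using this

theorem RightEq.mulRight {E : R →ₗ[ℂ] V} {i j : A →ₐ[ℂ] R} (h : RightEq E i j) {u : R}
    (hi : ∀ a, Commute u (i a)) (hj : ∀ a, Commute u (j a)) :
    RightEq (E ∘ₗ LinearMap.mulRight ℂ u) i j := fun a r => by
  have := h a (r * u)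
  rw [mul_assoc, mul_assoc, (hi a).eq, (hj a).eq] at this
  simpa [mul_assoc] using this

theorem LeftEq.pair_left {E : R →ₗ[ℂ] V} {i i' : A →ₐ[ℂ] R} (h : LeftEq E i i')
    (j : B →ₐ[ℂ] R) [CommHoms i j] [CommHoms i' j] : LeftEq E (pair i j) (pair i' j) := by
  intro t r
  induction t using TensorProduct.induction_on with
  | zero => simp
  | tmul a b => simpa [mul_assoc] using h a (j b * r)
  | add x y hx hy => rw [map_add, map_add, add_mul, add_mul, map_add, map_add, hx, hy]

/-- The legs of one tensor commute, so any of them can be brought to the front: its position inside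
the tensor is irrelevant. -/
theorem LeftEq.pair_right {E : R →ₗ[ℂ] V} {j j' : B →ₐ[ℂ] R} (h : LeftEq E j j')
    (i : A →ₐ[ℂ] R) [CommHoms i j] [CommHoms i j'] : LeftEq E (pair i j) (pair i j') := by
  intro t r
  induction t using TensorProduct.induction_on with
  | zero => simp
  | tmul a b =>
    rw [pair_tmul, pair_tmul, (CommHoms.comm (i := i) (j := j) a b).eq,
      (CommHoms.comm (i := i) (j := j') a b).eq, mul_assoc, mul_assoc]
    exact h b _
  | add x y hx hy => rw [map_add, map_add, add_mul, add_mul, map_add, map_add, hx, hy]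

theorem RightEq.pair_left {E : R →ₗ[ℂ] V} {i i' : A →ₐ[ℂ] R} (h : RightEq E i i')
    (j : B →ₐ[ℂ] R) [CommHoms i j] [CommHoms i' j] : RightEq E (pair i j) (pair i' j) := by
  intro t r
  induction t using TensorProduct.induction_on with
  | zero => simp
  | tmul a b =>
    rw [pair_tmul, pair_tmul, (CommHoms.comm (i := i) (j := j) a b).eq,
      (CommHoms.comm (i := i') (j := j) a b).eq, ← mul_assoc, ← mul_assoc]
    exact h a _
  | add x y hx hy => rw [map_add, map_add, mul_add, mul_add, map_add, map_add, hx, hy]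

theorem RightEq.pair_right {E : R →ₗ[ℂ] V} {j j' : B →ₐ[ℂ] R} (h : RightEq E j j')
    (i : A →ₐ[ℂ] R) [CommHoms i j] [CommHoms i j'] : RightEq E (pair i j) (pair i j') := by
  intro t r
  induction t using TensorProduct.induction_on with
  | zero => simp
  | tmul a b => simpa [mul_assoc] using h b (r * i a)
  | add x y hx hy => rw [map_add, map_add, mul_add, mul_add, map_add, map_add, hx, hy]

end CommutingHoms

/-- A quasi-bialgebra structure on `H`. -/
structure QuasiBialgebra (H : Type*) [Ring H] [Algebra ℂ H] where
  /-- the co-product -/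
  comul : H →ₐ[ℂ] Tensor2 H
  /-- the co-unit -/
  counit : H →ₐ[ℂ] ℂ
  /-- the co-associator -/
  coassoc : (Tensor3 H)ˣ
  counitLeft_comul : ∀ a, counitLeft counit (comul a) = a
  counitRight_comul : ∀ a, counitRight counit (comul a) = a
  quasi_coassoc : ∀ a, deltaRight comul (comul a) =
    (↑coassoc⁻¹ : Tensor3 H) * deltaLeft comul (comul a) * (coassoc : Tensor3 H)
  pentagon : deltaFirst comul (coassoc : Tensor3 H) * deltaThird comul (coassoc : Tensor3 H) =
    oneFourth (coassoc : Tensor3 H) * deltaSecond comul (coassoc : Tensor3 H) *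
      oneFirst (coassoc : Tensor3 H)
  counit_coassoc : counitMiddle counit (coassoc : Tensor3 H) = 1

/-! ### Convolution of legs, and the co-associator evaluated at legs -/

namespace QuasiBialgebra

variable {H : Type*} [Ring H] [Algebra ℂ H] (Q : QuasiBialgebra H)
variable {R : Type*} [Ring R] [Algebra ℂ R] {A : Type*} [Ring A] [Algebra ℂ A]

/-- The convolution `(i ⊗ j)Δ` of commuting homomorphisms. -/
def conv (i j : H →ₐ[ℂ] R) [CommHoms i j] : H →ₐ[ℂ] R := (pair i j).comp Q.comul

theorem conv_apply (i j : H →ₐ[ℂ] R) [CommHoms i j] (a : H) :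
    Q.conv i j a = pair i j (Q.comul a) := rfl

instance (i j : H →ₐ[ℂ] R) (k : A →ₐ[ℂ] R) [CommHoms i j] [CommHoms k i] [CommHoms k j] :
    CommHoms k (Q.conv i j) := ⟨fun a _ => CommHoms.comm (i := k) (j := pair i j) a _⟩

instance (i j : H →ₐ[ℂ] R) (k : A →ₐ[ℂ] R) [CommHoms i j] [CommHoms i k] [CommHoms j k] :
    CommHoms (Q.conv i j) k := ⟨fun _ b => CommHoms.comm (i := pair i j) (j := k) _ b⟩

/-- The co-unit as a homomorphism into an arbitrary algebra. -/
def unitHom (R : Type*) [Ring R] [Algebra ℂ R] : H →ₐ[ℂ] R := (Algebra.ofId ℂ R).comp Q.counit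

theorem unitHom_apply (a : H) : Q.unitHom R a = algebraMap ℂ R (Q.counit a) := rfl

instance (k : A →ₐ[ℂ] R) : CommHoms k (Q.unitHom R) :=
  ⟨fun a _ => (Algebra.commutes _ (k a)).symm⟩

instance (k : A →ₐ[ℂ] R) : CommHoms (Q.unitHom R) k :=
  ⟨fun _ b => Algebra.commutes _ (k b)⟩

/-- The image of the co-associator under three commuting homomorphisms. -/
def assocAt (i j k : H →ₐ[ℂ] R) [CommHoms i j] [CommHoms i k] [CommHoms j k] : Rˣ :=
  Units.map (pair i (pair j k)).toMonoidHom Q.coassoc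

section

variable (i j k l : H →ₐ[ℂ] R) [CommHoms i j] [CommHoms i k] [CommHoms i l] [CommHoms j k]
  [CommHoms j l] [CommHoms k l]

theorem coe_assocAt : (Q.assocAt i j k : R) = pair i (pair j k) (Q.coassoc : Tensor3 H) := rfl

theorem coe_inv_assocAt :
    (↑(Q.assocAt i j k)⁻¹ : R) = pair i (pair j k) (↑Q.coassoc⁻¹ : Tensor3 H) := rfl

theorem pair_comp_deltaLeft :
    (pair i (pair j k)).comp (deltaLeft Q.comul) = pair (Q.conv i j) k := by
  apply Algebra.TensorProduct.ext'
  intro a b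
  simp [deltaLeft, conv_apply, pair_assoc]

theorem pair_comp_deltaRight :
    (pair i (pair j k)).comp (deltaRight Q.comul) = pair i (Q.conv j k) :=
  Algebra.TensorProduct.ext' fun a b => by simp [deltaRight, conv_apply]

theorem pair_comp_deltaFirst :
    (pair i (pair j (pair k l))).comp (deltaFirst Q.comul) = pair (Q.conv i j) (pair k l) := by
  apply Algebra.TensorProduct.ext'
  intro a b
  simp [deltaFirst, conv_apply, pair_assoc]

theorem pair_comp_deltaSecond :
    (pair i (pair j (pair k l))).comp (deltaSecond Q.comul) = pair i (pair (Q.conv j k) l) :=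
  Algebra.TensorProduct.ext' fun a b => by
    simp [deltaSecond, ← pair_comp_deltaLeft]

theorem pair_comp_deltaThird :
    (pair i (pair j (pair k l))).comp (deltaThird Q.comul) = pair i (pair j (Q.conv k l)) :=
  Algebra.TensorProduct.ext' fun a b => by
    simp [deltaThird, ← pair_comp_deltaRight]

theorem pair_comp_oneRight :
    (pair i (pair j k)).comp oneRight = pair i j := by
  apply Algebra.TensorProduct.ext'
  intro a b
  simp [oneRight]

theorem pair_comp_oneLeft :
    (pair i (pair j k)).comp oneLeft = pair j k := by
  apply Algebra.TensorProduct.ext'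
  intro a b
  simp [oneLeft]

theorem pair_comp_oneFourth :
    (pair i (pair j (pair k l))).comp oneFourth = pair i (pair j k) := by
  apply Algebra.TensorProduct.ext'
  intro a b
  simp [oneFourth, ← pair_comp_oneRight j k l]

theorem pair_comp_oneFirst :
    (pair i (pair j (pair k l))).comp oneFirst = pair j (pair k l) := by
  apply Algebra.TensorProduct.ext'
  intro a b
  simp [oneFirst]

/-- With legs in place of tensor positions, the pentagon can be used at any choice and any order of
slots of a larger tensor product. -/
theorem assocAt_pentagon : Q.assocAt (Q.conv i j) k l * Q.assocAt i j (Q.conv k l) =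
    Q.assocAt i j k * Q.assocAt i (Q.conv j k) l * Q.assocAt j k l := by
  ext
  have := congrArg (pair i (pair j (pair k l))) Q.pentagon
  rw [map_mul, map_mul, map_mul] at this
  simp only [← AlgHom.comp_apply, pair_comp_deltaFirst, pair_comp_deltaSecond,
    pair_comp_deltaThird, pair_comp_oneFourth, pair_comp_oneFirst] at this
  exact this

theorem assocAt_mul_conv (a : H) : (Q.assocAt i j k : R) * Q.conv i (Q.conv j k) a =
    Q.conv (Q.conv i j) k a * Q.assocAt i j k := by
  have := congrArg (pair i (pair j k)) (congrArg ((Q.coassoc : Tensor3 H) * ·) (Q.quasi_coassoc a))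
  simp only [← mul_assoc, Units.mul_inv, one_mul] at this
  rw [conv_apply, conv_apply, ← pair_comp_deltaLeft, ← pair_comp_deltaRight, coe_assocAt]
  simpa using this

theorem conv_unitHom_left : Q.conv (Q.unitHom R) j = j := by
  have h : pair (Q.unitHom R) j = j.comp (counitLeft Q.counit) :=
    Algebra.TensorProduct.ext' fun a b => by
      simp [counitLeft, unitHom_apply, Algebra.smul_def]
  ext a
  rw [conv_apply, h, AlgHom.comp_apply, counitLeft_comul]

theorem conv_unitHom_right : Q.conv j (Q.unitHom R) = j := by
  have h : pair j (Q.unitHom R) = j.comp (counitRight Q.counit) :=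
    Algebra.TensorProduct.ext' fun a b => by
      simp [counitRight, unitHom_apply, Algebra.smul_def, Algebra.commutes]
  ext a
  rw [conv_apply, h, AlgHom.comp_apply, counitRight_comul]

theorem assocAt_unitHom_middle : Q.assocAt i (Q.unitHom R) k = 1 := by
  have h : pair i (pair (Q.unitHom R) k) = (pair i k).comp (counitMiddle Q.counit) :=
    Algebra.TensorProduct.ext' fun a b => by
      have h' : pair (Q.unitHom R) k = k.comp (counitLeft Q.counit) :=
        Algebra.TensorProduct.ext' fun a b => by
          simp [counitLeft, unitHom_apply, Algebra.smul_def]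
      simp [counitMiddle, h']
  ext
  rw [coe_assocAt, h, AlgHom.comp_apply, counit_coassoc, map_one, Units.val_one]

/-- In the pentagon with two initial co-unit legs, the middle co-unit axiom removes all factors but
three copies of this unit, leaving x = x x. -/
theorem assocAt_unitHom_left : Q.assocAt (Q.unitHom R) j k = 1 := by
  have h := Q.assocAt_pentagon (Q.unitHom R) (Q.unitHom R) j k
  simp only [conv_unitHom_left, assocAt_unitHom_middle, mul_one] at h
  simpa using h

theorem assocAt_unitHom_right : Q.assocAt i j (Q.unitHom R) = 1 := by
  have h := Q.assocAt_pentagon i j (Q.unitHom R) (Q.unitHom R)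
  simp only [conv_unitHom_right, assocAt_unitHom_middle, mul_one, one_mul] at h
  simpa using h

end

end QuasiBialgebra

end

/-! ### Contracting the pentagon along four legs -/

section

section

variable {R A B C V : Type*} [Ring R] [Algebra ℂ R] [Ring A] [Algebra ℂ A] [Ring B] [Algebra ℂ B]
  [Ring C] [Algebra ℂ C] [AddCommGroup V] [Module ℂ V]

theorem LeftEq.map_units {E : R →ₗ[ℂ] V} {i j : A →ₐ[ℂ] R} (h : LeftEq E i j) (g : Aˣ) (v : Rˣ) :
    E ↑(Units.map i.toMonoidHom g * v) = E ↑(Units.map j.toMonoidHom g * v) :=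
  h g v

theorem RightEq.map_units {E : R →ₗ[ℂ] V} {i j : A →ₐ[ℂ] R} (h : RightEq E i j) (g : Aˣ)
    (v : Rˣ) :
    E ↑(v * Units.map i.toMonoidHom g) = E ↑(v * Units.map j.toMonoidHom g) :=
  h g v

end

namespace QuasiBialgebra

variable {H : Type*} [Ring H] [Algebra ℂ H] (Q : QuasiBialgebra H)
variable {R : Type*} [Ring R] [Algebra ℂ R] {V : Type*} [AddCommGroup V] [Module ℂ V]

section

variable {i i' j j' k k' : H →ₐ[ℂ] R} [CommHoms i j] [CommHoms i k] [CommHoms j k]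
  [CommHoms i' j'] [CommHoms i' k'] [CommHoms j' k']

theorem commute_assocAt {u : R} (hi : ∀ a, Commute u (i a)) (hj : ∀ a, Commute u (j a))
    (hk : ∀ a, Commute u (k a)) : Commute u (Q.assocAt i j k : R) :=
  commute_pair hi (commute_pair hj hk) _

theorem assocAt_commute {A : Type*} [Ring A] [Algebra ℂ A] (i j k : H →ₐ[ℂ] R) (l : A →ₐ[ℂ] R)
    [CommHoms i j] [CommHoms i k] [CommHoms j k] [CommHoms i l] [CommHoms j l] [CommHoms k l]
    (a : A) : Commute (Q.assocAt i j k : R) (l a) :=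
  (Q.commute_assocAt (fun b => (CommHoms.comm (i := i) (j := l) b a).symm)
    (fun b => (CommHoms.comm (i := j) (j := l) b a).symm)
    fun b => (CommHoms.comm (i := k) (j := l) b a).symm).symm

theorem assocAt_intertwine {u : Rˣ} (hi : ∀ a, u * i a = i' a * u) (hj : ∀ a, u * j a = j' a * u)
    (hk : ∀ a, u * k a = k' a * u) : u * Q.assocAt i j k = Q.assocAt i' j' k' * u :=
  Units.ext (pair_intertwine hi (pair_intertwine hj hk) _)

theorem conv_mul_inv_assocAt (a : H) :
    (↑(Q.assocAt i j k)⁻¹ : R) * Q.conv (Q.conv i j) k a =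
      Q.conv i (Q.conv j k) a * (↑(Q.assocAt i j k)⁻¹ : R) := by
  rw [Units.inv_mul_eq_iff_eq_mul, ← mul_assoc, assocAt_mul_conv, Units.mul_inv_cancel_right]

variable {Q} {E : R →ₗ[ℂ] V} {x y : H →ₐ[ℂ] R}

theorem LeftEq.conv_left (h : LeftEq E x y) (p : H →ₐ[ℂ] R) [CommHoms x p] [CommHoms y p] :
    LeftEq E (Q.conv x p) (Q.conv y p) := fun a => h.pair_left p (Q.comul a)

theorem LeftEq.conv_right (h : LeftEq E x y) (p : H →ₐ[ℂ] R) [CommHoms p x] [CommHoms p y] :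
    LeftEq E (Q.conv p x) (Q.conv p y) := fun a => h.pair_right p (Q.comul a)

theorem RightEq.conv_left (h : RightEq E x y) (p : H →ₐ[ℂ] R) [CommHoms x p] [CommHoms y p] :
    RightEq E (Q.conv x p) (Q.conv y p) := fun a => h.pair_left p (Q.comul a)

theorem RightEq.conv_right (h : RightEq E x y) (p : H →ₐ[ℂ] R) [CommHoms p x] [CommHoms p y] :
    RightEq E (Q.conv p x) (Q.conv p y) := fun a => h.pair_right p (Q.comul a)

theorem LeftEq.conv_unitHom_left (h : LeftEq E x (Q.unitHom R)) (p : H →ₐ[ℂ] R)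
    [CommHoms x p] : LeftEq E (Q.conv x p) p := by
  simpa only [Q.conv_unitHom_left] using LeftEq.conv_left (Q := Q) h p

theorem LeftEq.conv_unitHom_right (h : LeftEq E x (Q.unitHom R)) (p : H →ₐ[ℂ] R)
    [CommHoms p x] : LeftEq E (Q.conv p x) p := by
  simpa only [Q.conv_unitHom_right] using LeftEq.conv_right (Q := Q) h p

theorem RightEq.conv_unitHom_left (h : RightEq E x (Q.unitHom R)) (p : H →ₐ[ℂ] R)
    [CommHoms x p] : RightEq E (Q.conv x p) p := by
  simpa only [Q.conv_unitHom_left] using RightEq.conv_left (Q := Q) h p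

theorem RightEq.conv_unitHom_right (h : RightEq E x (Q.unitHom R)) (p : H →ₐ[ℂ] R)
    [CommHoms p x] : RightEq E (Q.conv p x) p := by
  simpa only [Q.conv_unitHom_right] using RightEq.conv_right (Q := Q) h p

end

section Antipodal

variable {Q} {E : R →ₗ[ℂ] V} {i₁ i₂ i₃ i₄ : H →ₐ[ℂ] R} [CommHoms i₁ i₂] [CommHoms i₁ i₃]
  [CommHoms i₁ i₄] [CommHoms i₂ i₃] [CommHoms i₂ i₄] [CommHoms i₃ i₄]

/-- The pentagon has five factors. The three that contain a contracted pair become trivial under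
`E`, and the other two are compared. -/
theorem map_assocAt_eq_map_inv (h₁₂ : LeftEq E (Q.conv i₁ i₂) (Q.unitHom R))
    (h₂₃ : RightEq E (Q.conv i₂ i₃) (Q.unitHom R)) (h₃₄ : LeftEq E (Q.conv i₃ i₄) (Q.unitHom R)) :
    E ↑(Q.assocAt i₁ i₂ i₃) = E ↑(Q.assocAt i₂ i₃ i₄)⁻¹ := by
  -- In this arrangement each contractible pair is at the correct end of the product once the
  -- previous factor has disappeared.
  have e : Q.assocAt i₁ i₂ i₃ = Q.assocAt (Q.conv i₁ i₂) i₃ i₄ *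
      (Q.assocAt i₁ i₂ (Q.conv i₃ i₄) * ((Q.assocAt i₂ i₃ i₄)⁻¹ *
        (Q.assocAt i₁ (Q.conv i₂ i₃) i₄)⁻¹)) := by
    rw [← mul_assoc, assocAt_pentagon]
    group
  have e₁ := (h₁₂.pair_left (pair i₃ i₄)).map_units Q.coassoc
    (Q.assocAt i₁ i₂ (Q.conv i₃ i₄) * ((Q.assocAt i₂ i₃ i₄)⁻¹ *
      (Q.assocAt i₁ (Q.conv i₂ i₃) i₄)⁻¹))
  have e₂ := ((h₃₄.pair_right i₂).pair_right i₁).map_units Q.coassoc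
    ((Q.assocAt i₂ i₃ i₄)⁻¹ * (Q.assocAt i₁ (Q.conv i₂ i₃) i₄)⁻¹)
  have e₃ := ((h₂₃.pair_left i₄).pair_right i₁).map_units Q.coassoc⁻¹ (Q.assocAt i₂ i₃ i₄)⁻¹
  rw [e]
  refine e₁.trans ?_
  change E ↑(Q.assocAt (Q.unitHom R) i₃ i₄ * _) = _
  rw [assocAt_unitHom_left, one_mul]
  refine e₂.trans ?_
  change E ↑(Q.assocAt i₁ i₂ (Q.unitHom R) * _) = _
  rw [assocAt_unitHom_right, one_mul]
  refine e₃.trans ?_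
  change E ↑(_ * (Q.assocAt i₁ (Q.unitHom R) i₄)⁻¹) = _
  rw [assocAt_unitHom_middle, inv_one, mul_one]

theorem map_assocAt_eq_map_inv' (h₁₂ : RightEq E (Q.conv i₁ i₂) (Q.unitHom R))
    (h₂₃ : LeftEq E (Q.conv i₂ i₃) (Q.unitHom R)) (h₃₄ : RightEq E (Q.conv i₃ i₄) (Q.unitHom R)) :
    E ↑(Q.assocAt i₂ i₃ i₄) = E ↑(Q.assocAt i₁ i₂ i₃)⁻¹ := by
  have e : Q.assocAt i₂ i₃ i₄ = (Q.assocAt i₁ (Q.conv i₂ i₃) i₄)⁻¹ *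
      ((Q.assocAt i₁ i₂ i₃)⁻¹ * Q.assocAt (Q.conv i₁ i₂) i₃ i₄ *
        Q.assocAt i₁ i₂ (Q.conv i₃ i₄)) := by
    rw [mul_assoc _ _ (Q.assocAt i₁ i₂ _), assocAt_pentagon]
    group
  have e₁ := ((h₂₃.pair_left i₄).pair_right i₁).map_units Q.coassoc⁻¹
    ((Q.assocAt i₁ i₂ i₃)⁻¹ * Q.assocAt (Q.conv i₁ i₂) i₃ i₄ * Q.assocAt i₁ i₂ (Q.conv i₃ i₄))
  have e₂ := ((h₃₄.pair_right i₂).pair_right i₁).map_units Q.coassoc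
    ((Q.assocAt i₁ i₂ i₃)⁻¹ * Q.assocAt (Q.conv i₁ i₂) i₃ i₄)
  have e₃ := (h₁₂.pair_left (pair i₃ i₄)).map_units Q.coassoc (Q.assocAt i₁ i₂ i₃)⁻¹
  rw [e]
  refine e₁.trans ?_
  change E ↑((Q.assocAt i₁ (Q.unitHom R) i₄)⁻¹ * _) = _
  rw [assocAt_unitHom_middle, inv_one, one_mul]
  refine e₂.trans ?_
  change E ↑(_ * Q.assocAt i₁ i₂ (Q.unitHom R)) = _
  rw [assocAt_unitHom_right, mul_one]
  refine e₃.trans ?_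
  change E ↑(_ * Q.assocAt (Q.unitHom R) i₃ i₄) = _
  rw [assocAt_unitHom_left, mul_one]

end Antipodal
end QuasiBialgebra

end

/-! ### Contracting pentagons along six legs -/

section

namespace QuasiBialgebra

variable {H : Type*} [Ring H] [Algebra ℂ H] (Q : QuasiBialgebra H)
variable {R : Type*} [Ring R] [Algebra ℂ R] {V : Type*} [AddCommGroup V] [Module ℂ V]

section

theorem assocAt_comm (i j k l m n : H →ₐ[ℂ] R) [CommHoms i j] [CommHoms i k] [CommHoms j k]
    [CommHoms l m] [CommHoms l n] [CommHoms m n] [CommHoms i l] [CommHoms i m] [CommHoms i n]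
    [CommHoms j l] [CommHoms j m] [CommHoms j n] [CommHoms k l] [CommHoms k m] [CommHoms k n] :
    Commute (Q.assocAt i j k) (Q.assocAt l m n) :=
  Units.ext (Q.commute_assocAt (Q.assocAt_commute i j k l) (Q.assocAt_commute i j k m)
    (Q.assocAt_commute i j k n))

end

section Middle

variable {Q} {E : R →ₗ[ℂ] V} {x : H →ₐ[ℂ] R}

theorem commute_unitHom (u : R) (a : H) : Commute u (Q.unitHom R a) :=
  (Algebra.commutes _ u).symm

/-- Only the middle leg has to commute with the preceding factor `u`; once it is the co-unit, the
whole co-associator is trivial. -/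
theorem LeftEq.map_mul_assocAt (h : LeftEq E x (Q.unitHom R)) (p q : H →ₐ[ℂ] R) [CommHoms p x]
    [CommHoms p q] [CommHoms x q] {u : Rˣ} (hu : ∀ a, Commute (u : R) (x a)) (v : Rˣ) :
    E ↑(u * (Q.assocAt p x q * v)) = E ↑(u * v) := by
  refine ((((h.mulLeft hu (commute_unitHom _)).pair_left q).pair_right p).map_units
    Q.coassoc v).trans ?_
  change E ↑(u * (Q.assocAt p (Q.unitHom R) q * v)) = _
  rw [assocAt_unitHom_middle, one_mul]

theorem LeftEq.map_mul_inv_assocAt (h : LeftEq E x (Q.unitHom R)) (p q : H →ₐ[ℂ] R)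
    [CommHoms p x] [CommHoms p q] [CommHoms x q] {u : Rˣ} (hu : ∀ a, Commute (u : R) (x a))
    (v : Rˣ) : E ↑(u * ((Q.assocAt p x q)⁻¹ * v)) = E ↑(u * v) := by
  refine ((((h.mulLeft hu (commute_unitHom _)).pair_left q).pair_right p).map_units
    Q.coassoc⁻¹ v).trans ?_
  change E ↑(u * ((Q.assocAt p (Q.unitHom R) q)⁻¹ * v)) = _
  rw [assocAt_unitHom_middle, inv_one, one_mul]

theorem RightEq.map_assocAt_mul (h : RightEq E x (Q.unitHom R)) (p q : H →ₐ[ℂ] R) [CommHoms p x]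
    [CommHoms p q] [CommHoms x q] {v : Rˣ} (hv : ∀ a, Commute (v : R) (x a)) (u : Rˣ) :
    E ↑(u * Q.assocAt p x q * v) = E ↑(u * v) := by
  refine ((((h.mulRight hv (commute_unitHom _)).pair_left q).pair_right p).map_units
    Q.coassoc u).trans ?_
  change E ↑(u * Q.assocAt p (Q.unitHom R) q * v) = _
  rw [assocAt_unitHom_middle, mul_one]

theorem RightEq.map_inv_assocAt_mul (h : RightEq E x (Q.unitHom R)) (p q : H →ₐ[ℂ] R)
    [CommHoms p x] [CommHoms p q] [CommHoms x q] {v : Rˣ} (hv : ∀ a, Commute (v : R) (x a))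
    (u : Rˣ) : E ↑(u * (Q.assocAt p x q)⁻¹ * v) = E ↑(u * v) := by
  refine ((((h.mulRight hv (commute_unitHom _)).pair_left q).pair_right p).map_units
    Q.coassoc⁻¹ u).trans ?_
  change E ↑(u * (Q.assocAt p (Q.unitHom R) q)⁻¹ * v) = _
  rw [assocAt_unitHom_middle, inv_one, mul_one]

end Middle

section SixLegs

variable {Q} {E : R →ₗ[ℂ] V} {i₁ i₂ i₃ i₄ i₅ i₆ : H →ₐ[ℂ] R} [CommHoms i₁ i₂] [CommHoms i₁ i₃]
  [CommHoms i₁ i₄] [CommHoms i₁ i₅] [CommHoms i₁ i₆] [CommHoms i₂ i₃] [CommHoms i₂ i₄]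
  [CommHoms i₂ i₅] [CommHoms i₂ i₆] [CommHoms i₃ i₄] [CommHoms i₃ i₅] [CommHoms i₃ i₆]
  [CommHoms i₄ i₅] [CommHoms i₄ i₆] [CommHoms i₅ i₆]

/-- The argument on the left is the word of (S ⊗ S)TΔ(X) γ Δ(Y) δ (S ⊗ S)TΔ(Z): two factors from γ,
the co-associator with all three legs co-multiplied, two factors from δ. Four pentagons reduce it to
co-associators on the disjoint triples (1, 4, 5) and (2, 3, 6), on which the intended `E` splits as
a tensor product. -/
theorem map_six_legs_eq
    (h₂₃ : LeftEq E (Q.conv i₂ i₃) (Q.unitHom R)) (h₁₄ : LeftEq E (Q.conv i₁ i₄) (Q.unitHom R))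
    (h₄₅ : RightEq E (Q.conv i₄ i₅) (Q.unitHom R))
    (h₃₆ : RightEq E (Q.conv i₃ i₆) (Q.unitHom R)) :
    E ↑((Q.assocAt i₁ i₂ i₃)⁻¹ * Q.assocAt (Q.conv i₁ i₂) i₃ i₄ *
        Q.assocAt (Q.conv i₁ i₂) (Q.conv i₃ i₄) (Q.conv i₅ i₆) *
        (Q.assocAt (Q.conv i₃ i₄) i₅ i₆)⁻¹ * Q.assocAt i₃ i₄ i₅) =
      E ↑(Q.assocAt i₁ i₄ i₅ * Q.assocAt i₂ i₃ i₆) := by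
  have p₁ := Q.assocAt_pentagon (Q.conv i₁ i₂) i₃ i₄ (Q.conv i₅ i₆)
  have p₂ := Q.assocAt_pentagon i₃ i₄ i₅ i₆
  have p₃ := Q.assocAt_pentagon i₁ i₂ i₃ i₆
  have p₄ := Q.assocAt_pentagon i₁ i₄ i₅ i₆
  -- Quasi-co-associativity: passing a co-associator over a convolved leg changes its bracketing and
  -- brings legs 2 and 3 together. The next identity does the same for 4 and 5.
  have q₁ : (Q.assocAt i₁ i₂ i₃)⁻¹ * Q.assocAt (Q.conv (Q.conv i₁ i₂) i₃) i₄ (Q.conv i₅ i₆) =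
      Q.assocAt (Q.conv i₁ (Q.conv i₂ i₃)) i₄ (Q.conv i₅ i₆) * (Q.assocAt i₁ i₂ i₃)⁻¹ :=
    Q.assocAt_intertwine Q.conv_mul_inv_assocAt
      (fun a => (Commute.units_inv_left (Q.assocAt_commute i₁ i₂ i₃ i₄ a)).eq)
      (fun a => (Commute.units_inv_left (Q.assocAt_commute i₁ i₂ i₃ (Q.conv i₅ i₆) a)).eq)
  have q₂ : Q.assocAt (Q.conv i₁ i₂) i₃ (Q.conv i₄ (Q.conv i₅ i₆)) * (Q.assocAt i₄ i₅ i₆)⁻¹ =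
      (Q.assocAt i₄ i₅ i₆)⁻¹ * Q.assocAt (Q.conv i₁ i₂) i₃ (Q.conv (Q.conv i₄ i₅) i₆) :=
    (Q.assocAt_intertwine
      (fun a => (Commute.units_inv_left (Q.assocAt_commute i₄ i₅ i₆ (Q.conv i₁ i₂) a)).eq)
      (fun a => (Commute.units_inv_left (Q.assocAt_commute i₄ i₅ i₆ i₃ a)).eq)
      Q.conv_mul_inv_assocAt).symm
  have q₃ : (Q.assocAt i₁ i₂ i₃)⁻¹ * (Q.assocAt i₄ i₅ i₆)⁻¹ =
      (Q.assocAt i₄ i₅ i₆)⁻¹ * (Q.assocAt i₁ i₂ i₃)⁻¹ :=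
    (Q.assocAt_comm i₁ i₂ i₃ i₄ i₅ i₆).inv_inv.eq
  -- The pentagons `p₁` and `p₂` share the co-associator at 3, 4, (56), which cancels.
  have e₁ : (Q.assocAt i₁ i₂ i₃)⁻¹ * Q.assocAt (Q.conv i₁ i₂) i₃ i₄ *
        Q.assocAt (Q.conv i₁ i₂) (Q.conv i₃ i₄) (Q.conv i₅ i₆) *
        (Q.assocAt (Q.conv i₃ i₄) i₅ i₆)⁻¹ * Q.assocAt i₃ i₄ i₅ =
      Q.assocAt (Q.conv i₁ (Q.conv i₂ i₃)) i₄ (Q.conv i₅ i₆) * ((Q.assocAt i₁ i₂ i₃)⁻¹ *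
        (Q.assocAt i₄ i₅ i₆)⁻¹ * Q.assocAt (Q.conv i₁ i₂) i₃ (Q.conv (Q.conv i₄ i₅) i₆)) *
        (Q.assocAt i₃ (Q.conv i₄ i₅) i₆)⁻¹ := by
    have r₁ := eq_mul_inv_of_mul_eq p₁.symm
    have r₂ : (Q.assocAt (Q.conv i₃ i₄) i₅ i₆)⁻¹ * Q.assocAt i₃ i₄ i₅ =
        Q.assocAt i₃ i₄ (Q.conv i₅ i₆) * (Q.assocAt i₄ i₅ i₆)⁻¹ *
          (Q.assocAt i₃ (Q.conv i₄ i₅) i₆)⁻¹ := by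
      rw [eq_mul_inv_of_mul_eq p₂]
      group
    rw [mul_assoc _ (_)⁻¹ _, r₂, mul_assoc _ (Q.assocAt (Q.conv i₁ i₂) i₃ i₄), r₁,
      show ∀ a A B s n m : Rˣ, a⁻¹ * (A * B * s⁻¹) * (s * n⁻¹ * m⁻¹) =
        (a⁻¹ * A) * (B * n⁻¹) * m⁻¹ from fun a A B s n m => by group, q₁, q₂]
    simp only [mul_assoc]
  have e₂ : ∀ v, E ↑(v * (Q.assocAt i₃ (Q.conv i₄ i₅) i₆)⁻¹) = E ↑v := fun v => by
    simpa using RightEq.map_inv_assocAt_mul h₄₅ i₃ i₆ (v := 1) (fun _ => Commute.one_left _) v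
  have e₃ : ∀ v, E ↑(Q.assocAt (Q.conv i₁ (Q.conv i₂ i₃)) i₄ (Q.conv i₅ i₆) * v) =
      E ↑(Q.assocAt i₁ i₄ (Q.conv i₅ i₆) * v) :=
    ((LeftEq.conv_unitHom_right h₂₃ i₁).pair_left (pair i₄ (Q.conv i₅ i₆))).map_units Q.coassoc
  have e₄ : ∀ v, E ↑(v * Q.assocAt (Q.conv i₁ i₂) i₃ (Q.conv (Q.conv i₄ i₅) i₆)) =
      E ↑(v * Q.assocAt (Q.conv i₁ i₂) i₃ i₆) :=
    (((RightEq.conv_unitHom_left h₄₅ i₆).pair_right i₃).pair_right (Q.conv i₁ i₂)).map_units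
      Q.coassoc
  have e₅ : ∀ v, E ↑((Q.assocAt (Q.conv i₁ i₄) i₅ i₆)⁻¹ * v) = E ↑v := fun v => by
    refine ((h₁₄.pair_left (pair i₅ i₆)).map_units Q.coassoc⁻¹ v).trans ?_
    change E ↑((Q.assocAt (Q.unitHom R) i₅ i₆)⁻¹ * v) = _
    rw [assocAt_unitHom_left, inv_one, one_mul]
  have e₆ : ∀ v, E ↑(v * (Q.assocAt i₁ i₂ (Q.conv i₃ i₆))⁻¹) = E ↑v := fun v => by
    refine (((h₃₆.pair_right i₂).pair_right i₁).map_units Q.coassoc⁻¹ v).trans ?_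
    change E ↑(v * (Q.assocAt i₁ i₂ (Q.unitHom R))⁻¹) = _
    rw [assocAt_unitHom_right, inv_one, mul_one]
  -- The other two pentagons leave contractible factors at both ends. Of the two remaining middle
  -- factors, (23) is then absorbed from the left past co-associators that commute with it, and (45)
  -- from the right.
  have e₇ : Q.assocAt i₁ i₄ (Q.conv i₅ i₆) * ((Q.assocAt i₁ i₂ i₃)⁻¹ *
        (Q.assocAt i₄ i₅ i₆)⁻¹ * Q.assocAt (Q.conv i₁ i₂) i₃ i₆) =
      (Q.assocAt (Q.conv i₁ i₄) i₅ i₆)⁻¹ * (Q.assocAt i₁ i₄ i₅ * Q.assocAt i₁ (Q.conv i₄ i₅) i₆ *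
        (Q.assocAt i₁ (Q.conv i₂ i₃) i₆ * Q.assocAt i₂ i₃ i₆)) *
        (Q.assocAt i₁ i₂ (Q.conv i₃ i₆))⁻¹ := by
    rw [q₃, eq_inv_mul_of_mul_eq p₄, eq_mul_inv_of_mul_eq p₃]
    group
  rw [e₁, e₂, e₃, ← mul_assoc, e₄, mul_assoc, e₇, e₆, e₅, LeftEq.map_mul_assocAt h₂₃ i₁ i₆
    (fun a => (Q.assocAt_commute i₁ i₄ i₅ (Q.conv i₂ i₃) a).mul_left
      (Q.assocAt_commute i₁ (Q.conv i₄ i₅) i₆ (Q.conv i₂ i₃) a)),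
    RightEq.map_assocAt_mul h₄₅ i₁ i₆ (Q.assocAt_commute i₂ i₃ i₆ (Q.conv i₄ i₅))]

end SixLegs

section SixLegs

variable {Q} {E : R →ₗ[ℂ] V} {i₁ i₂ i₃ i₄ i₅ i₆ : H →ₐ[ℂ] R} [CommHoms i₁ i₂] [CommHoms i₁ i₃]
  [CommHoms i₁ i₄] [CommHoms i₁ i₅] [CommHoms i₁ i₆] [CommHoms i₂ i₃] [CommHoms i₂ i₄]
  [CommHoms i₂ i₅] [CommHoms i₂ i₆] [CommHoms i₃ i₄] [CommHoms i₃ i₅] [CommHoms i₃ i₆]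
  [CommHoms i₄ i₅] [CommHoms i₄ i₆] [CommHoms i₅ i₆]

/-- The companion for Δ(X̄) δ (S ⊗ S)TΔ(Ȳ) γ Δ(Z̄): the same four pentagons in inverted form, with
left and right contractions exchanged. -/
theorem map_six_legs_inv_eq
    (h₁₄ : RightEq E (Q.conv i₁ i₄) (Q.unitHom R)) (h₂₃ : RightEq E (Q.conv i₂ i₃) (Q.unitHom R))
    (h₄₅ : LeftEq E (Q.conv i₄ i₅) (Q.unitHom R))
    (h₃₆ : LeftEq E (Q.conv i₃ i₆) (Q.unitHom R)) :
    E ↑((Q.assocAt i₃ i₄ i₅)⁻¹ * Q.assocAt (Q.conv i₃ i₄) i₅ i₆ *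
        (Q.assocAt (Q.conv i₁ i₂) (Q.conv i₃ i₄) (Q.conv i₅ i₆))⁻¹ *
        (Q.assocAt (Q.conv i₁ i₂) i₃ i₄)⁻¹ * Q.assocAt i₁ i₂ i₃) =
      E ↑((Q.assocAt i₂ i₃ i₆)⁻¹ * (Q.assocAt i₁ i₄ i₅)⁻¹) := by
  have p₁ := Q.assocAt_pentagon (Q.conv i₁ i₂) i₃ i₄ (Q.conv i₅ i₆)
  have p₂ := Q.assocAt_pentagon i₃ i₄ i₅ i₆
  have p₃ := Q.assocAt_pentagon i₁ i₂ i₃ i₆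
  have p₄ := Q.assocAt_pentagon i₁ i₄ i₅ i₆
  have q₁ : (Q.assocAt i₁ i₂ i₃)⁻¹ * Q.assocAt (Q.conv (Q.conv i₁ i₂) i₃) i₄ (Q.conv i₅ i₆) =
      Q.assocAt (Q.conv i₁ (Q.conv i₂ i₃)) i₄ (Q.conv i₅ i₆) * (Q.assocAt i₁ i₂ i₃)⁻¹ :=
    Q.assocAt_intertwine Q.conv_mul_inv_assocAt
      (fun a => (Commute.units_inv_left (Q.assocAt_commute i₁ i₂ i₃ i₄ a)).eq)
      (fun a => (Commute.units_inv_left (Q.assocAt_commute i₁ i₂ i₃ (Q.conv i₅ i₆) a)).eq)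
  have q₂ : Q.assocAt (Q.conv i₁ i₂) i₃ (Q.conv i₄ (Q.conv i₅ i₆)) * (Q.assocAt i₄ i₅ i₆)⁻¹ =
      (Q.assocAt i₄ i₅ i₆)⁻¹ * Q.assocAt (Q.conv i₁ i₂) i₃ (Q.conv (Q.conv i₄ i₅) i₆) :=
    (Q.assocAt_intertwine
      (fun a => (Commute.units_inv_left (Q.assocAt_commute i₄ i₅ i₆ (Q.conv i₁ i₂) a)).eq)
      (fun a => (Commute.units_inv_left (Q.assocAt_commute i₄ i₅ i₆ i₃ a)).eq)
      Q.conv_mul_inv_assocAt).symm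
  have q₃ : Q.assocAt i₄ i₅ i₆ * Q.assocAt i₁ i₂ i₃ = Q.assocAt i₁ i₂ i₃ * Q.assocAt i₄ i₅ i₆ :=
    (Q.assocAt_comm i₁ i₂ i₃ i₄ i₅ i₆).eq.symm
  have e₁ : (Q.assocAt i₃ i₄ i₅)⁻¹ * Q.assocAt (Q.conv i₃ i₄) i₅ i₆ *
        (Q.assocAt (Q.conv i₁ i₂) (Q.conv i₃ i₄) (Q.conv i₅ i₆))⁻¹ *
        (Q.assocAt (Q.conv i₁ i₂) i₃ i₄)⁻¹ * Q.assocAt i₁ i₂ i₃ =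
      Q.assocAt i₃ (Q.conv i₄ i₅) i₆ *
        ((Q.assocAt (Q.conv i₁ i₂) i₃ (Q.conv (Q.conv i₄ i₅) i₆))⁻¹ *
        (Q.assocAt i₄ i₅ i₆ * Q.assocAt i₁ i₂ i₃ *
        (Q.assocAt (Q.conv i₁ (Q.conv i₂ i₃)) i₄ (Q.conv i₅ i₆))⁻¹)) := by
    have r₁ : (Q.assocAt (Q.conv i₁ i₂) (Q.conv i₃ i₄) (Q.conv i₅ i₆))⁻¹ *
        (Q.assocAt (Q.conv i₁ i₂) i₃ i₄)⁻¹ = Q.assocAt i₃ i₄ (Q.conv i₅ i₆) *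
        (Q.assocAt (Q.conv i₁ i₂) i₃ (Q.conv i₄ (Q.conv i₅ i₆)))⁻¹ *
        (Q.assocAt (Q.conv (Q.conv i₁ i₂) i₃) i₄ (Q.conv i₅ i₆))⁻¹ := by
      rw [← mul_inv_rev, eq_mul_inv_of_mul_eq p₁.symm]
      group
    have r₂ : (Q.assocAt i₃ i₄ i₅)⁻¹ * Q.assocAt (Q.conv i₃ i₄) i₅ i₆ =
        Q.assocAt i₃ (Q.conv i₄ i₅) i₆ * Q.assocAt i₄ i₅ i₆ *
          (Q.assocAt i₃ i₄ (Q.conv i₅ i₆))⁻¹ := by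
      rw [eq_mul_inv_of_mul_eq p₂]
      group
    have r₃ := congrArg (·⁻¹) q₁
    have r₄ := congrArg (·⁻¹) q₂
    simp only [mul_inv_rev, inv_inv] at r₃ r₄
    rw [mul_assoc _ (_)⁻¹ (_)⁻¹, r₁, r₂,
      show ∀ a A B s n m : Rˣ, (m * n * s⁻¹) * (s * B⁻¹ * A⁻¹) * a =
        m * (n * B⁻¹) * (A⁻¹ * a) from fun a A B s n m => by group, r₃, r₄]
    simp only [mul_assoc]
  have e₂ : ∀ v, E ↑(Q.assocAt i₃ (Q.conv i₄ i₅) i₆ * v) = E ↑v := fun v => by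
    simpa using LeftEq.map_mul_assocAt h₄₅ i₃ i₆ (u := 1) (fun _ => Commute.one_left _) v
  have e₃ : ∀ v, E ↑(v * (Q.assocAt (Q.conv i₁ (Q.conv i₂ i₃)) i₄ (Q.conv i₅ i₆))⁻¹) =
      E ↑(v * (Q.assocAt i₁ i₄ (Q.conv i₅ i₆))⁻¹) :=
    ((RightEq.conv_unitHom_right h₂₃ i₁).pair_left (pair i₄ (Q.conv i₅ i₆))).map_units
      Q.coassoc⁻¹
  have e₄ : ∀ v, E ↑((Q.assocAt (Q.conv i₁ i₂) i₃ (Q.conv (Q.conv i₄ i₅) i₆))⁻¹ * v) =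
      E ↑((Q.assocAt (Q.conv i₁ i₂) i₃ i₆)⁻¹ * v) :=
    (((LeftEq.conv_unitHom_left h₄₅ i₆).pair_right i₃).pair_right (Q.conv i₁ i₂)).map_units
      Q.coassoc⁻¹
  have e₅ : ∀ v, E ↑(v * Q.assocAt (Q.conv i₁ i₄) i₅ i₆) = E ↑v := fun v => by
    refine ((h₁₄.pair_left (pair i₅ i₆)).map_units Q.coassoc v).trans ?_
    change E ↑(v * Q.assocAt (Q.unitHom R) i₅ i₆) = _
    rw [assocAt_unitHom_left, mul_one]
  have e₆ : ∀ v, E ↑(Q.assocAt i₁ i₂ (Q.conv i₃ i₆) * v) = E ↑v := fun v => by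
    refine (((h₃₆.pair_right i₂).pair_right i₁).map_units Q.coassoc v).trans ?_
    change E ↑(Q.assocAt i₁ i₂ (Q.unitHom R) * v) = _
    rw [assocAt_unitHom_right, one_mul]
  have e₇ : (Q.assocAt (Q.conv i₁ i₂) i₃ i₆)⁻¹ *
        (Q.assocAt i₄ i₅ i₆ * Q.assocAt i₁ i₂ i₃) * (Q.assocAt i₁ i₄ (Q.conv i₅ i₆))⁻¹ =
      Q.assocAt i₁ i₂ (Q.conv i₃ i₆) * (((Q.assocAt i₂ i₃ i₆)⁻¹ *
        (Q.assocAt i₁ (Q.conv i₂ i₃) i₆)⁻¹) * ((Q.assocAt i₁ (Q.conv i₄ i₅) i₆)⁻¹ *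
        (Q.assocAt i₁ i₄ i₅)⁻¹)) * Q.assocAt (Q.conv i₁ i₄) i₅ i₆ := by
    rw [q₃, eq_inv_mul_of_mul_eq p₄, eq_mul_inv_of_mul_eq p₃]
    group
  rw [e₁, e₂, e₄, ← mul_assoc, e₃, e₇, e₅, e₆, LeftEq.map_mul_inv_assocAt h₄₅ i₁ i₆
    (fun a => (Commute.units_inv_left (Q.assocAt_commute i₂ i₃ i₆ (Q.conv i₄ i₅) a)).mul_left
      (Commute.units_inv_left (Q.assocAt_commute i₁ (Q.conv i₂ i₃) i₆ (Q.conv i₄ i₅) a))),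
    RightEq.map_inv_assocAt_mul h₂₃ i₁ i₆
      (fun a => Commute.units_inv_left (Q.assocAt_commute i₁ i₄ i₅ (Q.conv i₂ i₃) a))]

end SixLegs
end QuasiBialgebra

end

/-! ### Antipodes along a homomorphism and their uniqueness -/

section

open Algebra.TensorProduct (includeLeft includeRight)

section Slots

variable {A B R R' : Type*} [Ring A] [Algebra ℂ A] [Ring B] [Algebra ℂ B] [Ring R] [Algebra ℂ R]
  [Ring R'] [Algebra ℂ R']

instance (j : B →ₐ[ℂ] R') : CommHoms (includeLeft : R →ₐ[ℂ] R ⊗[ℂ] R')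
    ((includeRight : R' →ₐ[ℂ] R ⊗[ℂ] R').comp j) :=
  ⟨fun a b => by simp [Commute, SemiconjBy]⟩

instance (i : A →ₐ[ℂ] R) (j : B →ₐ[ℂ] R') : CommHoms ((includeLeft : R →ₐ[ℂ] R ⊗[ℂ] R').comp i)
    ((includeRight : R' →ₐ[ℂ] R ⊗[ℂ] R').comp j) :=
  ⟨fun a b => by simp [Commute, SemiconjBy]⟩

instance (g : R →ₐ[ℂ] R') (i : A →ₐ[ℂ] R) (j : B →ₐ[ℂ] R) [CommHoms i j] :
    CommHoms (g.comp i) (g.comp j) :=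
  ⟨fun a b => (CommHoms.comm (i := i) (j := j) a b).map g⟩

theorem pair_comp (g : R →ₐ[ℂ] R') (i : A →ₐ[ℂ] R) (j : B →ₐ[ℂ] R) [CommHoms i j] :
    pair (g.comp i) (g.comp j) = g.comp (pair i j) :=
  Algebra.TensorProduct.ext' fun a b => by simp

theorem QuasiBialgebra.conv_comp {H : Type*} [Ring H] [Algebra ℂ H] (Q : QuasiBialgebra H)
    (g : R →ₐ[ℂ] R') (i j : H →ₐ[ℂ] R) [CommHoms i j] :
    Q.conv (g.comp i) (g.comp j) = g.comp (Q.conv i j) := by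
  rw [conv, pair_comp]; rfl

theorem QuasiBialgebra.comp_unitHom {H : Type*} [Ring H] [Algebra ℂ H] (Q : QuasiBialgebra H)
    (g : R →ₐ[ℂ] R') : g.comp (Q.unitHom R) = Q.unitHom R' := by
  ext a; simp [unitHom_apply]

end Slots

section Glue

variable {H B R : Type*} [Ring H] [Algebra ℂ H] [Ring B] [Algebra ℂ B] [Ring R] [Algebra ℂ R]

/-- `x ⊗ r ↦ φ x * E r`. -/
def glue (φ : H →ₗ[ℂ] B) (E : R →ₗ[ℂ] B) : H ⊗[ℂ] R →ₗ[ℂ] B := mul2 ∘ₗ TensorProduct.map φ E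

@[simp]
theorem glue_tmul (φ : H →ₗ[ℂ] B) (E : R →ₗ[ℂ] B) (x : H) (r : R) :
    glue φ E (x ⊗ₜ r) = φ x * E r := rfl

@[simp]
theorem thenMul_apply {V : Type*} [AddCommGroup V] [Module ℂ V] (f : V →ₗ[ℂ] B) (c : B) (x : V) :
    thenMul f c x = f x * c := rfl

variable {φ : H →ₗ[ℂ] B} {E : R →ₗ[ℂ] B} {A : Type*} [Ring A] [Algebra ℂ A]

theorem LeftEq.glue {x y : A →ₐ[ℂ] R} (h : LeftEq E x y) :
    LeftEq (glue φ E) ((includeRight : R →ₐ[ℂ] H ⊗[ℂ] R).comp x) (includeRight.comp y) := by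
  intro a r
  induction r using TensorProduct.induction_on with
  | zero => simp
  | tmul p q => simp [h a q]
  | add p q hp hq => rw [mul_add, mul_add, map_add, map_add, hp, hq]

theorem RightEq.glue {x y : A →ₐ[ℂ] R} (h : RightEq E x y) :
    RightEq (glue φ E) ((includeRight : R →ₐ[ℂ] H ⊗[ℂ] R).comp x) (includeRight.comp y) := by
  intro a r
  induction r using TensorProduct.induction_on with
  | zero => simp
  | tmul p q => simp [h a q]
  | add p q hp hq => rw [add_mul, add_mul, map_add, map_add, hp, hq]

theorem glue_includeRight_mul {j : A →ₐ[ℂ] R} {c : A → B} (h : ∀ x r, E (j x * r) = E r * c x)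
    (x : A) (r : H ⊗[ℂ] R) :
    glue φ E ((includeRight : R →ₐ[ℂ] H ⊗[ℂ] R).comp j x * r) = glue φ E r * c x := by
  induction r using TensorProduct.induction_on with
  | zero => simp
  | tmul p q => simp [h x q, mul_assoc]
  | add p q hp hq => rw [mul_add, map_add, map_add, hp, hq, add_mul]

theorem glue_includeLeft_mul (f : H →ₐ[ℂ] B) (b : B) (x : H) (r : H ⊗[ℂ] R) :
    glue (thenMul f.toLinearMap b) E (includeLeft (S := ℂ) x * r) =
      f x * glue (thenMul f.toLinearMap b) E r := by
  induction r using TensorProduct.induction_on with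
  | zero => simp
  | tmul p q => simp [mul_assoc]
  | add p q hp hq => rw [mul_add, map_add, map_add, hp, hq, mul_add]

theorem glue_mul_includeLeft {s : H →ₗ[ℂ] B} (hs : ∀ x y, s (x * y) = s y * s x) (a : B) (x : H)
    (r : H ⊗[ℂ] R) :
    glue (thenMul s a) E (r * includeLeft (S := ℂ) x) = s x * glue (thenMul s a) E r := by
  induction r using TensorProduct.induction_on with
  | zero => simp
  | tmul p q => simp [mul_assoc, hs]
  | add p q hp hq => rw [add_mul, map_add, map_add, hp, hq, mul_add]

theorem mul_glue_of_intertwine {s s' : H →ₗ[ℂ] B} {a a' u : B} (hs : ∀ x, u * s x = s' x * u)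
    (ha : u * a = a') (r : H ⊗[ℂ] R) :
    u * glue (thenMul s a) E r = glue (thenMul s' a') E r := by
  induction r using TensorProduct.induction_on with
  | zero => simp
  | tmul p q =>
    simp only [glue_tmul, thenMul_apply, ← mul_assoc]
    rw [hs, mul_assoc (s' p), ha]
  | add p q hp hq => rw [map_add, map_add, mul_add, hp, hq]

end Glue

namespace QuasiBialgebra

variable {H B R : Type*} [Ring H] [Algebra ℂ H] [Ring B] [Algebra ℂ B] [Ring R] [Algebra ℂ R]
  (Q : QuasiBialgebra H)

/-- An antipode `s` with canonical elements `a` and `b`, relative to a homomorphism `f : H → B`. -/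
structure IsAntipode (f : H →ₐ[ℂ] B) (s : H →ₗ[ℂ] B) (a b : B) : Prop where
  map_one : s 1 = 1
  map_mul : ∀ x y, s (x * y) = s y * s x
  left : ∀ x, glue (thenMul s a) f.toLinearMap (Q.comul x) = Q.counit x • a
  right : ∀ x, glue (thenMul f.toLinearMap b) s (Q.comul x) = Q.counit x • b
  coassoc : glue (thenMul s a) (glue (thenMul f.toLinearMap b) s) (Q.coassoc : Tensor3 H) = 1
  coassoc_inv : glue (thenMul f.toLinearMap b) (glue (thenMul s a) f.toLinearMap)
    (↑Q.coassoc⁻¹ : Tensor3 H) = 1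

variable {Q} {f : H →ₐ[ℂ] B} {s s' : H →ₗ[ℂ] B} {a b a' b' : B} {E : R →ₗ[ℂ] B}
  {j : H →ₐ[ℂ] R}

/-- This puts the axiom s(x₁) a f(x₂) = ε(x) a inside a longer word. It suffices that the rest `E`
of the word releases a left factor f(x) when its leg `j` is multiplied by x. -/
theorem leftEq_glue (hs : ∀ x y, s (x * y) = s y * s x)
    (ha : ∀ x, glue (thenMul s a) f.toLinearMap (Q.comul x) = Q.counit x • a)
    (hE : ∀ x r, E (j x * r) = f x * E r) :
    LeftEq (glue (thenMul s a) E) (Q.conv includeLeft (includeRight.comp j))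
      (Q.unitHom (H ⊗[ℂ] R)) := by
  intro x r
  induction r using TensorProduct.induction_on with
  | zero => simp
  | tmul p q =>
    have key : ∀ t : Tensor2 H, glue (thenMul s a) E
        (pair (includeLeft : H →ₐ[ℂ] H ⊗[ℂ] R) (includeRight.comp j) t * (p ⊗ₜ q)) =
        s p * glue (thenMul s a) f.toLinearMap t * E q := fun t => by
      induction t using TensorProduct.induction_on with
      | zero => simp
      | tmul y z => simp [hs, hE, mul_assoc]
      | add y z hy hz => rw [map_add, add_mul, map_add, hy, hz, map_add, mul_add, add_mul]
    rw [conv_apply, key, ha, unitHom_apply, ← Algebra.smul_def, map_smul]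
    simp
  | add p q hp hq => rw [mul_add, mul_add, map_add, map_add, hp, hq]

theorem rightEq_glue (hb : ∀ x, glue (thenMul f.toLinearMap b) s (Q.comul x) = Q.counit x • b)
    (hE : ∀ x r, E (r * j x) = s x * E r) :
    RightEq (glue (thenMul f.toLinearMap b) E) (Q.conv includeLeft (includeRight.comp j))
      (Q.unitHom (H ⊗[ℂ] R)) := by
  intro x r
  induction r using TensorProduct.induction_on with
  | zero => simp
  | tmul p q =>
    have key : ∀ t : Tensor2 H, glue (thenMul f.toLinearMap b) E
        ((p ⊗ₜ q) * pair (includeLeft : H →ₐ[ℂ] H ⊗[ℂ] R) (includeRight.comp j) t) =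
        f p * glue (thenMul f.toLinearMap b) s t * E q := fun t => by
      induction t using TensorProduct.induction_on with
      | zero => simp
      | tmul y z => simp [hE, mul_assoc]
      | add y z hy hz => rw [map_add, mul_add, map_add, hy, hz, map_add, mul_add, add_mul]
    rw [conv_apply, key, hb, unitHom_apply, ← Algebra.commutes, ← Algebra.smul_def, map_smul]
    simp
  | add p q hp hq => rw [add_mul, add_mul, map_add, map_add, hp, hq]

namespace IsAntipode

/-- The comparison element `s'(X) a' f(Y) b s(Z)` of two relative antipodes. -/
def link (Q : QuasiBialgebra H) (f : H →ₐ[ℂ] B) (s' : H →ₗ[ℂ] B) (a' : B) (b : B)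
    (s : H →ₗ[ℂ] B) : B :=
  glue (thenMul s' a') (glue (thenMul f.toLinearMap b) s) (Q.coassoc : Tensor3 H)

/-- Multiply 1 = s(X) a f(Y) b s(Z) by u on the left and push u past s(X) and onto a. Neither
invertibility of u nor any axiom for s' enters. -/
theorem eq_link (h : Q.IsAntipode f s a b) {u : B} (hs : ∀ x, u * s x = s' x * u)
    (ha : u * a = a') : u = link Q f s' a' b s := by
  rw [link, ← mul_glue_of_intertwine hs ha, h.coassoc, mul_one]

/-- Insert an iterated co-product of x next to Φ. On its left, legs 1 and 2 contract and leave s(x)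
at the right of the word; on its right, legs 2 and 3 contract and leave s'(x) at the left.
Quasi-co-associativity equates the two insertions. -/
theorem link_mul_antipode (h : Q.IsAntipode f s a b) (h' : Q.IsAntipode f s' a' b') (x : H) :
    link Q f s' a' b s * s x = s' x * link Q f s' a' b s := by
  set E := glue (thenMul s' a') (glue (thenMul f.toLinearMap b) s)
  let i₁ : H →ₐ[ℂ] Tensor3 H := includeLeft
  let i₂ : H →ₐ[ℂ] Tensor3 H := includeRight.comp includeLeft
  let i₃ : H →ₐ[ℂ] Tensor3 H := includeRight.comp (includeRight.comp (AlgHom.id ℂ H))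
  have e : (Q.assocAt i₁ i₂ i₃ : Tensor3 H) = Q.coassoc := by
    have : (pair i₁ (pair i₂ i₃)).toLinearMap = LinearMap.id := by
      ext x y z
      simp [i₁, i₂, i₃]
    exact DFunLike.congr_fun this (Q.coassoc : Tensor3 H)
  have h₁₂ : LeftEq E (Q.conv i₁ i₂) (Q.unitHom _) :=
    leftEq_glue h'.map_mul h'.left (glue_includeLeft_mul f b)
  have h₂₃ : RightEq E (Q.conv i₂ i₃) (Q.unitHom _) := by
    have := (rightEq_glue (E := s) (j := AlgHom.id ℂ H) h.right fun x r => h.map_mul r x).glue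
      (φ := thenMul s' a')
    rwa [comp_unitHom, ← conv_comp] at this
  have h₁ := RightEq.conv_unitHom_right h₂₃ i₁ x (Q.assocAt i₁ i₂ i₃)
  have h₂ := LeftEq.conv_unitHom_left h₁₂ i₃ x (Q.assocAt i₁ i₂ i₃)
  rw [assocAt_mul_conv, h₂, glue_mul_includeLeft h'.map_mul, glue_includeRight_mul (c := s), e] at h₁
  · exact h₁
  · exact glue_includeRight_mul fun x r => h.map_mul x r

/-- Contract the pentagon with the word s'(x) a' f(y) b s(z) a f(t). The co-associator on the first
three legs gives the link times a; its inverse on the last three gives a' times f(X̄) b s(Ȳ) a f(Z̄)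
= 1. -/
theorem link_mul_left (h : Q.IsAntipode f s a b) (h' : Q.IsAntipode f s' a' b') :
    link Q f s' a' b s * a = a' := by
  let E := glue (thenMul s' a') (glue (thenMul f.toLinearMap b)
    (glue (thenMul s a) f.toLinearMap))
  let i₁ : H →ₐ[ℂ] Tensor4 H := includeLeft
  let i₂ : H →ₐ[ℂ] Tensor4 H := includeRight.comp includeLeft
  let i₃ : H →ₐ[ℂ] Tensor4 H := includeRight.comp (includeRight.comp includeLeft)
  let i₄ : H →ₐ[ℂ] Tensor4 H := includeRight.comp (includeRight.comp
    (includeRight.comp (AlgHom.id ℂ H)))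
  have h₁₂ : LeftEq E (Q.conv i₁ i₂) (Q.unitHom _) :=
    leftEq_glue h'.map_mul h'.left (glue_includeLeft_mul f b)
  have h₂₃ : RightEq E (Q.conv i₂ i₃) (Q.unitHom _) := by
    have := (rightEq_glue h.right (glue_mul_includeLeft h.map_mul a (E := f.toLinearMap))).glue
      (φ := thenMul s' a')
    rwa [comp_unitHom, ← conv_comp] at this
  have h₃₄ : LeftEq E (Q.conv i₃ i₄) (Q.unitHom _) := by
    have := ((leftEq_glue (E := f.toLinearMap) (j := AlgHom.id ℂ H) h.map_mul h.left
      fun x r => _root_.map_mul f x r).glue (φ := thenMul f.toLinearMap b)).glue (φ := thenMul s' a')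
    rwa [comp_unitHom, comp_unitHom, ← conv_comp, ← conv_comp] at this
  have key := map_assocAt_eq_map_inv h₁₂ h₂₃ h₃₄
  have e₁ : ∀ t : Tensor3 H, E (pair i₁ (pair i₂ i₃) t) =
      glue (thenMul s' a') (glue (thenMul f.toLinearMap b) s) t * a := by
    intro t
    have : E ∘ₗ (pair i₁ (pair i₂ i₃)).toLinearMap = LinearMap.mulRight ℂ a ∘ₗ
        glue (thenMul s' a') (glue (thenMul f.toLinearMap b) s) := by
      ext x y z
      simp [E, i₁, i₂, i₃, mul_assoc]
    exact DFunLike.congr_fun this t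
  have e₂ : ∀ t : Tensor3 H, E (pair i₂ (pair i₃ i₄) t) =
      a' * glue (thenMul f.toLinearMap b) (glue (thenMul s a) f.toLinearMap) t := by
    intro t
    have : E ∘ₗ (pair i₂ (pair i₃ i₄)).toLinearMap = LinearMap.mulLeft ℂ a' ∘ₗ
        glue (thenMul f.toLinearMap b) (glue (thenMul s a) f.toLinearMap) := by
      ext x y z
      simp [E, i₂, i₃, i₄, h'.map_one]
    exact DFunLike.congr_fun this t
  rw [coe_assocAt, e₁, coe_inv_assocAt, e₂, h.coassoc_inv, mul_one] at key
  exact key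

/-- The mirror argument, for the word f(x) b' s'(y) a' f(z) b s(t). -/
theorem right_mul_link (h : Q.IsAntipode f s a b) (h' : Q.IsAntipode f s' a' b') :
    b' * link Q f s' a' b s = b := by
  let E := glue (thenMul f.toLinearMap b') (glue (thenMul s' a')
    (glue (thenMul f.toLinearMap b) s))
  let i₁ : H →ₐ[ℂ] Tensor4 H := includeLeft
  let i₂ : H →ₐ[ℂ] Tensor4 H := includeRight.comp includeLeft
  let i₃ : H →ₐ[ℂ] Tensor4 H := includeRight.comp (includeRight.comp includeLeft)
  let i₄ : H →ₐ[ℂ] Tensor4 H := includeRight.comp (includeRight.comp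
    (includeRight.comp (AlgHom.id ℂ H)))
  have h₁₂ : RightEq E (Q.conv i₁ i₂) (Q.unitHom _) :=
    rightEq_glue h'.right (glue_mul_includeLeft h'.map_mul a')
  have h₂₃ : LeftEq E (Q.conv i₂ i₃) (Q.unitHom _) := by
    have := (leftEq_glue h'.map_mul h'.left (glue_includeLeft_mul f b (E := s))).glue
      (φ := thenMul f.toLinearMap b')
    rwa [comp_unitHom, ← conv_comp] at this
  have h₃₄ : RightEq E (Q.conv i₃ i₄) (Q.unitHom _) := by
    have := ((rightEq_glue (E := s) (j := AlgHom.id ℂ H) h.right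
      fun x r => h.map_mul r x).glue (φ := thenMul s' a')).glue (φ := thenMul f.toLinearMap b')
    rwa [comp_unitHom, comp_unitHom, ← conv_comp, ← conv_comp] at this
  have key := map_assocAt_eq_map_inv' h₁₂ h₂₃ h₃₄
  have e₁ : ∀ t : Tensor3 H, E (pair i₁ (pair i₂ i₃) t) =
      glue (thenMul f.toLinearMap b') (glue (thenMul s' a') f.toLinearMap) t * b := by
    intro t
    have : E ∘ₗ (pair i₁ (pair i₂ i₃)).toLinearMap = LinearMap.mulRight ℂ b ∘ₗ
        glue (thenMul f.toLinearMap b') (glue (thenMul s' a') f.toLinearMap) := by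
      ext x y z
      simp [E, i₁, i₂, i₃, mul_assoc, h.map_one]
    exact DFunLike.congr_fun this t
  have e₂ : ∀ t : Tensor3 H, E (pair i₂ (pair i₃ i₄) t) =
      b' * glue (thenMul s' a') (glue (thenMul f.toLinearMap b) s) t := by
    intro t
    have : E ∘ₗ (pair i₂ (pair i₃ i₄)).toLinearMap = LinearMap.mulLeft ℂ b' ∘ₗ
        glue (thenMul s' a') (glue (thenMul f.toLinearMap b) s) := by
      ext x y z
      simp [E, i₂, i₃, i₄]
    exact DFunLike.congr_fun this t
  rw [coe_assocAt, e₂, coe_inv_assocAt, e₁, h'.coassoc_inv, one_mul] at key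
  exact key

/-- Two relative antipodes along the same homomorphism differ by a unique unit. -/
theorem exists_unit (h : Q.IsAntipode f s a b) (h' : Q.IsAntipode f s' a' b') :
    ∃ u : Bˣ, (u : B) = link Q f s' a' b s ∧ (∀ x, u * s x = s' x * u) ∧ u * a = a' ∧
      b' * u = b := by
  -- The product of the two opposite links commutes with every s(x) and fixes a, two relations that
  -- by `eq_link` only 1 satisfies.
  have comp : ∀ {s s' : H →ₗ[ℂ] B} {a b a' b' : B}, Q.IsAntipode f s a b →
      Q.IsAntipode f s' a' b' → link Q f s a b' s' * link Q f s' a' b s = 1 := by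
    intro s s' a b a' b' h h'
    refine (h.eq_link (s' := s) (a' := a) (fun x => ?_) ?_).trans h.coassoc
    · rw [mul_assoc, link_mul_antipode h h', ← mul_assoc, link_mul_antipode h' h, mul_assoc]
    · rw [mul_assoc, link_mul_left h h', link_mul_left h' h]
  exact ⟨⟨link Q f s' a' b s, link Q f s a b' s', comp h' h, comp h h'⟩, rfl,
    link_mul_antipode h h', link_mul_left h h', right_mul_link h h'⟩

end IsAntipode
end QuasiBialgebra

namespace QuasiHopf
variable {H : Type*} [Ring H] [Algebra ℂ H] (Q : QuasiHopf H)

/-- The underlying quasi-bialgebra. -/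
def toQuasiBialgebra : QuasiBialgebra H where
  comul := Q.comul
  counit := Q.counit
  coassoc := Q.coassoc
  counitLeft_comul := Q.counitLeft_comul
  counitRight_comul := Q.counitRight_comul
  quasi_coassoc := Q.quasi_coassoc
  pentagon := Q.pentagon
  counit_coassoc := Q.counit_coassoc

theorem S_mul (x y : H) : Q.S (x * y) = Q.S y * Q.S x := Q.antipode_mul x y

theorem S_Sinv (x : H) : Q.S (Q.Sinv x) = x := Q.antipode.apply_symm_apply x

theorem Sinv_S (x : H) : Q.Sinv (Q.S x) = x := Q.antipode.symm_apply_apply x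

theorem S_one : Q.S 1 = 1 := by
  have h := Q.S_mul (Q.Sinv 1) 1
  rwa [mul_one, S_Sinv, mul_one, eq_comm] at h

theorem Sinv_one : Q.Sinv 1 = 1 := by rw [← Q.S_one, Sinv_S, S_one]

theorem Sinv_mul (x y : H) : Q.Sinv (x * y) = Q.Sinv y * Q.Sinv x := by
  rw [← Q.Sinv_S (Q.Sinv y * Q.Sinv x), S_mul, S_Sinv, S_Sinv]

theorem isAntipode_S :
    Q.toQuasiBialgebra.IsAntipode (AlgHom.id ℂ H) Q.S Q.α Q.β where
  map_one := Q.S_one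
  map_mul := Q.S_mul
  left := Q.antipode_left
  right := Q.antipode_right
  coassoc := by
    have : glue (thenMul Q.S Q.α) (glue (thenMul (AlgHom.id ℂ H).toLinearMap Q.β) Q.S) =
        mul3 ∘ₗ TensorProduct.map (thenMul Q.S Q.α)
          (TensorProduct.map (thenMul LinearMap.id Q.β) Q.S) := by
      ext x y z
      simp [mul3, mul2]
    exact (DFunLike.congr_fun this _).trans Q.antipode_coassoc
  coassoc_inv := by
    have : glue (thenMul (AlgHom.id ℂ H).toLinearMap Q.β)
        (glue (thenMul Q.S Q.α) (AlgHom.id ℂ H).toLinearMap) =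
        mul3 ∘ₗ TensorProduct.map (thenMul LinearMap.id Q.β)
          (TensorProduct.map (thenMul Q.S Q.α) LinearMap.id) := by
      ext x y z
      simp [mul3, mul2]
    exact (DFunLike.congr_fun this _).trans Q.antipode_coassoc_inv

end QuasiHopf

end

/-! ### Drinfeld's elements γ and δ and the flipped antipode -/

section

open Algebra.TensorProduct (includeLeft includeRight)

section

variable {H : Type*} [Ring H] [Algebra ℂ H]

theorem tensor4_induction {p : Tensor4 H → Prop} (t : Tensor4 H) (zero : p 0)
    (tmul : ∀ a b c d : H, p (a ⊗ₜ (b ⊗ₜ (c ⊗ₜ d)))) (add : ∀ x y, p x → p y → p (x + y)) :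
    p t := by
  induction t using TensorProduct.induction_on with
  | zero => exact zero
  | add x y hx hy => exact add x y hx hy
  | tmul a t =>
    induction t using TensorProduct.induction_on with
    | zero => rwa [TensorProduct.tmul_zero]
    | add x y hx hy => rw [TensorProduct.tmul_add]; exact add _ _ hx hy
    | tmul b t =>
      induction t using TensorProduct.induction_on with
      | zero => rwa [TensorProduct.tmul_zero, TensorProduct.tmul_zero]
      | add x y hx hy => rw [TensorProduct.tmul_add, TensorProduct.tmul_add]; exact add _ _ hx hy
      | tmul c d => exact tmul a b c d

variable {A R R' V V' : Type*} [Ring A] [Algebra ℂ A] [Ring R] [Algebra ℂ R]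
  [Ring R'] [Algebra ℂ R'] [AddCommGroup V] [Module ℂ V] [AddCommGroup V'] [Module ℂ V']
  {E : R →ₗ[ℂ] V} {E' : R' →ₗ[ℂ] V'}

theorem LeftEq.map_includeLeft {x y : A →ₐ[ℂ] R} (h : LeftEq E x y) :
    LeftEq (TensorProduct.map E E') ((includeLeft : R →ₐ[ℂ] R ⊗[ℂ] R').comp x)
      (includeLeft.comp y) := by
  intro a r
  induction r using TensorProduct.induction_on with
  | zero => simp
  | tmul p q => simp [h a p]
  | add p q hp hq => rw [mul_add, mul_add, map_add, map_add, hp, hq]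

theorem LeftEq.map_includeRight {x y : A →ₐ[ℂ] R'} (h : LeftEq E' x y) :
    LeftEq (TensorProduct.map E E') ((includeRight : R' →ₐ[ℂ] R ⊗[ℂ] R').comp x)
      (includeRight.comp y) := by
  intro a r
  induction r using TensorProduct.induction_on with
  | zero => simp
  | tmul p q => simp [h a q]
  | add p q hp hq => rw [mul_add, mul_add, map_add, map_add, hp, hq]

theorem RightEq.map_includeLeft {x y : A →ₐ[ℂ] R} (h : RightEq E x y) :
    RightEq (TensorProduct.map E E') ((includeLeft : R →ₐ[ℂ] R ⊗[ℂ] R').comp x)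
      (includeLeft.comp y) := by
  intro a r
  induction r using TensorProduct.induction_on with
  | zero => simp
  | tmul p q => simp [h a p]
  | add p q hp hq => rw [add_mul, add_mul, map_add, map_add, hp, hq]

theorem RightEq.map_includeRight {x y : A →ₐ[ℂ] R'} (h : RightEq E' x y) :
    RightEq (TensorProduct.map E E') ((includeRight : R' →ₐ[ℂ] R ⊗[ℂ] R').comp x)
      (includeRight.comp y) := by
  intro a r
  induction r using TensorProduct.induction_on with
  | zero => simp
  | tmul p q => simp [h a q]
  | add p q hp hq => rw [add_mul, add_mul, map_add, map_add, hp, hq]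

end

section Slots

variable (H : Type*) [Ring H] [Algebra ℂ H]

/-- The first slot of `H ⊗ H`. -/
abbrev slot₁ : H →ₐ[ℂ] Tensor2 H := includeLeft

/-- The second slot of `H ⊗ H`. -/
abbrev slot₂ : H →ₐ[ℂ] Tensor2 H := includeRight.comp (AlgHom.id ℂ H)

/-- The first slot of `H ⊗ H ⊗ H`. -/
abbrev slot3₁ : H →ₐ[ℂ] Tensor3 H := includeLeft

/-- The second slot of `H ⊗ H ⊗ H`. -/
abbrev slot3₂ : H →ₐ[ℂ] Tensor3 H := includeRight.comp (slot₁ H)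

/-- The third slot of `H ⊗ H ⊗ H`. -/
abbrev slot3₃ : H →ₐ[ℂ] Tensor3 H := includeRight.comp (slot₂ H)

variable {H} {R R' : Type*} [Ring R] [Algebra ℂ R] [Ring R'] [Algebra ℂ R']

/-- `i` in the first leg of `R ⊗ R'`. -/
abbrev inl (R' : Type*) [Ring R'] [Algebra ℂ R'] (i : H →ₐ[ℂ] R) : H →ₐ[ℂ] R ⊗[ℂ] R' :=
  includeLeft.comp i

/-- `i` in the second leg of `R ⊗ R'`. -/
abbrev inr (R : Type*) [Ring R] [Algebra ℂ R] (i : H →ₐ[ℂ] R') : H →ₐ[ℂ] R ⊗[ℂ] R' :=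
  includeRight.comp i

end Slots

namespace QuasiBialgebra

variable {H : Type*} [Ring H] [Algebra ℂ H] (Q : QuasiBialgebra H)

/-- `(Φ⁻¹ ⊗ 1)(Δ ⊗ 1 ⊗ 1)Φ`. -/
def gammaTensor : Tensor4 H :=
  oneFourth (↑Q.coassoc⁻¹ : Tensor3 H) * deltaFirst Q.comul (Q.coassoc : Tensor3 H)

/-- `(Δ ⊗ 1 ⊗ 1)Φ⁻¹(Φ ⊗ 1)`. -/
def deltaTensor : Tensor4 H :=
  deltaFirst Q.comul (↑Q.coassoc⁻¹ : Tensor3 H) * oneFourth (Q.coassoc : Tensor3 H)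

section

variable {R : Type*} [Ring R] [Algebra ℂ R] (i j k l : H →ₐ[ℂ] R) [CommHoms i j] [CommHoms i k]
  [CommHoms i l] [CommHoms j k] [CommHoms j l] [CommHoms k l]

theorem pair_gammaTensor : pair i (pair j (pair k l)) Q.gammaTensor =
    ↑((Q.assocAt i j k)⁻¹ * Q.assocAt (Q.conv i j) k l) := by
  rw [gammaTensor, map_mul, ← AlgHom.comp_apply, ← AlgHom.comp_apply, pair_comp_oneFourth,
    pair_comp_deltaFirst, Units.val_mul, coe_assocAt, coe_inv_assocAt]

theorem pair_deltaTensor : pair i (pair j (pair k l)) Q.deltaTensor =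
    ↑((Q.assocAt (Q.conv i j) k l)⁻¹ * Q.assocAt i j k) := by
  rw [deltaTensor, map_mul, ← AlgHom.comp_apply, ← AlgHom.comp_apply, pair_comp_oneFourth,
    pair_comp_deltaFirst, Units.val_mul, coe_assocAt, coe_inv_assocAt]

end

/-- `(y ⊗ z) ⊗ (x ⊗ t) ↦ s(y) a z ⊗ s(x) a t`. -/
def leftLegs (s : H →ₗ[ℂ] H) (a : H) : Tensor2 H ⊗[ℂ] Tensor2 H →ₗ[ℂ] Tensor2 H :=
  TensorProduct.map (glue (thenMul s a) (AlgHom.id ℂ H).toLinearMap)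
    (glue (thenMul s a) (AlgHom.id ℂ H).toLinearMap)

/-- `(x ⊗ t) ⊗ (y ⊗ z) ↦ x b s(t) ⊗ y b s(z)`. -/
def rightLegs (b : H) (s : H →ₗ[ℂ] H) : Tensor2 H ⊗[ℂ] Tensor2 H →ₗ[ℂ] Tensor2 H :=
  TensorProduct.map (glue (thenMul (AlgHom.id ℂ H).toLinearMap b) s)
    (glue (thenMul (AlgHom.id ℂ H).toLinearMap b) s)

variable (H) in
/-- `x ⊗ y ⊗ z ⊗ t ↦ (y ⊗ z) ⊗ (x ⊗ t)`. -/
def leftSlots : Tensor4 H →ₐ[ℂ] Tensor2 H ⊗[ℂ] Tensor2 H :=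
  pair (inr _ (slot₁ H)) (pair (inl _ (slot₁ H)) (pair (inl _ (slot₂ H)) (inr _ (slot₂ H))))

variable (H) in
/-- `x ⊗ y ⊗ z ⊗ t ↦ (x ⊗ t) ⊗ (y ⊗ z)`. -/
def rightSlots : Tensor4 H →ₐ[ℂ] Tensor2 H ⊗[ℂ] Tensor2 H :=
  pair (inl _ (slot₁ H)) (pair (inr _ (slot₁ H)) (pair (inr _ (slot₂ H)) (inl _ (slot₂ H))))

/-- Drinfeld's element `γ`. -/
def gammaElt (s : H →ₗ[ℂ] H) (a : H) : Tensor2 H := leftLegs s a (leftSlots H Q.gammaTensor)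

/-- Drinfeld's element `δ`. -/
def deltaElt (b : H) (s : H →ₗ[ℂ] H) : Tensor2 H := rightLegs b s (rightSlots H Q.deltaTensor)

/-- `(s ⊗ s)Δᵀ`. -/
def flipAntipode (s : H →ₗ[ℂ] H) : H →ₗ[ℂ] Tensor2 H :=
  both s ∘ₗ (tensorFlip (A := H)).toLinearMap ∘ₗ Q.comul.toLinearMap

variable {Q} {s : H →ₗ[ℂ] H} {a b : H}

@[simp]
theorem both_tmul (s : H →ₗ[ℂ] H) (x y : H) : both s (x ⊗ₜ y) = s x ⊗ₜ s y := rfl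

@[simp]
theorem tensorFlip_tmul (x y : H) : tensorFlip (x ⊗ₜ[ℂ] y) = y ⊗ₜ x := rfl

theorem both_flip_mul (hs : ∀ x y, s (x * y) = s y * s x) (t u : Tensor2 H) :
    both s (tensorFlip (t * u)) = both s (tensorFlip u) * both s (tensorFlip t) := by
  induction t using TensorProduct.induction_on with
  | zero => simp
  | tmul x y =>
    induction u using TensorProduct.induction_on with
    | zero => simp
    | tmul z w => simp [hs]
    | add x y hx hy => rw [mul_add, map_add, map_add, hx, hy, map_add, map_add, add_mul]
  | add x y hx hy => rw [add_mul, map_add, map_add, hx, hy, map_add, map_add, mul_add]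

section LeftLegs

theorem leftLegs_leftEq_inl (h : Q.IsAntipode (AlgHom.id ℂ H) s a b) :
    LeftEq (leftLegs s a) (Q.conv (inl (Tensor2 H) (slot₁ H)) (inl _ (slot₂ H)))
      (Q.unitHom _) := by
  have := (leftEq_glue (E := (AlgHom.id ℂ H).toLinearMap) (j := AlgHom.id ℂ H) h.map_mul h.left
    fun x r => rfl).map_includeLeft (E' := glue (thenMul s a) (AlgHom.id ℂ H).toLinearMap)
  rwa [comp_unitHom, ← conv_comp] at this

theorem leftLegs_leftEq_inr (h : Q.IsAntipode (AlgHom.id ℂ H) s a b) :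
    LeftEq (leftLegs s a) (Q.conv (inr (Tensor2 H) (slot₁ H)) (inr _ (slot₂ H)))
      (Q.unitHom _) := by
  have := (leftEq_glue (E := (AlgHom.id ℂ H).toLinearMap) (j := AlgHom.id ℂ H) h.map_mul h.left
    fun x r => rfl).map_includeRight (E := glue (thenMul s a) (AlgHom.id ℂ H).toLinearMap)
  rwa [comp_unitHom, ← conv_comp] at this

theorem rightLegs_rightEq_inl (h : Q.IsAntipode (AlgHom.id ℂ H) s a b) :
    RightEq (rightLegs b s) (Q.conv (inl (Tensor2 H) (slot₁ H)) (inl _ (slot₂ H)))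
      (Q.unitHom _) := by
  have := (rightEq_glue (E := s) (j := AlgHom.id ℂ H) h.right
    fun x r => h.map_mul r x).map_includeLeft
      (E' := glue (thenMul (AlgHom.id ℂ H).toLinearMap b) s)
  rwa [comp_unitHom, ← conv_comp] at this

theorem rightLegs_rightEq_inr (h : Q.IsAntipode (AlgHom.id ℂ H) s a b) :
    RightEq (rightLegs b s) (Q.conv (inr (Tensor2 H) (slot₁ H)) (inr _ (slot₂ H)))
      (Q.unitHom _) := by
  have := (rightEq_glue (E := s) (j := AlgHom.id ℂ H) h.right
    fun x r => h.map_mul r x).map_includeRight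
      (E := glue (thenMul (AlgHom.id ℂ H).toLinearMap b) s)
  rwa [comp_unitHom, ← conv_comp] at this

theorem leftLegs_mul (hs : ∀ x y, s (x * y) = s y * s x) (t : Tensor2 H ⊗[ℂ] Tensor2 H)
    (p q : Tensor2 H) :
    leftLegs s a (t * (pair (inr _ (slot₁ H)) (inl _ (slot₁ H)) p *
      pair (inl _ (slot₂ H)) (inr _ (slot₂ H)) q)) =
      both s (tensorFlip p) * leftLegs s a t * q := by
  induction p using TensorProduct.induction_on with
  | zero => simp
  | add x y hx hy => simp only [map_add, add_mul, mul_add, hx, hy]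
  | tmul p₁ p₂ =>
  induction q using TensorProduct.induction_on with
  | zero => simp
  | add x y hx hy => simp only [map_add, mul_add, hx, hy]
  | tmul q₁ q₂ =>
  induction t using TensorProduct.induction_on with
  | zero => simp
  | add x y hx hy => simp only [map_add, add_mul, mul_add, hx, hy]
  | tmul t u =>
  induction t using TensorProduct.induction_on with
  | zero => simp
  | add x y hx hy => simp only [TensorProduct.add_tmul, map_add, add_mul, mul_add, hx, hy]
  | tmul t₁ t₂ =>
  induction u using TensorProduct.induction_on with
  | zero => simp
  | add x y hx hy => simp only [TensorProduct.tmul_add, map_add, add_mul, mul_add, hx, hy]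
  | tmul u₁ u₂ => simp [leftLegs, hs, mul_assoc]

theorem rightLegs_mul (hs : ∀ x y, s (x * y) = s y * s x) (t : Tensor2 H ⊗[ℂ] Tensor2 H)
    (p q : Tensor2 H) :
    rightLegs b s (pair (inl _ (slot₁ H)) (inr _ (slot₁ H)) p *
      pair (inr _ (slot₂ H)) (inl _ (slot₂ H)) q * t) =
      p * rightLegs b s t * both s (tensorFlip q) := by
  induction p using TensorProduct.induction_on with
  | zero => simp
  | add x y hx hy => simp only [map_add, add_mul, hx, hy]
  | tmul p₁ p₂ =>
  induction q using TensorProduct.induction_on with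
  | zero => simp
  | add x y hx hy => simp only [map_add, add_mul, mul_add, hx, hy]
  | tmul q₁ q₂ =>
  induction t using TensorProduct.induction_on with
  | zero => simp
  | add x y hx hy => simp only [map_add, add_mul, mul_add, hx, hy]
  | tmul t u =>
  induction t using TensorProduct.induction_on with
  | zero => simp
  | add x y hx hy => simp only [TensorProduct.add_tmul, map_add, add_mul, mul_add, hx, hy]
  | tmul t₁ t₂ =>
  induction u using TensorProduct.induction_on with
  | zero => simp
  | add x y hx hy => simp only [TensorProduct.tmul_add, map_add, add_mul, mul_add, hx, hy]
  | tmul u₁ u₂ => simp [rightLegs, hs, mul_assoc]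

end LeftLegs

section

variable {R : Type*} [Ring R] [Algebra ℂ R] (i j k l : H →ₐ[ℂ] R) [CommHoms i j] [CommHoms i k]
  [CommHoms i l] [CommHoms j k] [CommHoms j l] [CommHoms k l]

/-- The two co-associators rebracket (12)(34) as ((12)3)4 and then as (1(23))4. In that form the
word of γ contracts the inner pair 2, 3 and then the outer pair 1, 4. -/
theorem pair_gammaTensor_mul_conv (x : H) : pair i (pair j (pair k l)) Q.gammaTensor *
    Q.conv (Q.conv i j) (Q.conv k l) x =
    Q.conv (Q.conv i (Q.conv j k)) l x * pair i (pair j (pair k l)) Q.gammaTensor := by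
  rw [pair_gammaTensor, Units.val_mul, mul_assoc, assocAt_mul_conv, ← mul_assoc, ← mul_assoc]
  congr 1
  exact pair_intertwine Q.conv_mul_inv_assocAt
    (fun a => (Commute.units_inv_left (Q.assocAt_commute i j k l a)).eq) _

theorem conv_mul_pair_deltaTensor (x : H) : Q.conv (Q.conv i j) (Q.conv k l) x *
    pair i (pair j (pair k l)) Q.deltaTensor =
    pair i (pair j (pair k l)) Q.deltaTensor * Q.conv (Q.conv i (Q.conv j k)) l x := by
  rw [pair_deltaTensor, Units.val_mul, ← mul_assoc, ← conv_mul_inv_assocAt, mul_assoc, mul_assoc]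
  congr 1
  exact (pair_intertwine (Q.assocAt_mul_conv i j k) (fun a => (Q.assocAt_commute i j k l a).eq)
    _).symm

end

theorem glue_flipAntipode_gamma (hs : ∀ x y, s (x * y) = s y * s x) (t : Tensor2 H) :
    glue (thenMul (Q.flipAntipode s) (Q.gammaElt s a)) Q.comul.toLinearMap t =
      leftLegs s a (leftSlots H Q.gammaTensor *
        pair (Q.conv (inr _ (slot₁ H)) (inl _ (slot₁ H)))
          (Q.conv (inl _ (slot₂ H)) (inr _ (slot₂ H))) t) := by
  induction t using TensorProduct.induction_on with
  | zero => simp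
  | add x y hx hy => simp only [map_add, mul_add, hx, hy]
  | tmul x y =>
    rw [pair_tmul, conv_apply, conv_apply, leftLegs_mul hs]
    rfl

theorem glue_delta_flipAntipode (hs : ∀ x y, s (x * y) = s y * s x) (t : Tensor2 H) :
    glue (thenMul Q.comul.toLinearMap (Q.deltaElt b s)) (Q.flipAntipode s) t =
      rightLegs b s (pair (Q.conv (inl _ (slot₁ H)) (inr _ (slot₁ H)))
        (Q.conv (inr _ (slot₂ H)) (inl _ (slot₂ H))) t * rightSlots H Q.deltaTensor) := by
  induction t using TensorProduct.induction_on with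
  | zero => simp
  | add x y hx hy => simp only [map_add, add_mul, hx, hy]
  | tmul x y =>
    rw [pair_tmul, conv_apply, conv_apply, rightLegs_mul hs]
    rfl

theorem flipAntipode_gamma_comul (h : Q.IsAntipode (AlgHom.id ℂ H) s a b) (x : H) :
    glue (thenMul (Q.flipAntipode s) (Q.gammaElt s a)) Q.comul.toLinearMap (Q.comul x) =
      Q.counit x • Q.gammaElt s a := by
  rw [glue_flipAntipode_gamma h.map_mul, ← conv_apply, leftSlots, pair_gammaTensor_mul_conv,
    LeftEq.conv_left (LeftEq.conv_unitHom_right (leftLegs_leftEq_inl h) (inr _ (slot₁ H))),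
    leftLegs_leftEq_inr h, unitHom_apply, ← Algebra.smul_def, map_smul]
  rfl

theorem comul_delta_flipAntipode (h : Q.IsAntipode (AlgHom.id ℂ H) s a b) (x : H) :
    glue (thenMul Q.comul.toLinearMap (Q.deltaElt b s)) (Q.flipAntipode s) (Q.comul x) =
      Q.counit x • Q.deltaElt b s := by
  rw [glue_delta_flipAntipode h.map_mul, ← conv_apply, rightSlots, conv_mul_pair_deltaTensor,
    RightEq.conv_left (RightEq.conv_unitHom_right (rightLegs_rightEq_inr h) (inl _ (slot₁ H))),
    rightLegs_rightEq_inl h, unitHom_apply, ← Algebra.commutes, ← Algebra.smul_def, map_smul]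
  rfl

end QuasiBialgebra

end

/-! ### The flipped antipode along the co-product and the Drinfeld twist -/

section

open Algebra.TensorProduct (includeLeft includeRight)

namespace QuasiBialgebra

variable {H : Type*} [Ring H] [Algebra ℂ H] (Q : QuasiBialgebra H) {s : H →ₗ[ℂ] H} {a b : H}

/-- Two copies of `x ⊗ y ⊗ z ↦ s(x) a y b s(z)`. -/
def sixLegs (s : H →ₗ[ℂ] H) (a b : H) : Tensor3 H ⊗[ℂ] Tensor3 H →ₗ[ℂ] Tensor2 H :=
  TensorProduct.map (glue (thenMul s a) (glue (thenMul (AlgHom.id ℂ H).toLinearMap b) s))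
    (glue (thenMul s a) (glue (thenMul (AlgHom.id ℂ H).toLinearMap b) s))

/-- Two copies of `x ⊗ y ⊗ z ↦ x b s(y) a z`. -/
def sixLegsInv (s : H →ₗ[ℂ] H) (a b : H) : Tensor3 H ⊗[ℂ] Tensor3 H →ₗ[ℂ] Tensor2 H :=
  TensorProduct.map
    (glue (thenMul (AlgHom.id ℂ H).toLinearMap b)
      (glue (thenMul s a) (AlgHom.id ℂ H).toLinearMap))
    (glue (thenMul (AlgHom.id ℂ H).toLinearMap b)
      (glue (thenMul s a) (AlgHom.id ℂ H).toLinearMap))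

/-- This rewrites a word in γ, δ and co-products as one evaluation at six legs. Since `s` reverses
products, `p` follows `g` inside but precedes it outside; `r` and `d` are exchanged likewise. -/
theorem sixLegs_mul (hs : ∀ x y, s (x * y) = s y * s x) (p q r : Tensor2 H) (g d : Tensor4 H) :
    sixLegs s a b (pair (inr _ (slot3₁ H)) (pair (inl _ (slot3₁ H)) (pair (inl _ (slot3₂ H))
        (inr _ (slot3₂ H)))) g * (pair (inr _ (slot3₁ H)) (inl _ (slot3₁ H)) p *
        (pair (inl _ (slot3₂ H)) (inr _ (slot3₂ H)) q *
          pair (inr _ (slot3₃ H)) (inl _ (slot3₃ H)) r)) *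
        pair (inl _ (slot3₂ H)) (pair (inr _ (slot3₂ H)) (pair (inr _ (slot3₃ H))
          (inl _ (slot3₃ H)))) d) =
      both s (tensorFlip p) * leftLegs s a (leftSlots H g) *
        (q * rightLegs b s (rightSlots H d) * both s (tensorFlip r)) := by
  induction p using TensorProduct.induction_on with
  | zero => simp
  | add x y hx hy => simp only [map_add, add_mul, mul_add, hx, hy]
  | tmul p₁ p₂ =>
  induction q using TensorProduct.induction_on with
  | zero => simp
  | add x y hx hy => simp only [map_add, add_mul, mul_add, hx, hy]
  | tmul q₁ q₂ =>
  induction r using TensorProduct.induction_on with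
  | zero => simp
  | add x y hx hy => simp only [map_add, add_mul, mul_add, hx, hy]
  | tmul r₁ r₂ =>
  induction g using tensor4_induction with
  | zero => simp
  | add x y hx hy => simp only [map_add, add_mul, mul_add, hx, hy]
  | tmul g₁ g₂ g₃ g₄ =>
  induction d using tensor4_induction with
  | zero => simp
  | add x y hx hy => simp only [map_add, add_mul, mul_add, hx, hy]
  | tmul d₁ d₂ d₃ d₄ =>
  simp [sixLegs, leftLegs, rightLegs, leftSlots, rightSlots, hs, mul_assoc]

theorem sixLegsInv_mul (hs : ∀ x y, s (x * y) = s y * s x) (p q r : Tensor2 H)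
    (g d : Tensor4 H) :
    sixLegsInv s a b (pair (inr _ (slot3₂ H)) (pair (inl _ (slot3₂ H)) (pair (inl _ (slot3₃ H))
        (inr _ (slot3₃ H)))) g * (pair (inl _ (slot3₁ H)) (inr _ (slot3₁ H)) p *
        (pair (inr _ (slot3₂ H)) (inl _ (slot3₂ H)) q *
          pair (inl _ (slot3₃ H)) (inr _ (slot3₃ H)) r)) *
        pair (inl _ (slot3₁ H)) (pair (inr _ (slot3₁ H)) (pair (inr _ (slot3₂ H))
          (inl _ (slot3₂ H)))) d) =
      p * rightLegs b s (rightSlots H d) *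
        (both s (tensorFlip q) * leftLegs s a (leftSlots H g) * r) := by
  induction p using TensorProduct.induction_on with
  | zero => simp
  | add x y hx hy => simp only [map_add, add_mul, mul_add, hx, hy]
  | tmul p₁ p₂ =>
  induction q using TensorProduct.induction_on with
  | zero => simp
  | add x y hx hy => simp only [map_add, add_mul, mul_add, hx, hy]
  | tmul q₁ q₂ =>
  induction r using TensorProduct.induction_on with
  | zero => simp
  | add x y hx hy => simp only [map_add, add_mul, mul_add, hx, hy]
  | tmul r₁ r₂ =>
  induction g using tensor4_induction with
  | zero => simp
  | add x y hx hy => simp only [map_add, add_mul, mul_add, hx, hy]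
  | tmul g₁ g₂ g₃ g₄ =>
  induction d using tensor4_induction with
  | zero => simp
  | add x y hx hy => simp only [map_add, add_mul, mul_add, hx, hy]
  | tmul d₁ d₂ d₃ d₄ =>
  simp [sixLegsInv, leftLegs, rightLegs, leftSlots, rightSlots, hs, mul_assoc]

theorem pair_slots3 (t : Tensor3 H) : pair (slot3₁ H) (pair (slot3₂ H) (slot3₃ H)) t = t := by
  have : (pair (slot3₁ H) (pair (slot3₂ H) (slot3₃ H))).toLinearMap = LinearMap.id := by
    ext x y z
    simp
  exact DFunLike.congr_fun this t

theorem pair_comp_comp {R R' : Type*} [Ring R] [Algebra ℂ R] [Ring R'] [Algebra ℂ R']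
    (g : R →ₐ[ℂ] R') (i j k : H →ₐ[ℂ] R) [CommHoms i j] [CommHoms i k] [CommHoms j k]
    (t : Tensor3 H) :
    pair (g.comp i) (pair (g.comp j) (g.comp k)) t = g (pair i (pair j k) t) := by
  simp only [pair_comp, AlgHom.comp_apply]

variable {Q}

/-- By `map_six_legs_eq` the word falls apart into two co-associators in different tensor factors,
each contributing s(X) a Y b s(Z) = 1. Because of the flip, leg 1 lies in the second factor and leg
2 in the first. -/
theorem flipAntipode_coassoc (h : Q.IsAntipode (AlgHom.id ℂ H) s a b) :
    glue (thenMul (Q.flipAntipode s) (Q.gammaElt s a)) (glue (thenMul Q.comul.toLinearMap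
      (Q.deltaElt b s)) (Q.flipAntipode s)) (Q.coassoc : Tensor3 H) = 1 := by
  have e : ∀ t : Tensor3 H, glue (thenMul (Q.flipAntipode s) (Q.gammaElt s a))
      (glue (thenMul Q.comul.toLinearMap (Q.deltaElt b s)) (Q.flipAntipode s)) t =
      sixLegs s a b (pair (inr _ (slot3₁ H)) (pair (inl _ (slot3₁ H)) (pair (inl _ (slot3₂ H))
        (inr _ (slot3₂ H)))) Q.gammaTensor *
        pair (Q.conv (inr _ (slot3₁ H)) (inl _ (slot3₁ H)))
          (pair (Q.conv (inl _ (slot3₂ H)) (inr _ (slot3₂ H)))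
            (Q.conv (inr _ (slot3₃ H)) (inl _ (slot3₃ H)))) t *
        pair (inl _ (slot3₂ H)) (pair (inr _ (slot3₂ H)) (pair (inr _ (slot3₃ H))
          (inl _ (slot3₃ H)))) Q.deltaTensor) := by
    intro t
    induction t using TensorProduct.induction_on with
    | zero => simp
    | add x y hx hy => simp only [map_add, mul_add, add_mul, hx, hy]
    | tmul x t =>
    induction t using TensorProduct.induction_on with
    | zero => simp
    | add x y hx hy => simp only [TensorProduct.tmul_add, map_add, mul_add, add_mul, hx, hy]
    | tmul y z =>
    rw [pair_tmul, pair_tmul, conv_apply, conv_apply, conv_apply, sixLegs_mul h.map_mul]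
    rfl
  have h₂₃ : LeftEq (sixLegs s a b) (Q.conv (inl (Tensor3 H) (slot3₁ H)) (inl _ (slot3₂ H)))
      (Q.unitHom _) := by
    have := (leftEq_glue (j := includeLeft) h.map_mul h.left
      (glue_includeLeft_mul (AlgHom.id ℂ H) b (E := s))).map_includeLeft (R' := Tensor3 H)
        (E' := glue (thenMul s a) (glue (thenMul (AlgHom.id ℂ H).toLinearMap b) s))
    rwa [comp_unitHom, ← conv_comp] at this
  have h₁₄ : LeftEq (sixLegs s a b) (Q.conv (inr (Tensor3 H) (slot3₁ H)) (inr _ (slot3₂ H)))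
      (Q.unitHom _) := by
    have := (leftEq_glue (j := includeLeft) h.map_mul h.left
      (glue_includeLeft_mul (AlgHom.id ℂ H) b (E := s))).map_includeRight (R := Tensor3 H)
        (E := glue (thenMul s a) (glue (thenMul (AlgHom.id ℂ H).toLinearMap b) s))
    rwa [comp_unitHom, ← conv_comp] at this
  have h₃ : RightEq (glue (thenMul s a) (glue (thenMul (AlgHom.id ℂ H).toLinearMap b) s))
      (Q.conv (slot3₂ H) (slot3₃ H)) (Q.unitHom _) := by
    have := (rightEq_glue (E := s) (j := AlgHom.id ℂ H) h.right fun x r => h.map_mul r x).glue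
      (φ := thenMul s a)
    rwa [comp_unitHom, ← conv_comp] at this
  have h₃₆ : RightEq (sixLegs s a b) (Q.conv (inl (Tensor3 H) (slot3₂ H)) (inl _ (slot3₃ H)))
      (Q.unitHom _) := by
    have := h₃.map_includeLeft (R' := Tensor3 H)
      (E' := glue (thenMul s a) (glue (thenMul (AlgHom.id ℂ H).toLinearMap b) s))
    rwa [comp_unitHom, ← conv_comp] at this
  have h₄₅ : RightEq (sixLegs s a b) (Q.conv (inr (Tensor3 H) (slot3₂ H)) (inr _ (slot3₃ H)))
      (Q.unitHom _) := by
    have := h₃.map_includeRight (R := Tensor3 H)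
      (E := glue (thenMul s a) (glue (thenMul (AlgHom.id ℂ H).toLinearMap b) s))
    rwa [comp_unitHom, ← conv_comp] at this
  have key := map_six_legs_eq h₂₃ h₁₄ h₄₅ h₃₆
  rw [e, pair_gammaTensor, pair_deltaTensor, ← coe_assocAt, ← Units.val_mul, ← Units.val_mul]
  simp only [← mul_assoc]
  rw [key]
  have e₁ : ∀ t u : Tensor3 H, sixLegs s a b
      (pair (inr _ (slot3₁ H)) (pair (inr _ (slot3₂ H)) (inr _ (slot3₃ H))) t *
        pair (inl _ (slot3₁ H)) (pair (inl _ (slot3₂ H)) (inl _ (slot3₃ H))) u) =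
      glue (thenMul s a) (glue (thenMul (AlgHom.id ℂ H).toLinearMap b) s) u ⊗ₜ
        glue (thenMul s a) (glue (thenMul (AlgHom.id ℂ H).toLinearMap b) s) t := by
    intro t u
    rw [pair_comp_comp, pair_comp_comp, pair_slots3, pair_slots3,
      Algebra.TensorProduct.includeLeft_apply, Algebra.TensorProduct.includeRight_apply,
      Algebra.TensorProduct.tmul_mul_tmul, one_mul, mul_one]
    rfl
  rw [Units.val_mul, coe_assocAt, coe_assocAt, e₁, h.coassoc]
  rfl

theorem flipAntipode_coassoc_inv (h : Q.IsAntipode (AlgHom.id ℂ H) s a b) :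
    glue (thenMul Q.comul.toLinearMap (Q.deltaElt b s)) (glue (thenMul (Q.flipAntipode s)
      (Q.gammaElt s a)) Q.comul.toLinearMap) (↑Q.coassoc⁻¹ : Tensor3 H) = 1 := by
  have e : ∀ t : Tensor3 H, glue (thenMul Q.comul.toLinearMap (Q.deltaElt b s))
      (glue (thenMul (Q.flipAntipode s) (Q.gammaElt s a)) Q.comul.toLinearMap) t =
      sixLegsInv s a b (pair (inr _ (slot3₂ H)) (pair (inl _ (slot3₂ H))
        (pair (inl _ (slot3₃ H)) (inr _ (slot3₃ H)))) Q.gammaTensor *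
        pair (Q.conv (inl _ (slot3₁ H)) (inr _ (slot3₁ H)))
          (pair (Q.conv (inr _ (slot3₂ H)) (inl _ (slot3₂ H)))
            (Q.conv (inl _ (slot3₃ H)) (inr _ (slot3₃ H)))) t *
        pair (inl _ (slot3₁ H)) (pair (inr _ (slot3₁ H)) (pair (inr _ (slot3₂ H))
          (inl _ (slot3₂ H)))) Q.deltaTensor) := by
    intro t
    induction t using TensorProduct.induction_on with
    | zero => simp
    | add x y hx hy => simp only [map_add, mul_add, add_mul, hx, hy]
    | tmul x t =>
    induction t using TensorProduct.induction_on with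
    | zero => simp
    | add x y hx hy => simp only [TensorProduct.tmul_add, map_add, mul_add, add_mul, hx, hy]
    | tmul y z =>
    rw [pair_tmul, pair_tmul, conv_apply, conv_apply, conv_apply, sixLegsInv_mul h.map_mul]
    rfl
  have h₁₄ : RightEq (sixLegsInv s a b) (Q.conv (inl (Tensor3 H) (slot3₁ H)) (inl _ (slot3₂ H)))
      (Q.unitHom _) := by
    have := (rightEq_glue (j := includeLeft) h.right
      (glue_mul_includeLeft h.map_mul a (E := (AlgHom.id ℂ H).toLinearMap))).map_includeLeft
        (R' := Tensor3 H) (E' := glue (thenMul (AlgHom.id ℂ H).toLinearMap b)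
          (glue (thenMul s a) (AlgHom.id ℂ H).toLinearMap))
    rwa [comp_unitHom, ← conv_comp] at this
  have h₂₃ : RightEq (sixLegsInv s a b) (Q.conv (inr (Tensor3 H) (slot3₁ H)) (inr _ (slot3₂ H)))
      (Q.unitHom _) := by
    have := (rightEq_glue (j := includeLeft) h.right
      (glue_mul_includeLeft h.map_mul a (E := (AlgHom.id ℂ H).toLinearMap))).map_includeRight
        (R := Tensor3 H) (E := glue (thenMul (AlgHom.id ℂ H).toLinearMap b)
          (glue (thenMul s a) (AlgHom.id ℂ H).toLinearMap))
    rwa [comp_unitHom, ← conv_comp] at this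
  have h₃ : LeftEq (glue (thenMul (AlgHom.id ℂ H).toLinearMap b)
      (glue (thenMul s a) (AlgHom.id ℂ H).toLinearMap))
      (Q.conv (slot3₂ H) (slot3₃ H)) (Q.unitHom _) := by
    have := (leftEq_glue (E := (AlgHom.id ℂ H).toLinearMap) (j := AlgHom.id ℂ H) h.map_mul
      h.left fun x r => rfl).glue (φ := thenMul (AlgHom.id ℂ H).toLinearMap b)
    rwa [comp_unitHom, ← conv_comp] at this
  have h₄₅ : LeftEq (sixLegsInv s a b) (Q.conv (inl (Tensor3 H) (slot3₂ H)) (inl _ (slot3₃ H)))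
      (Q.unitHom _) := by
    have := h₃.map_includeLeft (R' := Tensor3 H)
      (E' := glue (thenMul (AlgHom.id ℂ H).toLinearMap b)
          (glue (thenMul s a) (AlgHom.id ℂ H).toLinearMap))
    rwa [comp_unitHom, ← conv_comp] at this
  have h₃₆ : LeftEq (sixLegsInv s a b) (Q.conv (inr (Tensor3 H) (slot3₂ H)) (inr _ (slot3₃ H)))
      (Q.unitHom _) := by
    have := h₃.map_includeRight (R := Tensor3 H)
      (E := glue (thenMul (AlgHom.id ℂ H).toLinearMap b)
          (glue (thenMul s a) (AlgHom.id ℂ H).toLinearMap))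
    rwa [comp_unitHom, ← conv_comp] at this
  have key := map_six_legs_inv_eq h₁₄ h₂₃ h₄₅ h₃₆
  rw [e, pair_gammaTensor, pair_deltaTensor, ← coe_inv_assocAt, ← Units.val_mul, ← Units.val_mul]
  simp only [← mul_assoc]
  rw [key]
  have e₁ : ∀ t u : Tensor3 H, sixLegsInv s a b
      (pair (inr _ (slot3₁ H)) (pair (inr _ (slot3₂ H)) (inr _ (slot3₃ H))) t *
        pair (inl _ (slot3₁ H)) (pair (inl _ (slot3₂ H)) (inl _ (slot3₃ H))) u) =
      glue (thenMul (AlgHom.id ℂ H).toLinearMap b)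
          (glue (thenMul s a) (AlgHom.id ℂ H).toLinearMap) u ⊗ₜ
        glue (thenMul (AlgHom.id ℂ H).toLinearMap b)
          (glue (thenMul s a) (AlgHom.id ℂ H).toLinearMap) t := by
    intro t u
    rw [pair_comp_comp, pair_comp_comp, pair_slots3, pair_slots3,
      Algebra.TensorProduct.includeLeft_apply, Algebra.TensorProduct.includeRight_apply,
      Algebra.TensorProduct.tmul_mul_tmul, one_mul, mul_one]
    rfl
  rw [Units.val_mul, coe_inv_assocAt, coe_inv_assocAt, e₁, h.coassoc_inv]
  rfl

/-- `(s ⊗ s)Δᵀ` is an antipode relative to the co-product, with canonical elements `γ`, `δ`. -/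
theorem isAntipode_flipAntipode (h : Q.IsAntipode (AlgHom.id ℂ H) s a b) :
    Q.IsAntipode Q.comul (Q.flipAntipode s) (Q.gammaElt s a) (Q.deltaElt b s) where
  map_one := by
    change both s (tensorFlip (Q.comul 1)) = 1
    rw [map_one, map_one, Algebra.TensorProduct.one_def, both_tmul, h.map_one]
  map_mul x y := by
    change both s (tensorFlip (Q.comul (x * y))) = _
    rw [map_mul, both_flip_mul h.map_mul]
    rfl
  left := flipAntipode_gamma_comul h
  right := comul_delta_flipAntipode h
  coassoc := flipAntipode_coassoc h
  coassoc_inv := flipAntipode_coassoc_inv h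

theorem IsAntipode.comp {B B' : Type*} [Ring B] [Algebra ℂ B] [Ring B'] [Algebra ℂ B']
    {f : H →ₐ[ℂ] B} {s : H →ₗ[ℂ] B} {a b : B} (h : Q.IsAntipode f s a b) (g : B →ₐ[ℂ] B') :
    Q.IsAntipode (g.comp f) (g.toLinearMap ∘ₗ s) (g a) (g b) where
  map_one := by simp [h.map_one]
  map_mul x y := by simp [h.map_mul]
  left x := by
    have : glue (thenMul (g.toLinearMap ∘ₗ s) (g a)) (g.comp f).toLinearMap =
        g.toLinearMap ∘ₗ glue (thenMul s a) f.toLinearMap := by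
      ext x y
      simp
    rw [this, LinearMap.comp_apply, h.left]
    simp
  right x := by
    have : glue (thenMul (g.comp f).toLinearMap (g b)) (g.toLinearMap ∘ₗ s) =
        g.toLinearMap ∘ₗ glue (thenMul f.toLinearMap b) s := by
      ext x y
      simp
    rw [this, LinearMap.comp_apply, h.right]
    simp
  coassoc := by
    have : glue (thenMul (g.toLinearMap ∘ₗ s) (g a))
        (glue (thenMul (g.comp f).toLinearMap (g b)) (g.toLinearMap ∘ₗ s)) =
        g.toLinearMap ∘ₗ glue (thenMul s a) (glue (thenMul f.toLinearMap b) s) := by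
      ext x y z
      simp
    rw [this, LinearMap.comp_apply, h.coassoc]
    simp
  coassoc_inv := by
    have : glue (thenMul (g.comp f).toLinearMap (g b))
        (glue (thenMul (g.toLinearMap ∘ₗ s) (g a)) (g.comp f).toLinearMap) =
        g.toLinearMap ∘ₗ glue (thenMul f.toLinearMap b) (glue (thenMul s a) f.toLinearMap) := by
      ext x y z
      simp
    rw [this, LinearMap.comp_apply, h.coassoc_inv]
    simp

variable (Q) in
/-- The Drinfeld twist of an antipode `s` with canonical elements `a` and `b`. -/
def drinfeldElt (s : H →ₗ[ℂ] H) (a b : H) : Tensor2 H :=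
  IsAntipode.link Q Q.comul (Q.flipAntipode s) (Q.gammaElt s a) (Q.comul b)
    (Q.comul.toLinearMap ∘ₗ s)

/-- Composing with a homomorphism preserves relative antipodes, so Δs is an antipode along Δ and can
be compared with the flipped one. -/
theorem exists_drinfeldElt (h : Q.IsAntipode (AlgHom.id ℂ H) s a b) :
    ∃ F : (Tensor2 H)ˣ, (F : Tensor2 H) = Q.drinfeldElt s a b ∧
      (∀ x, F * Q.comul (s x) = both s (tensorFlip (Q.comul x)) * F) ∧
      F * Q.comul a = Q.gammaElt s a ∧ Q.deltaElt b s * F = Q.comul b :=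
  (h.comp Q.comul).exists_unit (isAntipode_flipAntipode h)

end QuasiBialgebra

namespace QuasiHopf

variable {H : Type*} [Ring H] [Algebra ℂ H] (Q : QuasiHopf H)

theorem gamma_eq : Q.gamma = Q.toQuasiBialgebra.gammaElt Q.S Q.α := by
  have : Q.gammaMap = QuasiBialgebra.leftLegs Q.S Q.α ∘ₗ
      (QuasiBialgebra.leftSlots H).toLinearMap := by
    ext x y z w
    simp [gammaMap, QuasiBialgebra.leftLegs, QuasiBialgebra.leftSlots, mul2]
  exact DFunLike.congr_fun this _

theorem drinfeldTwist_eq :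
    Q.drinfeldTwist = Q.toQuasiBialgebra.drinfeldElt Q.S Q.α Q.β := by
  rw [drinfeldTwist, gamma_eq]
  have : mul2 ∘ₗ (TensorProduct.map
      (thenMul (both Q.S ∘ₗ (tensorFlip (A := H)).toLinearMap ∘ₗ Q.comul.toLinearMap)
        (Q.toQuasiBialgebra.gammaElt Q.S Q.α))
      (Q.comul.toLinearMap ∘ₗ mul2 ∘ₗ TensorProduct.map (thenMul LinearMap.id Q.β) Q.S)) =
      glue (thenMul (Q.toQuasiBialgebra.flipAntipode Q.S) (Q.toQuasiBialgebra.gammaElt Q.S Q.α))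
        (glue (thenMul Q.comul.toLinearMap (Q.comul Q.β)) (Q.comul.toLinearMap ∘ₗ Q.S)) := by
    ext x y z
    simp [mul2, QuasiBialgebra.flipAntipode, toQuasiBialgebra]
  exact DFunLike.congr_fun this _

end QuasiHopf

end

/-! ### Behaviour of antipodes and of γ under twisting -/

section

open Algebra.TensorProduct (includeLeft includeRight)

namespace QuasiBialgebra

variable {H : Type*} [Ring H] [Algebra ℂ H] {Q Q' : QuasiBialgebra H} {F : (Tensor2 H)ˣ}
  {R : Type*} [Ring R] [Algebra ℂ R]

/-- The image of `F` under two commuting homomorphisms. -/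
def unitAt (F : (Tensor2 H)ˣ) (i j : H →ₐ[ℂ] R) [CommHoms i j] : Rˣ :=
  Units.map (pair i j).toMonoidHom F

theorem coe_unitAt (F : (Tensor2 H)ˣ) (i j : H →ₐ[ℂ] R) [CommHoms i j] :
    (unitAt F i j : R) = pair i j (F : Tensor2 H) := rfl

theorem coe_inv_unitAt (F : (Tensor2 H)ˣ) (i j : H →ₐ[ℂ] R) [CommHoms i j] :
    (↑(unitAt F i j)⁻¹ : R) = pair i j (↑F⁻¹ : Tensor2 H) := rfl

theorem unitAt_commute (F : (Tensor2 H)ˣ) {A : Type*} [Ring A] [Algebra ℂ A] (i j : H →ₐ[ℂ] R)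
    (k : A →ₐ[ℂ] R) [CommHoms i j] [CommHoms i k] [CommHoms j k] (a : A) :
    Commute (unitAt F i j : R) (k a) :=
  (commute_pair (fun b => (CommHoms.comm (i := i) (j := k) b a).symm)
    (fun b => (CommHoms.comm (i := j) (j := k) b a).symm) _).symm

theorem unitAt_intertwine (F : (Tensor2 H)ˣ) {i i' j j' : H →ₐ[ℂ] R} [CommHoms i j]
    [CommHoms i' j'] {u : Rˣ} (hi : ∀ a, u * i a = i' a * u) (hj : ∀ a, u * j a = j' a * u) :
    u * unitAt F i j = unitAt F i' j' * u :=
  Units.ext (pair_intertwine hi hj _)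

theorem unitAt_unitHom_left (hF : IsTwist Q.counit F) (j : H →ₐ[ℂ] R) :
    unitAt F (Q.unitHom R) j = 1 := by
  have h : pair (Q.unitHom R) j = j.comp (counitLeft Q.counit) :=
    Algebra.TensorProduct.ext' fun a b => by
      simp [counitLeft, unitHom_apply, Algebra.smul_def]
  ext
  rw [coe_unitAt, h, AlgHom.comp_apply, hF.1, map_one, Units.val_one]

theorem unitAt_unitHom_right (hF : IsTwist Q.counit F) (j : H →ₐ[ℂ] R) :
    unitAt F j (Q.unitHom R) = 1 := by
  have h : pair j (Q.unitHom R) = j.comp (counitRight Q.counit) :=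
    Algebra.TensorProduct.ext' fun a b => by
      simp [counitRight, unitHom_apply, Algebra.smul_def, Algebra.commutes]
  ext
  rw [coe_unitAt, h, AlgHom.comp_apply, hF.2, map_one, Units.val_one]

variable (Q Q' F) in
/-- `Q'` is the twist of `Q` by `F`. -/
structure IsTwisted : Prop where
  comul : Q'.comul = twistComul Q.comul F
  coassoc : Q'.coassoc = twistCoassoc Q.comul Q.coassoc F
  counit : Q'.counit = Q.counit

section

variable (i j k l : H →ₐ[ℂ] R) [CommHoms i j] [CommHoms i k] [CommHoms j k]
  [CommHoms i l] [CommHoms j l] [CommHoms k l]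

theorem IsTwisted.conv_eq (h : Q.IsTwisted Q' F) (a : H) :
    Q'.conv i j a = unitAt F i j * Q.conv i j a * (↑(unitAt F i j)⁻¹ : R) := by
  rw [conv_apply, h.comul, coe_unitAt, coe_inv_unitAt, conv_apply, ← map_mul, ← map_mul]
  rfl

theorem IsTwisted.unitAt_mul_conv (h : Q.IsTwisted Q' F) (a : H) :
    unitAt F i j * Q.conv i j a = Q'.conv i j a * unitAt F i j := by
  rw [h.conv_eq i j, Units.inv_mul_cancel_right]

theorem IsTwisted.assocAt_eq (h : Q.IsTwisted Q' F) :
    Q'.assocAt i j k = unitAt F i j * unitAt F (Q.conv i j) k * Q.assocAt i j k *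
      (unitAt F i (Q.conv j k))⁻¹ * (unitAt F j k)⁻¹ := by
  ext
  rw [coe_assocAt, h.coassoc]
  change pair i (pair j k) (oneRight (F : Tensor2 H) * deltaLeft Q.comul (F : Tensor2 H) *
    (Q.coassoc : Tensor3 H) * deltaRight Q.comul (↑F⁻¹ : Tensor2 H) *
    oneLeft (↑F⁻¹ : Tensor2 H)) = _
  rw [map_mul, map_mul, map_mul, map_mul]
  simp only [← AlgHom.comp_apply]
  rw [pair_comp_deltaLeft, pair_comp_deltaRight, pair_comp_oneRight, pair_comp_oneLeft]
  rfl

theorem IsTwisted.pair_gammaTensor (h : Q.IsTwisted Q' F) :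
    pair i (pair j (pair k l)) Q'.gammaTensor = ↑(unitAt F j k * unitAt F i (Q.conv j k) *
      unitAt F (Q.conv i (Q.conv j k)) l * ((Q.assocAt i j k)⁻¹ * Q.assocAt (Q.conv i j) k l) *
        (unitAt F (Q.conv i j) (Q.conv k l))⁻¹ * (unitAt F k l)⁻¹ * (unitAt F i j)⁻¹) := by
  -- Conjugation by F returns the twisted convolution in the first leg to the untwisted one; `e₂`
  -- then moves a twist past Φ⁻¹ by rebracketing its leg.
  have e₁ : unitAt F i j * Q'.assocAt (Q.conv i j) k l =
      Q'.assocAt (Q'.conv i j) k l * unitAt F i j :=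
    Q'.assocAt_intertwine (h.unitAt_mul_conv i j) (fun a => (unitAt_commute F i j k a).eq)
      (fun a => (unitAt_commute F i j l a).eq)
  have e₂ : (Q.assocAt i j k)⁻¹ * unitAt F (Q.conv (Q.conv i j) k) l =
      unitAt F (Q.conv i (Q.conv j k)) l * (Q.assocAt i j k)⁻¹ :=
    unitAt_intertwine F Q.conv_mul_inv_assocAt
      (fun a => (Commute.units_inv_left (Q.assocAt_commute i j k l a)).eq)
  rw [QuasiBialgebra.pair_gammaTensor, eq_mul_inv_of_mul_eq e₁.symm, h.assocAt_eq i j k,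
    h.assocAt_eq (Q.conv i j) k l]
  congr 1
  rw [show ∀ x y z a b c d e f g : Rˣ, x * y * z * (a * b) * c * d * e =
    x * y * (z * a) * b * c * d * e from fun x y z a b c d e f g => by group, ← e₂]
  · group
  · exact 1
  · exact 1

end

variable {s : H →ₗ[ℂ] H} {a b : H}

/-- Replacing a by α_F in a word amounts to inserting F⁻¹ on the left into the two legs around a. -/
theorem glue_glue_left (hs : ∀ x y, s (x * y) = s y * s x) {R : Type*} [Ring R] [Algebra ℂ R]
    {E : R →ₗ[ℂ] H} {j : H →ₐ[ℂ] R} (hE : ∀ x r, E (j x * r) = x * E r) (x : Tensor2 H)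
    (t : H ⊗[ℂ] R) :
    glue (thenMul s (glue (thenMul s a) (AlgHom.id ℂ H).toLinearMap x)) E t =
      glue (thenMul s a) E
        (pair (includeLeft : H →ₐ[ℂ] H ⊗[ℂ] R) (includeRight.comp j) x * t) := by
  induction t using TensorProduct.induction_on with
  | zero => simp
  | add y z hy hz => rw [map_add, hy, hz, mul_add, map_add]
  | tmul y z =>
    rw [glue_tmul, thenMul_apply]
    induction x using TensorProduct.induction_on with
    | zero => simp
    | tmul p q => simp [hs, hE, mul_assoc]
    | add p q hp hq => rw [map_add, map_add, add_mul, map_add, mul_add, add_mul, hp, hq]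

theorem glue_glue_right {R : Type*} [Ring R] [Algebra ℂ R] {E : R →ₗ[ℂ] H} {j : H →ₐ[ℂ] R} (hE : ∀ x r, E (r * j x) = s x * E r) (x : Tensor2 H)
    (t : H ⊗[ℂ] R) :
    glue (thenMul (AlgHom.id ℂ H).toLinearMap
        (glue (thenMul (AlgHom.id ℂ H).toLinearMap b) s x)) E t =
      glue (thenMul (AlgHom.id ℂ H).toLinearMap b) E
        (t * pair (includeLeft : H →ₐ[ℂ] H ⊗[ℂ] R) (includeRight.comp j) x) := by
  induction t using TensorProduct.induction_on with
  | zero => simp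
  | add y z hy hz => rw [map_add, hy, hz, add_mul, map_add]
  | tmul y z =>
    rw [glue_tmul, thenMul_apply]
    induction x using TensorProduct.induction_on with
    | zero => simp
    | tmul p q => simp [hE, mul_assoc]
    | add p q hp hq => simp only [map_add, mul_add, add_mul, hp, hq]

/-- `α_F`. -/
def twistLeft (s : H →ₗ[ℂ] H) (a : H) (F : (Tensor2 H)ˣ) : H :=
  glue (thenMul s a) (AlgHom.id ℂ H).toLinearMap (↑F⁻¹ : Tensor2 H)

/-- `β_F`. -/
def twistRight (b : H) (s : H →ₗ[ℂ] H) (F : (Tensor2 H)ˣ) : H :=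
  glue (thenMul (AlgHom.id ℂ H).toLinearMap b) s (F : Tensor2 H)

theorem pair_slots (t : Tensor2 H) : pair (slot₁ H) (slot₂ H) t = t := by
  have : (pair (slot₁ H) (slot₂ H)).toLinearMap = LinearMap.id := by
    ext x y
    simp
  exact DFunLike.congr_fun this t

theorem conv_slots (x : H) : Q.conv (slot₁ H) (slot₂ H) x = Q.comul x := by
  rw [conv_apply, pair_slots]

/-- The twist of an antipode. -/
theorem IsAntipode.twist (h : Q.IsAntipode (AlgHom.id ℂ H) s a b) (hQ : Q.IsTwisted Q' F)
    (hF : IsTwist Q.counit F) :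
    Q'.IsAntipode (AlgHom.id ℂ H) s (twistLeft s a F) (twistRight b s F) where
  map_one := h.map_one
  map_mul := h.map_mul
  left x := by
    have k := leftEq_glue (E := (AlgHom.id ℂ H).toLinearMap) (j := AlgHom.id ℂ H) h.map_mul
      h.left fun x r => rfl
    rw [twistLeft, glue_glue_left (j := AlgHom.id ℂ H) h.map_mul (fun _ _ => rfl), ← conv_slots,
      hQ.conv_eq (slot₁ H) (slot₂ H), ← coe_inv_unitAt F (slot₁ H) (slot₂ H), mul_assoc, Units.inv_mul_cancel_left, k, unitHom_apply,
      ← Algebra.smul_def, map_smul, coe_inv_unitAt, pair_slots, hQ.counit]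
  right x := by
    have k := rightEq_glue (E := s) (j := AlgHom.id ℂ H) h.right fun x r => h.map_mul r x
    rw [twistRight, glue_glue_right (j := AlgHom.id ℂ H) (fun x r => h.map_mul r x),
      ← conv_slots, hQ.conv_eq (slot₁ H) (slot₂ H), ← coe_unitAt F (slot₁ H) (slot₂ H), Units.inv_mul_cancel_right, k, unitHom_apply,
      ← Algebra.commutes, ← Algebra.smul_def, map_smul, coe_unitAt, pair_slots, hQ.counit]
  coassoc := by
    set E := glue (thenMul s a) (glue (thenMul (AlgHom.id ℂ H).toLinearMap b) s)
    have h₁₂ : LeftEq E (Q.conv (slot3₁ H) (slot3₂ H)) (Q.unitHom _) :=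
      leftEq_glue h.map_mul h.left (glue_includeLeft_mul (AlgHom.id ℂ H) b)
    have h₂₃ : RightEq E (Q.conv (slot3₂ H) (slot3₃ H)) (Q.unitHom _) := by
      have := (rightEq_glue (E := s) (j := AlgHom.id ℂ H) h.right fun x r => h.map_mul r x).glue
        (φ := thenMul s a)
      rwa [comp_unitHom, ← conv_comp] at this
    have e₁ : ∀ t : Tensor3 H, glue (thenMul s (twistLeft s a F))
        (glue (thenMul (AlgHom.id ℂ H).toLinearMap (twistRight b s F)) s) t =
        E (↑(unitAt F (slot3₁ H) (slot3₂ H))⁻¹ * (t * unitAt F (slot3₂ H) (slot3₃ H))) := by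
      intro t
      rw [twistLeft, glue_glue_left h.map_mul (glue_includeLeft_mul (AlgHom.id ℂ H) _),
        ← coe_inv_unitAt, ← mul_assoc]
      generalize (↑(unitAt F (slot3₁ H) (slot3₂ H))⁻¹ : Tensor3 H) * t = u
      induction u using TensorProduct.induction_on with
      | zero => simp
      | add x y hx hy => rw [map_add, hx, hy, add_mul, map_add]
      | tmul x u =>
        rw [coe_unitAt, pair_comp, AlgHom.comp_apply, pair_slots,
          Algebra.TensorProduct.includeRight_apply, Algebra.TensorProduct.tmul_mul_tmul, mul_one,
          glue_tmul, glue_tmul, twistRight, glue_glue_right (j := AlgHom.id ℂ H)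
            (fun x r => h.map_mul r x), pair_slots]
    have e₂ : (Q'.coassoc : Tensor3 H) = Q'.assocAt (slot3₁ H) (slot3₂ H) (slot3₃ H) := by
      rw [coe_assocAt, pair_slots3]
    -- The canonical elements contribute F⁻¹ at 1, 2 and F at 2, 3, which cancel the outer factors
    -- of Φ_F. The inner ones, at (12), 3 and 1, (23), contract by the co-unit conditions on F.
    have e₃ : (unitAt F (slot3₁ H) (slot3₂ H))⁻¹ * (Q'.assocAt (slot3₁ H) (slot3₂ H) (slot3₃ H) *
        unitAt F (slot3₂ H) (slot3₃ H)) = unitAt F (Q.conv (slot3₁ H) (slot3₂ H)) (slot3₃ H) *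
          (Q.assocAt (slot3₁ H) (slot3₂ H) (slot3₃ H) *
            (unitAt F (slot3₁ H) (Q.conv (slot3₂ H) (slot3₃ H)))⁻¹) := by
      rw [hQ.assocAt_eq (slot3₁ H) (slot3₂ H) (slot3₃ H)]
      group
    rw [e₁, e₂, ← Units.val_mul, ← Units.val_mul, e₃]
    refine ((h₁₂.pair_left (slot3₃ H)).map_units F _).trans ?_
    change E ↑(unitAt F (Q.unitHom _) (slot3₃ H) * _) = 1
    rw [unitAt_unitHom_left hF, one_mul]
    refine ((h₂₃.pair_right (slot3₁ H)).map_units F⁻¹ _).trans ?_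
    change E ↑(_ * (unitAt F (slot3₁ H) (Q.unitHom _))⁻¹) = 1
    rw [unitAt_unitHom_right hF, inv_one, mul_one, coe_assocAt, pair_slots3, h.coassoc]
  coassoc_inv := by
    set E := glue (thenMul (AlgHom.id ℂ H).toLinearMap b)
      (glue (thenMul s a) (AlgHom.id ℂ H).toLinearMap)
    have h₁₂ : RightEq E (Q.conv (slot3₁ H) (slot3₂ H)) (Q.unitHom _) :=
      rightEq_glue h.right (glue_mul_includeLeft h.map_mul a)
    have h₂₃ : LeftEq E (Q.conv (slot3₂ H) (slot3₃ H)) (Q.unitHom _) := by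
      have := (leftEq_glue (E := (AlgHom.id ℂ H).toLinearMap) (j := AlgHom.id ℂ H) h.map_mul
        h.left fun x r => rfl).glue (φ := thenMul (AlgHom.id ℂ H).toLinearMap b)
      rwa [comp_unitHom, ← conv_comp] at this
    have e₁ : ∀ t : Tensor3 H, glue (thenMul (AlgHom.id ℂ H).toLinearMap (twistRight b s F))
        (glue (thenMul s (twistLeft s a F)) (AlgHom.id ℂ H).toLinearMap) t =
        E (↑(unitAt F (slot3₂ H) (slot3₃ H))⁻¹ * (t * unitAt F (slot3₁ H) (slot3₂ H))) := by
      intro t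
      rw [twistRight, glue_glue_right (glue_mul_includeLeft h.map_mul _),
        ← coe_unitAt]
      generalize t * (unitAt F (slot3₁ H) (slot3₂ H) : Tensor3 H) = u
      induction u using TensorProduct.induction_on with
      | zero => simp
      | add x y hx hy => rw [map_add, hx, hy, mul_add, map_add]
      | tmul x u =>
        rw [coe_inv_unitAt, pair_comp, AlgHom.comp_apply, pair_slots,
          Algebra.TensorProduct.includeRight_apply, Algebra.TensorProduct.tmul_mul_tmul, one_mul,
          glue_tmul, glue_tmul, twistLeft, glue_glue_left (j := AlgHom.id ℂ H) h.map_mul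
            (fun _ _ => rfl), pair_slots]
    have e₂ : (↑Q'.coassoc⁻¹ : Tensor3 H) =
        ↑(Q'.assocAt (slot3₁ H) (slot3₂ H) (slot3₃ H))⁻¹ := by
      rw [coe_inv_assocAt, pair_slots3]
    have e₃ : (unitAt F (slot3₂ H) (slot3₃ H))⁻¹ *
        ((Q'.assocAt (slot3₁ H) (slot3₂ H) (slot3₃ H))⁻¹ * unitAt F (slot3₁ H) (slot3₂ H)) =
          unitAt F (slot3₁ H) (Q.conv (slot3₂ H) (slot3₃ H)) *
            ((Q.assocAt (slot3₁ H) (slot3₂ H) (slot3₃ H))⁻¹ *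
              (unitAt F (Q.conv (slot3₁ H) (slot3₂ H)) (slot3₃ H))⁻¹) := by
      rw [hQ.assocAt_eq (slot3₁ H) (slot3₂ H) (slot3₃ H)]
      group
    rw [e₁, e₂, ← Units.val_mul, ← Units.val_mul, e₃]
    refine ((h₂₃.pair_right (slot3₁ H)).map_units F _).trans ?_
    change E ↑(unitAt F (slot3₁ H) (Q.unitHom _) * _) = 1
    rw [unitAt_unitHom_right hF, one_mul]
    refine ((h₁₂.pair_left (slot3₃ H)).map_units F⁻¹ _).trans ?_
    change E ↑(_ * (unitAt F (Q.unitHom _) (slot3₃ H))⁻¹) = 1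
    rw [unitAt_unitHom_left hF, inv_one, mul_one, coe_inv_assocAt, pair_slots3, h.coassoc_inv]

theorem leftLegs_glue (hs : ∀ x y, s (x * y) = s y * s x) (x : Tensor2 H)
    (t : Tensor2 H ⊗[ℂ] Tensor2 H) :
    leftLegs s (glue (thenMul s a) (AlgHom.id ℂ H).toLinearMap x) t =
      leftLegs s a ((x ⊗ₜ x) * t) := by
  induction t using TensorProduct.induction_on with
  | zero => simp
  | add y z hy hz => rw [map_add, hy, hz, mul_add, map_add]
  | tmul y z =>
    rw [Algebra.TensorProduct.tmul_mul_tmul, leftLegs, leftLegs, TensorProduct.map_tmul,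
      TensorProduct.map_tmul, glue_glue_left (j := AlgHom.id ℂ H) hs (fun _ _ => rfl),
      glue_glue_left (j := AlgHom.id ℂ H) hs (fun _ _ => rfl), pair_slots]

theorem glue_comul_comul (t : Tensor2 H) :
    glue (thenMul (Q.comul.toLinearMap ∘ₗ s) (Q.comul a)) Q.comul.toLinearMap t =
      Q.comul (glue (thenMul s a) (AlgHom.id ℂ H).toLinearMap t) := by
  induction t using TensorProduct.induction_on with
  | zero => simp
  | add y z hy hz => rw [map_add, hy, hz, map_add, map_add]
  | tmul y z => simp

/-- The behaviour of `γ` under twisting. -/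
theorem IsTwisted.gammaElt_mul (h : Q.IsAntipode (AlgHom.id ℂ H) s a b)
    (hQ : Q.IsTwisted Q' F) (hF : IsTwist Q.counit F) {D : Tensor2 H}
    (hD : ∀ x, D * Q.comul (s x) = both s (tensorFlip (Q.comul x)) * D)
    (hDa : D * Q.comul a = Q.gammaElt s a) :
    Q'.gammaElt s (twistLeft s a F) * F =
      both s (tensorFlip (↑F⁻¹ : Tensor2 H)) * D * Q.comul (twistLeft s a F) := by
  let E := leftLegs s a
  let g₁ : H →ₐ[ℂ] Tensor2 H ⊗[ℂ] Tensor2 H := inr _ (slot₁ H)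
  let g₂ : H →ₐ[ℂ] Tensor2 H ⊗[ℂ] Tensor2 H := inl _ (slot₁ H)
  let g₃ : H →ₐ[ℂ] Tensor2 H ⊗[ℂ] Tensor2 H := inl _ (slot₂ H)
  let g₄ : H →ₐ[ℂ] Tensor2 H ⊗[ℂ] Tensor2 H := inr _ (slot₂ H)
  have k₂₃ : LeftEq E (Q.conv g₂ g₃) (Q.unitHom _) := leftLegs_leftEq_inl h
  have e₁ : (↑F⁻¹ : Tensor2 H) ⊗ₜ[ℂ] (↑F⁻¹ : Tensor2 H) =
      ↑((unitAt F g₁ g₄)⁻¹ * (unitAt F g₂ g₃)⁻¹) := by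
    rw [Units.val_mul, coe_inv_unitAt, coe_inv_unitAt, pair_comp, pair_comp, AlgHom.comp_apply,
      AlgHom.comp_apply, pair_slots]
    simp
  have c₁ : ∀ x, Commute (↑(unitAt F g₁ g₄)⁻¹ : Tensor2 H ⊗[ℂ] Tensor2 H) (Q.conv g₂ g₃ x) :=
    fun x => Commute.units_inv_left (unitAt_commute F g₁ g₄ (Q.conv g₂ g₃) x)
  have k' := k₂₃.mulLeft c₁ (commute_unitHom _)
  -- The two copies of α_F contribute F⁻¹ at 1, 4 and at 2, 3. The latter cancels directly;
  -- contracting (23) removes F at 1, (23) and turns F at (1(23)), 4 into F at 1, 4, which cancels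
  -- the former.
  have e₂ : ∀ v, E ↑((unitAt F g₁ g₄)⁻¹ * (unitAt F g₁ (Q.conv g₂ g₃) * v)) =
      E ↑((unitAt F g₁ g₄)⁻¹ * v) := fun v => by
    refine ((k'.pair_right g₁).map_units F v).trans ?_
    change E ↑((unitAt F g₁ g₄)⁻¹ * (unitAt F g₁ (Q.unitHom _) * v)) = _
    rw [unitAt_unitHom_right hF, one_mul]
  have e₃ : ∀ v, E ↑((unitAt F g₁ g₄)⁻¹ * (unitAt F (Q.conv g₁ (Q.conv g₂ g₃)) g₄ * v)) =
      E ↑((unitAt F g₁ g₄)⁻¹ * (unitAt F g₁ g₄ * v)) := fun v =>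
    ((LeftEq.conv_unitHom_right k' g₁).pair_left g₄).map_units F v
  have e₄ := hQ.pair_gammaTensor g₁ g₂ g₃ g₄
  have e₅ : Q'.gammaElt s (twistLeft s a F) =
      E (pair g₁ (pair g₂ (pair g₃ g₄)) Q.gammaTensor *
        ↑((unitAt F (Q.conv g₁ g₂) (Q.conv g₃ g₄))⁻¹) *
          (↑(unitAt F g₁ g₂)⁻¹ * ↑(unitAt F g₃ g₄)⁻¹)) := by
    have e₆ : leftSlots H Q'.gammaTensor = _ := e₄
    have c₂ : (unitAt F g₃ g₄)⁻¹ * (unitAt F g₁ g₂)⁻¹ =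
        (unitAt F g₁ g₂)⁻¹ * (unitAt F g₃ g₄)⁻¹ :=
      Commute.eq (Commute.inv_inv (Units.ext
        (commute_pair (unitAt_commute F g₃ g₄ g₁) (unitAt_commute F g₃ g₄ g₂) _)))
    rw [gammaElt, twistLeft, leftLegs_glue h.map_mul, e₆, e₁, ← Units.val_mul,
      mul_assoc _ (unitAt F g₃ g₄)⁻¹, c₂]
    simp only [mul_assoc]
    rw [inv_mul_cancel_left, e₂, e₃, inv_mul_cancel_left, QuasiBialgebra.pair_gammaTensor]
    simp only [Units.val_mul, mul_assoc]
  -- Of the surviving twists, the one at 1, 2 comes out flipped through s ⊗ s, the one at 3, 4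
  -- cancels F, and the one at (12), (34) produces D Δ(α_F).
  rw [e₅, coe_inv_unitAt, coe_inv_unitAt, coe_inv_unitAt, leftLegs_mul h.map_mul]
  rw [mul_assoc, Units.inv_mul, mul_one, mul_assoc, twistLeft, ← glue_comul_comul,
    mul_glue_of_intertwine (s' := Q.flipAntipode s) hD hDa, glue_flipAntipode_gamma h.map_mul]
  rfl

end QuasiBialgebra

end

/-! ### Conjugation and twists; the antipode S̃ and the element w -/

section

section Twist

variable {A : Type*} [Ring A] [Algebra ℂ A] {Δ : A →ₐ[ℂ] Tensor2 A} {Φ : (Tensor3 A)ˣ}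

theorem twistComul_apply (F : (Tensor2 A)ˣ) (a : A) :
    twistComul Δ F a = F * Δ a * (↑F⁻¹ : Tensor2 A) := rfl

theorem deltaLeft_twistComul (F : (Tensor2 A)ˣ) (t : Tensor2 A) :
    deltaLeft (twistComul Δ F) t =
      oneRight (F : Tensor2 A) * deltaLeft Δ t * oneRight (↑F⁻¹ : Tensor2 A) := by
  induction t using TensorProduct.induction_on with
  | zero => simp
  | add x y hx hy => simp only [map_add, mul_add, add_mul, hx, hy]
  | tmul x y =>
    simp only [deltaLeft, oneRight, AlgHom.comp_apply, Algebra.TensorProduct.map_tmul,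
      ← map_mul, Algebra.TensorProduct.includeLeft_apply, Algebra.TensorProduct.tmul_mul_tmul,
      one_mul, mul_one]
    rfl

theorem deltaRight_twistComul (F : (Tensor2 A)ˣ) (t : Tensor2 A) :
    deltaRight (twistComul Δ F) t =
      oneLeft (F : Tensor2 A) * deltaRight Δ t * oneLeft (↑F⁻¹ : Tensor2 A) := by
  induction t using TensorProduct.induction_on with
  | zero => simp
  | add x y hx hy => simp only [map_add, mul_add, add_mul, hx, hy]
  | tmul x y =>
    simp [deltaRight, oneLeft, twistComul_apply]

theorem map_deltaLeft_twistComul (F G : (Tensor2 A)ˣ) :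
    Units.map (deltaLeft (twistComul Δ F)).toMonoidHom G =
      Units.map (oneRight (A := A)).toMonoidHom F * Units.map (deltaLeft Δ).toMonoidHom G *
        (Units.map (oneRight (A := A)).toMonoidHom F)⁻¹ :=
  Units.ext (deltaLeft_twistComul F _)

theorem map_deltaRight_twistComul (F G : (Tensor2 A)ˣ) :
    Units.map (deltaRight (twistComul Δ F)).toMonoidHom G =
      Units.map (oneLeft (A := A)).toMonoidHom F * Units.map (deltaRight Δ).toMonoidHom G *
        (Units.map (oneLeft (A := A)).toMonoidHom F)⁻¹ :=
  Units.ext (deltaRight_twistComul F _)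

/-- A cancellation valid for arbitrary Δ and Φ: the conjugations by F ⊗ 1 and 1 ⊗ F in Δ_F meet the
outer factors of Φ_F. -/
theorem twistCoassoc_twistCoassoc (F G : (Tensor2 A)ˣ) :
    twistCoassoc (twistComul Δ F) (twistCoassoc Δ Φ F) G = twistCoassoc Δ Φ (G * F) := by
  simp only [twistCoassoc, map_deltaLeft_twistComul, map_deltaRight_twistComul, map_mul, map_inv]
  group

theorem IsTwist.mul {ε : A →ₐ[ℂ] ℂ} {F G : (Tensor2 A)ˣ} (hF : IsTwist ε F) (hG : IsTwist ε G) :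
    IsTwist ε (F * G) := by
  simp [IsTwist, hF.1, hF.2, hG.1, hG.2]

theorem IsTwist.inv {ε : A →ₐ[ℂ] ℂ} {F : (Tensor2 A)ˣ} (hF : IsTwist ε F) : IsTwist ε F⁻¹ := by
  constructor
  · have := congrArg (counitLeft ε) F.mul_inv
    rwa [map_mul, map_one, hF.1, one_mul] at this
  · have := congrArg (counitRight ε) F.mul_inv
    rwa [map_mul, map_one, hF.2, one_mul] at this

variable [StarRing A] [StarModule ℂ A] {Δ' : A →ₐ[ℂ] Tensor2 A}

theorem star_mul_tensor {B : Type*} [Ring B] [Algebra ℂ B] [StarRing B] [StarModule ℂ B]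
    (x y : A ⊗[ℂ] B) : star (x * y) = star y * star x := star_mul x y

theorem star_oneRight (t : Tensor2 A) : star (oneRight t) = oneRight (star t) := by
  induction t using TensorProduct.induction_on with
  | zero => simp
  | add x y hx hy => simp only [map_add, star_add, hx, hy]
  | tmul x y => simp [oneRight, TensorProduct.star_tmul]

theorem star_oneLeft (t : Tensor2 A) : star (oneLeft t) = oneLeft (star t) := by
  simp [oneLeft, TensorProduct.star_tmul]

theorem star_assoc {B C : Type*} [Ring B] [Algebra ℂ B] [StarRing B] [StarModule ℂ B]
    [Ring C] [Algebra ℂ C] [StarRing C] [StarModule ℂ C] (t : (A ⊗[ℂ] B) ⊗[ℂ] C) :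
    star (Algebra.TensorProduct.assoc ℂ ℂ ℂ A B C t) =
      Algebra.TensorProduct.assoc ℂ ℂ ℂ A B C (star t) := by
  induction t using TensorProduct.induction_on with
  | zero => simp
  | add x y hx hy => simp only [map_add, star_add, hx, hy]
  | tmul x y =>
    induction x using TensorProduct.induction_on with
    | zero => simp
    | add x y hx hy => simp only [TensorProduct.add_tmul, map_add, star_add, hx, hy]
    | tmul x z => simp [TensorProduct.star_tmul]

theorem star_deltaLeft (h : ∀ a, star (Δ a) = Δ' (star a)) (t : Tensor2 A) :
    star (deltaLeft Δ t) = deltaLeft Δ' (star t) := by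
  induction t using TensorProduct.induction_on with
  | zero => simp
  | add x y hx hy => simp only [map_add, star_add, hx, hy]
  | tmul x y => simp [deltaLeft, star_assoc, TensorProduct.star_tmul, h]

theorem star_deltaRight (h : ∀ a, star (Δ a) = Δ' (star a)) (t : Tensor2 A) :
    star (deltaRight Δ t) = deltaRight Δ' (star t) := by
  induction t using TensorProduct.induction_on with
  | zero => simp
  | add x y hx hy => simp only [map_add, star_add, hx, hy]
  | tmul x y => simp [deltaRight, TensorProduct.star_tmul, h]

theorem star_deltaFirst (h : ∀ a, star (Δ a) = Δ' (star a)) (t : Tensor3 A) :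
    star (deltaFirst Δ t) = deltaFirst Δ' (star t) := by
  induction t using TensorProduct.induction_on with
  | zero => simp
  | add x y hx hy => simp only [map_add, star_add, hx, hy]
  | tmul x y => simp [deltaFirst, star_assoc, TensorProduct.star_tmul, h]

theorem star_deltaSecond (h : ∀ a, star (Δ a) = Δ' (star a)) (t : Tensor3 A) :
    star (deltaSecond Δ t) = deltaSecond Δ' (star t) := by
  induction t using TensorProduct.induction_on with
  | zero => simp
  | add x y hx hy => simp only [map_add, star_add, hx, hy]
  | tmul x y => simp [deltaSecond, star_deltaLeft h, TensorProduct.star_tmul]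

theorem star_deltaThird (h : ∀ a, star (Δ a) = Δ' (star a)) (t : Tensor3 A) :
    star (deltaThird Δ t) = deltaThird Δ' (star t) := by
  induction t using TensorProduct.induction_on with
  | zero => simp
  | add x y hx hy => simp only [map_add, star_add, hx, hy]
  | tmul x y => simp [deltaThird, star_deltaRight h, TensorProduct.star_tmul]

theorem star_oneFourth (t : Tensor3 A) : star (oneFourth t) = oneFourth (star t) := by
  induction t using TensorProduct.induction_on with
  | zero => simp
  | add x y hx hy => simp only [map_add, star_add, hx, hy]
  | tmul x y => simp [oneFourth, star_oneRight, TensorProduct.star_tmul]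

theorem star_oneFirst (t : Tensor3 A) : star (oneFirst t) = oneFirst (star t) := by
  simp [oneFirst, TensorProduct.star_tmul]

theorem star_counitLeft {ε : A →ₐ[ℂ] ℂ} (h : ∀ a, ε (star a) = star (ε a)) (t : Tensor2 A) :
    star (counitLeft ε t) = counitLeft ε (star t) := by
  induction t using TensorProduct.induction_on with
  | zero => simp
  | add x y hx hy => simp only [map_add, star_add, hx, hy]
  | tmul x y => simp [counitLeft, TensorProduct.star_tmul, h]

theorem star_counitRight {ε : A →ₐ[ℂ] ℂ} (h : ∀ a, ε (star a) = star (ε a)) (t : Tensor2 A) :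
    star (counitRight ε t) = counitRight ε (star t) := by
  induction t using TensorProduct.induction_on with
  | zero => simp
  | add x y hx hy => simp only [map_add, star_add, hx, hy]
  | tmul x y => simp [counitRight, TensorProduct.star_tmul, h]

theorem star_counitMiddle {ε : A →ₐ[ℂ] ℂ} (h : ∀ a, ε (star a) = star (ε a)) (t : Tensor3 A) :
    star (counitMiddle ε t) = counitMiddle ε (star t) := by
  induction t using TensorProduct.induction_on with
  | zero => simp
  | add x y hx hy => simp only [map_add, star_add, hx, hy]
  | tmul x y => simp [counitMiddle, star_counitLeft h, TensorProduct.star_tmul]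

theorem inv_star_twistCoassoc (h : ∀ a, star (Δ a) = Δ' (star a)) (F : (Tensor2 A)ˣ) :
    (star (twistCoassoc Δ Φ F))⁻¹ = twistCoassoc Δ' (star Φ)⁻¹ (star F)⁻¹ := by
  have h₁ : star (Units.map (oneRight (A := A)).toMonoidHom F) =
      Units.map (oneRight (A := A)).toMonoidHom (star F) := Units.ext (star_oneRight _)
  have h₂ : star (Units.map (oneLeft (A := A)).toMonoidHom F) =
      Units.map (oneLeft (A := A)).toMonoidHom (star F) := Units.ext (star_oneLeft _)
  have h₃ : star (Units.map (deltaLeft Δ).toMonoidHom F) =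
      Units.map (deltaLeft Δ').toMonoidHom (star F) := Units.ext (star_deltaLeft h _)
  have h₄ : star (Units.map (deltaRight Δ).toMonoidHom F) =
      Units.map (deltaRight Δ').toMonoidHom (star F) := Units.ext (star_deltaRight h _)
  simp only [twistCoassoc, map_inv, star_mul, star_inv, h₁, h₂, h₃, h₄]
  group

/-- Twisting by `F` carries a solution `Ω` of the relations to `(F†)⁻¹ Ω F⁻¹`. -/
theorem StarRelations.twist {Ω : (Tensor2 A)ˣ} (h : StarRelations Δ Φ Ω) (F : (Tensor2 A)ˣ) :
    StarRelations (twistComul Δ F) (twistCoassoc Δ Φ F) ((star F)⁻¹ * Ω * F⁻¹) := by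
  refine ⟨fun a => ?_, ?_⟩
  · rw [twistComul_apply, twistComul_apply, star_mul, star_mul, h.1, ← Units.coe_star,
      ← Units.coe_star, star_inv]
    simp only [mul_inv_rev, inv_inv, Units.val_mul, mul_assoc, Units.inv_mul_cancel_left]
  -- Both sides are Φ twisted by (F†)⁻¹ Ω: on the left as Φ_Ω twisted by (F†)⁻¹, on the right as Φ_F
  -- twisted by (F†)⁻¹ Ω F⁻¹.
  · rw [inv_star_twistCoassoc (Δ' := twistComul Δ Ω) h.1, h.2, twistCoassoc_twistCoassoc,
      twistCoassoc_twistCoassoc, inv_mul_cancel_right]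

theorem IsTwist.star {ε : A →ₐ[ℂ] ℂ} (h : ∀ a, ε (star a) = star (ε a)) {F : (Tensor2 A)ˣ}
    (hF : IsTwist ε F) : IsTwist ε (star F) := by
  constructor
  · rw [Units.coe_star, ← star_counitLeft h, hF.1, star_one]
  · rw [Units.coe_star, ← star_counitRight h, hF.2, star_one]

end Twist

namespace QuasiHopf

open QuasiBialgebra

variable {H : Type*} [Ring H] [Algebra ℂ H] {Q : QuasiHopf H} [StarRing H] [StarModule ℂ H]
  {Ω : (Tensor2 H)ˣ}

theorem IsStarCanonical.star_comul (hΩ : Q.IsStarCanonical Ω) (a : H) :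
    star (Q.comul a) = twistComul Q.comul Ω (star a) := hΩ.relations.1 a

/-- The quasi-bialgebra structure twisted by a `*`-canonical element. -/
def starTwist (hΩ : Q.IsStarCanonical Ω) : QuasiBialgebra H where
  comul := twistComul Q.comul Ω
  counit := Q.counit
  coassoc := twistCoassoc Q.comul Q.coassoc Ω
  counitLeft_comul a := by
    -- By (1) the twisted co-product of a† is Δ(a)† and the twisted co-associator is (Φ†)⁻¹. Each
    -- axiom is thus the conjugate of one for H, inverted where it concerns Φ, and the pentagon need
    -- not be twisted by hand.
    rw [← star_star a, ← hΩ.star_comul, ← star_counitLeft hΩ.counit_star, Q.counitLeft_comul]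
  counitRight_comul a := by
    rw [← star_star a, ← hΩ.star_comul, ← star_counitRight hΩ.counit_star, Q.counitRight_comul]
  quasi_coassoc a := by
    have := congrArg star (Q.quasi_coassoc (star a))
    rw [star_deltaRight hΩ.star_comul, hΩ.star_comul, star_mul, star_mul,
      star_deltaLeft hΩ.star_comul, hΩ.star_comul, star_star] at this
    rw [this, ← hΩ.relations.2, inv_inv, ← star_inv, mul_assoc]
    rfl
  pentagon := by
    have := congrArg star Q.pentagon
    rw [star_mul_tensor (B := Tensor3 H), star_mul_tensor (B := Tensor3 H),
      star_mul_tensor (B := Tensor3 H), star_deltaFirst hΩ.star_comul,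
      star_deltaSecond hΩ.star_comul, star_deltaThird hΩ.star_comul, star_oneFourth,
      star_oneFirst] at this
    have h : Units.map (deltaThird (twistComul Q.comul Ω)).toMonoidHom (star Q.coassoc) *
        Units.map (deltaFirst (twistComul Q.comul Ω)).toMonoidHom (star Q.coassoc) =
        Units.map (oneFirst (A := H)).toMonoidHom (star Q.coassoc) *
        (Units.map (deltaSecond (twistComul Q.comul Ω)).toMonoidHom (star Q.coassoc) *
        Units.map (oneFourth (A := H)).toMonoidHom (star Q.coassoc)) := Units.ext this
    have h' := congrArg (fun u : (Tensor4 H)ˣ => (↑u⁻¹ : Tensor4 H)) h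
    simp only [mul_inv_rev, ← map_inv, hΩ.relations.2] at h'
    exact h'
  counit_coassoc := by
    have h : Units.map (counitMiddle Q.counit).toMonoidHom (star Q.coassoc) = 1 :=
      Units.ext ((star_counitMiddle hΩ.counit_star _).symm.trans
        ((congrArg star Q.counit_coassoc).trans (star_one _)))
    have h' := congrArg (fun u : (Tensor2 H)ˣ => (↑u⁻¹ : Tensor2 H)) h
    simp only [← map_inv, hΩ.relations.2] at h'
    exact h'.trans (by simp)

theorem isTwisted_starTwist (hΩ : Q.IsStarCanonical Ω) :
    Q.toQuasiBialgebra.IsTwisted (starTwist hΩ) Ω := ⟨rfl, rfl, rfl⟩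

variable (Q) in
/-- `S̃` as a linear map. -/
def StildeLinear : H →ₗ[ℂ] H where
  toFun := Q.Stilde
  map_add' x y := by simp [Stilde]
  map_smul' c x := by simp [Stilde]

@[simp]
theorem StildeLinear_apply (x : H) : Q.StildeLinear x = star (Q.Sinv (star x)) := rfl

/-- Apply S⁻¹ and then † to the axioms of H. Both reverse words, and x β S(y) becomes S̃(x†) S⁻¹(β)†
y†; so α and β change roles, as do Φ and Φ⁻¹. -/
theorem isAntipode_Stilde (hΩ : Q.IsStarCanonical Ω) :
    (starTwist hΩ).IsAntipode (AlgHom.id ℂ H) Q.StildeLinear (star (Q.Sinv Q.β))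
      (star (Q.Sinv Q.α)) where
  map_one := by simp [Sinv_one]
  map_mul x y := by simp [Sinv_mul]
  left x := by
    have e : ∀ t : Tensor2 H, glue (thenMul Q.StildeLinear (star (Q.Sinv Q.β)))
        (AlgHom.id ℂ H).toLinearMap (star t) =
        star (Q.Sinv (glue (thenMul (AlgHom.id ℂ H).toLinearMap Q.β) Q.S t)) := fun t => by
      induction t using TensorProduct.induction_on with
      | zero => simp
      | add x y hx hy => simp only [map_add, star_add, hx, hy]
      | tmul x y => simp [TensorProduct.star_tmul, Sinv_mul, Sinv_S, mul_assoc]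
    change glue _ _ (twistComul Q.comul Ω x) = Q.counit x • _
    rw [← star_star x, ← hΩ.star_comul, e, hΩ.counit_star]
    refine (congrArg (fun y => star (Q.Sinv y)) (Q.isAntipode_S.right _)).trans ?_
    simp [toQuasiBialgebra]
  right x := by
    have e : ∀ t : Tensor2 H, glue (thenMul (AlgHom.id ℂ H).toLinearMap (star (Q.Sinv Q.α)))
        Q.StildeLinear (star t) =
        star (Q.Sinv (glue (thenMul Q.S Q.α) (AlgHom.id ℂ H).toLinearMap t)) := fun t => by
      induction t using TensorProduct.induction_on with
      | zero => simp
      | add x y hx hy => simp only [map_add, star_add, hx, hy]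
      | tmul x y => simp [TensorProduct.star_tmul, Sinv_mul, Sinv_S, mul_assoc]
    change glue _ _ (twistComul Q.comul Ω x) = Q.counit x • _
    rw [← star_star x, ← hΩ.star_comul, e, hΩ.counit_star]
    refine (congrArg (fun y => star (Q.Sinv y)) (Q.isAntipode_S.left _)).trans ?_
    simp [toQuasiBialgebra]
  coassoc := by
    have e : ∀ t : Tensor3 H, glue (thenMul Q.StildeLinear (star (Q.Sinv Q.β)))
        (glue (thenMul (AlgHom.id ℂ H).toLinearMap (star (Q.Sinv Q.α))) Q.StildeLinear)
        (star t) = star (Q.Sinv (glue (thenMul (AlgHom.id ℂ H).toLinearMap Q.β)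
          (glue (thenMul Q.S Q.α) (AlgHom.id ℂ H).toLinearMap) t)) := fun t => by
      induction t using TensorProduct.induction_on with
      | zero => simp
      | add x y hx hy => simp only [map_add, star_add, hx, hy]
      | tmul x t =>
        induction t using TensorProduct.induction_on with
        | zero => simp
        | add x y hx hy => simp only [TensorProduct.tmul_add, map_add, star_add, hx, hy]
        | tmul y z => simp [TensorProduct.star_tmul, Sinv_mul, Sinv_S, mul_assoc]
    change glue _ _ (twistCoassoc Q.comul Q.coassoc Ω : Tensor3 H) = _
    rw [← hΩ.relations.2, ← star_inv, Units.coe_star, e]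
    refine (congrArg (fun y => star (Q.Sinv y)) Q.isAntipode_S.coassoc_inv).trans ?_
    simp [Sinv_one]
  coassoc_inv := by
    have e : ∀ t : Tensor3 H, glue (thenMul (AlgHom.id ℂ H).toLinearMap (star (Q.Sinv Q.α)))
        (glue (thenMul Q.StildeLinear (star (Q.Sinv Q.β))) (AlgHom.id ℂ H).toLinearMap)
        (star t) = star (Q.Sinv (glue (thenMul Q.S Q.α)
          (glue (thenMul (AlgHom.id ℂ H).toLinearMap Q.β) Q.S) t)) := fun t => by
      induction t using TensorProduct.induction_on with
      | zero => simp
      | add x y hx hy => simp only [map_add, star_add, hx, hy]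
      | tmul x t =>
        induction t using TensorProduct.induction_on with
        | zero => simp
        | add x y hx hy => simp only [TensorProduct.tmul_add, map_add, star_add, hx, hy]
        | tmul y z => simp [TensorProduct.star_tmul, Sinv_mul, Sinv_S, mul_assoc]
    change glue _ _ (↑(twistCoassoc Q.comul Q.coassoc Ω)⁻¹ : Tensor3 H) = _
    rw [← hΩ.relations.2, inv_inv, Units.coe_star, e]
    refine (congrArg (fun y => star (Q.Sinv y)) Q.isAntipode_S.coassoc).trans ?_
    simp [Sinv_one]

theorem isAntipode_twist (hΩ : Q.IsStarCanonical Ω) :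
    (starTwist hΩ).IsAntipode (AlgHom.id ℂ H) Q.S (Q.twistα Ω) (Q.twistβ Ω) :=
  Q.isAntipode_S.twist (isTwisted_starTwist hΩ) hΩ.isTwist

/-- Existence and uniqueness of the conjugator. -/
theorem existsUnique_isConjugator (hΩ : Q.IsStarCanonical Ω) :
    ∃ w : Hˣ, Q.IsConjugator Ω w ∧ ∀ w' : Hˣ, Q.IsConjugator Ω w' → w' = w := by
  obtain ⟨w, -, h₁, h₂, h₃⟩ := (isAntipode_Stilde hΩ).exists_unit (isAntipode_twist hΩ)
  have hw : Q.IsConjugator Ω w :=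
    ⟨h₂, h₃, fun a => (Units.eq_mul_inv_iff_mul_eq w).2 (h₁ a).symm⟩
  have key : ∀ v : Hˣ, Q.IsConjugator Ω v → (v : H) = _ := fun v hv =>
    (isAntipode_Stilde hΩ).eq_link (s' := Q.S)
      (fun x => ((Units.eq_mul_inv_iff_mul_eq v).1 (hv.antipode x)).symm) hv.alpha
  exact ⟨w, hw, fun w' hw' => Units.ext ((key w' hw').trans (key w hw).symm)⟩

end QuasiHopf

end

/-! ### Flips, co-units of the Drinfeld twists, and conjugation by w -/

section

namespace QuasiHopf

open QuasiBialgebra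

variable {H : Type*} [Ring H] [Algebra ℂ H] (Q : QuasiHopf H)

/-- The anti-automorphism `(S ⊗ S)T` of `H ⊗ H`. -/
def flipS (t : Tensor2 H) : Tensor2 H := both Q.S (tensorFlip t)

/-- The anti-automorphism `(S⁻¹ ⊗ S⁻¹)T` of `H ⊗ H`. -/
def flipSinv (t : Tensor2 H) : Tensor2 H := both Q.Sinv (tensorFlip t)

@[simp]
theorem flipS_tmul (x y : H) : Q.flipS (x ⊗ₜ y) = Q.S y ⊗ₜ Q.S x := rfl

@[simp]
theorem flipSinv_tmul (x y : H) : Q.flipSinv (x ⊗ₜ y) = Q.Sinv y ⊗ₜ Q.Sinv x := rfl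

theorem flipS_zero : Q.flipS 0 = 0 := by simp [flipS]

theorem flipSinv_zero : Q.flipSinv 0 = 0 := by simp [flipSinv]

theorem flipS_add (t u : Tensor2 H) : Q.flipS (t + u) = Q.flipS t + Q.flipS u := by simp [flipS]

theorem flipSinv_add (t u : Tensor2 H) : Q.flipSinv (t + u) = Q.flipSinv t + Q.flipSinv u := by
  simp [flipSinv]

theorem flipS_mul (t u : Tensor2 H) : Q.flipS (t * u) = Q.flipS u * Q.flipS t :=
  both_flip_mul Q.S_mul t u

theorem flipSinv_mul (t u : Tensor2 H) : Q.flipSinv (t * u) = Q.flipSinv u * Q.flipSinv t :=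
  both_flip_mul Q.Sinv_mul t u

theorem flipS_one : Q.flipS 1 = 1 := by
  rw [Algebra.TensorProduct.one_def, flipS_tmul, S_one]

theorem flipSinv_one : Q.flipSinv 1 = 1 := by
  rw [Algebra.TensorProduct.one_def, flipSinv_tmul, Sinv_one]

theorem flipSinv_flipS (t : Tensor2 H) : Q.flipSinv (Q.flipS t) = t := by
  induction t using TensorProduct.induction_on with
  | zero => rw [flipS_zero, flipSinv_zero]
  | add x y hx hy => rw [flipS_add, flipSinv_add, hx, hy]
  | tmul x y => rw [flipS_tmul, flipSinv_tmul, Sinv_S, Sinv_S]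

/-- The image of a unit under `(S⁻¹ ⊗ S⁻¹)T`. -/
def flipSinvUnit (F : (Tensor2 H)ˣ) : (Tensor2 H)ˣ where
  val := Q.flipSinv F
  inv := Q.flipSinv (↑F⁻¹ : Tensor2 H)
  val_inv := by rw [← flipSinv_mul, Units.inv_mul, flipSinv_one]
  inv_val := by rw [← flipSinv_mul, Units.mul_inv, flipSinv_one]

theorem exists_drinfeldTwist : ∃ F : (Tensor2 H)ˣ, (F : Tensor2 H) = Q.drinfeldTwist ∧
    (∀ x, F * Q.comul (Q.S x) = Q.flipS (Q.comul x) * F) ∧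
    F * Q.comul Q.α = Q.toQuasiBialgebra.gammaElt Q.S Q.α ∧
    Q.toQuasiBialgebra.deltaElt Q.β Q.S * F = Q.comul Q.β := by
  rw [drinfeldTwist_eq]
  exact exists_drinfeldElt Q.isAntipode_S

section Counit

variable {Q}

/-- Apply ε to S(x₁) α x₂ = ε(x) α; the normalisation ε(α) = 1 removes the factor ε(α). -/
theorem counit_S (hα : Q.counit Q.α = 1) (x : H) : Q.counit (Q.S x) = Q.counit x := by
  have e : ∀ t : Tensor2 H, Q.counit (glue (thenMul Q.S Q.α) (AlgHom.id ℂ H).toLinearMap t) =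
      Q.counit (Q.S (counitRight Q.counit t)) := fun t => by
    induction t using TensorProduct.induction_on with
    | zero => simp
    | add x y hx hy => simp only [map_add, hx, hy]
    | tmul x y => simp [counitRight, hα, mul_comm]
  have h := congrArg Q.counit (Q.isAntipode_S.left x)
  have h' := e (Q.comul x)
  rw [Q.counitRight_comul] at h'
  refine h'.symm.trans (h.trans ?_)
  simp [hα, toQuasiBialgebra]

theorem counit_Sinv (hα : Q.counit Q.α = 1) (x : H) : Q.counit (Q.Sinv x) = Q.counit x := by
  rw [← counit_S hα, S_Sinv]

theorem counitLeft_flipS (hα : Q.counit Q.α = 1) (t : Tensor2 H) :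
    counitLeft Q.counit (Q.flipS t) = Q.S (counitRight Q.counit t) := by
  induction t using TensorProduct.induction_on with
  | zero => simp [flipS_zero]
  | add x y hx hy => rw [flipS_add, map_add, map_add, map_add, hx, hy]
  | tmul x y => simp [counitLeft, counitRight, counit_S hα]

theorem counitRight_flipS (hα : Q.counit Q.α = 1) (t : Tensor2 H) :
    counitRight Q.counit (Q.flipS t) = Q.S (counitLeft Q.counit t) := by
  induction t using TensorProduct.induction_on with
  | zero => simp [flipS_zero]
  | add x y hx hy => rw [flipS_add, map_add, map_add, map_add, hx, hy]
  | tmul x y => simp [counitLeft, counitRight, counit_S hα]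

theorem counitLeft_flipSinv (hα : Q.counit Q.α = 1) (t : Tensor2 H) :
    counitLeft Q.counit (Q.flipSinv t) = Q.Sinv (counitRight Q.counit t) := by
  induction t using TensorProduct.induction_on with
  | zero => simp [flipSinv_zero]
  | add x y hx hy => rw [flipSinv_add, map_add, map_add, map_add, hx, hy]
  | tmul x y => simp [counitLeft, counitRight, counit_Sinv hα]

theorem counitRight_flipSinv (hα : Q.counit Q.α = 1) (t : Tensor2 H) :
    counitRight Q.counit (Q.flipSinv t) = Q.Sinv (counitLeft Q.counit t) := by
  induction t using TensorProduct.induction_on with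
  | zero => simp [flipSinv_zero]
  | add x y hx hy => rw [flipSinv_add, map_add, map_add, map_add, hx, hy]
  | tmul x y => simp [counitLeft, counitRight, counit_Sinv hα]

/-- The co-unit on the first output replaces legs 2 and 3 by co-units, so both co-associators have a
co-unit in the middle. On the second output, it is legs 1 and 4. -/
theorem counitLeft_gamma (hα : Q.counit Q.α = 1) :
    counitLeft Q.counit (Q.toQuasiBialgebra.gammaElt Q.S Q.α) = Q.α := by
  have e : ∀ t : Tensor4 H, counitLeft Q.counit (leftLegs Q.S Q.α (leftSlots H t)) =
      glue (thenMul Q.S Q.α) (AlgHom.id ℂ H).toLinearMap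
        (pair (slot₁ H) (pair (Q.toQuasiBialgebra.unitHom _)
          (pair (Q.toQuasiBialgebra.unitHom _) (slot₂ H))) t) := fun t => by
    induction t using tensor4_induction with
    | zero => simp
    | add x y hx hy => simp only [map_add, hx, hy]
    | tmul x y z w =>
      simp [leftLegs, leftSlots, counitLeft, unitHom_apply, hα, counit_S hα, toQuasiBialgebra,
        Algebra.algebraMap_eq_smul_one, smul_smul]
      rw [mul_comm (Q.counit z)]
  rw [gammaElt, e, pair_gammaTensor, assocAt_unitHom_middle, assocAt_unitHom_middle]
  simp [Algebra.TensorProduct.one_def, S_one]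

theorem counitRight_gamma (hα : Q.counit Q.α = 1) :
    counitRight Q.counit (Q.toQuasiBialgebra.gammaElt Q.S Q.α) = Q.α := by
  have e : ∀ t : Tensor4 H, counitRight Q.counit (leftLegs Q.S Q.α (leftSlots H t)) =
      glue (thenMul Q.S Q.α) (AlgHom.id ℂ H).toLinearMap
        (pair (Q.toQuasiBialgebra.unitHom _) (pair (slot₁ H)
          (pair (slot₂ H) (Q.toQuasiBialgebra.unitHom _))) t) := fun t => by
    induction t using tensor4_induction with
    | zero => simp
    | add x y hx hy => simp only [map_add, hx, hy]
    | tmul x y z w =>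
      simp [leftLegs, leftSlots, counitRight, unitHom_apply, hα, counit_S hα, toQuasiBialgebra,
        Algebra.algebraMap_eq_smul_one, smul_smul]
      rw [mul_comm (Q.counit w)]
  rw [gammaElt, e, pair_gammaTensor, assocAt_unitHom_left, assocAt_unitHom_right]
  simp [Algebra.TensorProduct.one_def, S_one]

/-- Applying a co-unit to the relations for F gives an element that commutes with every S(x) and
fixes α; by `IsAntipode.eq_link` it is S(X) α Y β S(Z) = 1. -/
theorem isTwist_drinfeldTwist (hα : Q.counit Q.α = 1) {F : (Tensor2 H)ˣ}
    (hF : ∀ x, F * Q.comul (Q.S x) = Q.flipS (Q.comul x) * F)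
    (hFα : F * Q.comul Q.α = Q.toQuasiBialgebra.gammaElt Q.S Q.α) : IsTwist Q.counit F := by
  constructor
  · refine (Q.isAntipode_S.eq_link (fun x => ?_) ?_).trans Q.isAntipode_S.coassoc
    · have := congrArg (counitLeft Q.counit) (hF x)
      rwa [map_mul, map_mul, counitLeft_flipS hα, Q.counitLeft_comul, Q.counitRight_comul] at this
    · have := congrArg (counitLeft Q.counit) hFα
      rwa [map_mul, counitLeft_gamma hα, Q.counitLeft_comul] at this
  · refine (Q.isAntipode_S.eq_link (fun x => ?_) ?_).trans Q.isAntipode_S.coassoc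
    · have := congrArg (counitRight Q.counit) (hF x)
      rwa [map_mul, map_mul, counitRight_flipS hα, Q.counitLeft_comul,
        Q.counitRight_comul] at this
    · have := congrArg (counitRight Q.counit) hFα
      rwa [map_mul, counitRight_gamma hα, Q.counitRight_comul] at this

theorem IsTwist.flipSinvUnit (hα : Q.counit Q.α = 1) {F : (Tensor2 H)ˣ}
    (hF : IsTwist Q.counit F) : IsTwist Q.counit (Q.flipSinvUnit F) :=
  ⟨(counitLeft_flipSinv hα _).trans (by rw [hF.2, Sinv_one]),
    (counitRight_flipSinv hα _).trans (by rw [hF.1, Sinv_one])⟩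

end Counit

variable {Q} [StarRing H] {Ω : (Tensor2 H)ˣ} {w : Hˣ}

theorem IsConjugator.mul_star_Sinv (hw : Q.IsConjugator Ω w) (x : H) :
    w * star (Q.Sinv x) = Q.S (star x) * w := by
  have := hw.antipode (star x)
  rw [Units.eq_mul_inv_iff_mul_eq, Stilde, star_star] at this
  exact this.symm

variable [StarModule ℂ H]

/-- † reverses the two factors, and (Φ†)⁻¹ = Φ_Ω. This is why conjugation exchanges δ with the
twisted γ. -/
theorem star_deltaTensor (hΩ : Q.IsStarCanonical Ω) :
    star Q.toQuasiBialgebra.deltaTensor = (starTwist hΩ).gammaTensor := by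
  have h : (twistCoassoc Q.comul Q.coassoc Ω) = star Q.coassoc⁻¹ := by
    rw [← hΩ.relations.2, star_inv]
  have h' : (twistCoassoc Q.comul Q.coassoc Ω)⁻¹ = star Q.coassoc := by
    rw [← hΩ.relations.2, inv_inv]
  change star (deltaFirst Q.comul (↑Q.coassoc⁻¹ : Tensor3 H) *
    oneFourth (Q.coassoc : Tensor3 H)) = oneFourth (↑(twistCoassoc Q.comul Q.coassoc Ω)⁻¹) *
      deltaFirst (twistComul Q.comul Ω) (↑(twistCoassoc Q.comul Q.coassoc Ω))
  rw [star_mul_tensor (B := Tensor3 H), star_deltaFirst hΩ.star_comul, star_oneFourth, h', h]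
  rfl

theorem star_flipSinv_rightLegs (t : Tensor4 H) :
    star (Q.flipSinv (rightLegs Q.β Q.S (rightSlots H t))) =
      leftLegs Q.StildeLinear (star (Q.Sinv Q.β)) (leftSlots H (star t)) := by
  induction t using tensor4_induction with
  | zero => simp [flipSinv_zero]
  | add x y hx hy => simp only [map_add, flipSinv_add, star_add, hx, hy]
  | tmul x y z t =>
    simp [rightLegs, leftLegs, rightSlots, leftSlots, TensorProduct.star_tmul, Sinv_mul, Sinv_S,
      mul_assoc]

theorem IsConjugator.mul_star_flipSinv (hw : Q.IsConjugator Ω w) (t : Tensor2 H) :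
    ((w : H) ⊗ₜ[ℂ] (w : H)) * star (Q.flipSinv t) =
      Q.flipS (star t) * ((w : H) ⊗ₜ[ℂ] (w : H)) := by
  induction t using TensorProduct.induction_on with
  | zero => simp [flipS_zero, flipSinv_zero]
  | add x y hx hy => rw [flipSinv_add, star_add, mul_add, hx, hy, star_add, flipS_add, add_mul]
  | tmul x y => simp [TensorProduct.star_tmul, hw.mul_star_Sinv]

theorem IsConjugator.mul_leftLegs (hw : Q.IsConjugator Ω w) (t : Tensor2 H ⊗[ℂ] Tensor2 H) :
    ((w : H) ⊗ₜ[ℂ] (w : H)) * leftLegs Q.StildeLinear (star (Q.Sinv Q.β)) t =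
      leftLegs Q.S (Q.twistα Ω) t := by
  induction t using TensorProduct.induction_on with
  | zero => simp
  | add x y hx hy => rw [map_add, mul_add, hx, hy, map_add]
  | tmul x y =>
    have h : ∀ x, (w : H) * Q.StildeLinear x = Q.S x * w := fun x => by
      rw [StildeLinear_apply, hw.mul_star_Sinv, star_star]
    rw [leftLegs, leftLegs, TensorProduct.map_tmul, TensorProduct.map_tmul,
      Algebra.TensorProduct.tmul_mul_tmul, mul_glue_of_intertwine h hw.alpha,
      mul_glue_of_intertwine h hw.alpha]

/-- It turns δ F_δ = Δ(β) into a relation whose value is the twisted γ, as needed to characterise an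
element built from (F₀†)⁻¹. -/
theorem IsConjugator.mul_star_flipSinv_delta (hΩ : Q.IsStarCanonical Ω)
    (hw : Q.IsConjugator Ω w) :
    ((w : H) ⊗ₜ[ℂ] (w : H)) * star (Q.flipSinv (Q.toQuasiBialgebra.deltaElt Q.β Q.S)) =
      (starTwist hΩ).gammaElt Q.S (Q.twistα Ω) := by
  rw [deltaElt, star_flipSinv_rightLegs, hw.mul_leftLegs, star_deltaTensor hΩ, gammaElt]

end QuasiHopf

end

/-! ### The relation between the two Drinfeld twists and the explicit formulas -/

section

namespace QuasiHopf

open QuasiBialgebra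

variable {H : Type*} [Ring H] [Algebra ℂ H] {Q : QuasiHopf H} {F : (Tensor2 H)ˣ}

theorem flipSinv_comul_mul (hF : ∀ x, F * Q.comul (Q.S x) = Q.flipS (Q.comul x) * F) (x : H) :
    Q.flipSinv (Q.comul (Q.S x)) * Q.flipSinv F = Q.flipSinv F * Q.comul x := by
  rw [← flipSinv_mul, hF, flipSinv_mul, flipSinv_flipS]

theorem tmul_self_inv_mul (w : Hˣ) (t : Tensor2 H) :
    ((↑w⁻¹ : H) ⊗ₜ[ℂ] (↑w⁻¹ : H)) * (((w : H) ⊗ₜ[ℂ] (w : H)) * t) = t := by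
  rw [← mul_assoc, Algebra.TensorProduct.tmul_mul_tmul, Units.inv_mul,
    ← Algebra.TensorProduct.one_def, one_mul]

theorem comul_inv_mul (w : Hˣ) : Q.comul (↑w⁻¹ : H) * Q.comul (w : H) = 1 := by
  rw [← map_mul, Units.inv_mul, map_one]

variable [StarRing H] [StarModule ℂ H] {Ω : (Tensor2 H)ˣ} {w : Hˣ}

/-- The relation between the two Drinfeld twists that underlies both explicit formulas. -/
theorem IsConjugator.star_inv_flipSinv (hΩ : Q.IsStarCanonical Ω) (hw : Q.IsConjugator Ω w)
    (hF : ∀ x, F * Q.comul (Q.S x) = Q.flipS (Q.comul x) * F)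
    (hFα : F * Q.comul Q.α = Q.toQuasiBialgebra.gammaElt Q.S Q.α)
    (hFβ : Q.toQuasiBialgebra.deltaElt Q.β Q.S * F = Q.comul Q.β) :
    ((w : H) ⊗ₜ[ℂ] (w : H)) * (↑(star (Q.flipSinvUnit F))⁻¹ * Ω * Q.comul (↑w⁻¹ : H)) =
      Q.flipS (↑Ω⁻¹ : Tensor2 H) * F := by
  have hstar : ∀ x, (Ω : Tensor2 H) * Q.comul (star x) = star (Q.comul x) * Ω := fun x => by
    rw [hΩ.relations.1, Units.inv_mul_cancel_right]
  have hF' : ∀ x, Q.comul x * (↑(Q.flipSinvUnit F)⁻¹ : Tensor2 H) =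
      (↑(Q.flipSinvUnit F)⁻¹ : Tensor2 H) * Q.flipSinv (Q.comul (Q.S x)) := fun x => by
    rw [Units.eq_inv_mul_iff_mul_eq, ← mul_assoc, ← Units.eq_mul_inv_iff_mul_eq, inv_inv]
    exact (flipSinv_comul_mul hF x).symm
  have hF'' : ∀ x, (↑(star (Q.flipSinvUnit F))⁻¹ : Tensor2 H) * star (Q.comul x) =
      star (Q.flipSinv (Q.comul (Q.S x))) * (↑(star (Q.flipSinvUnit F))⁻¹ : Tensor2 H) :=
    fun x => by
      rw [← star_inv, Units.coe_star, ← star_mul, hF', star_mul]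
  have hwS : ∀ x, (↑w⁻¹ : H) * Q.S x = star (Q.Sinv (star x)) * (↑w⁻¹ : H) := fun x => by
    rw [Units.inv_mul_eq_iff_eq_mul, ← mul_assoc, hw.mul_star_Sinv, star_star,
      Units.mul_inv_cancel_right]
  have h := (isAntipode_twist hΩ).comp (starTwist hΩ).comul
  have inter : ∀ u : Tensor2 H, (∀ x, u * Q.comul (Q.S x) =
      Q.flipS (twistComul Q.comul Ω x) * u) → ∀ x, u * (↑Ω⁻¹ : Tensor2 H) *
      ((starTwist hΩ).comul.toLinearMap ∘ₗ Q.S) x =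
      (starTwist hΩ).flipAntipode Q.S x * (u * (↑Ω⁻¹ : Tensor2 H)) := fun u hu x => by
    change u * (↑Ω⁻¹ : Tensor2 H) * (Ω * Q.comul (Q.S x) * (↑Ω⁻¹ : Tensor2 H)) =
      Q.flipS (twistComul Q.comul Ω x) * (u * (↑Ω⁻¹ : Tensor2 H))
    rw [← mul_assoc, ← mul_assoc, Units.inv_mul_cancel_right, hu, mul_assoc]
  have value : ∀ u : Tensor2 H, u * (↑Ω⁻¹ : Tensor2 H) * (starTwist hΩ).comul (Q.twistα Ω) =
      u * Q.comul (Q.twistα Ω) * (↑Ω⁻¹ : Tensor2 H) := fun u => by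
    change u * (↑Ω⁻¹ : Tensor2 H) * (Ω * Q.comul (Q.twistα Ω) * (↑Ω⁻¹ : Tensor2 H)) = _
    rw [← mul_assoc, ← mul_assoc, Units.inv_mul_cancel_right]
  -- Both sides, after right multiplication by Ω⁻¹, will be the same link along Δ_Ω; the hypotheses
  -- are the two defining relations, cleared of Ω⁻¹.
  have key : ∀ u : Tensor2 H, (∀ x, u * Q.comul (Q.S x) =
      Q.flipS (twistComul Q.comul Ω x) * u) →
      u * Q.comul (Q.twistα Ω) = (starTwist hΩ).gammaElt Q.S (Q.twistα Ω) * Ω →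
      u * (↑Ω⁻¹ : Tensor2 H) = _ := fun u hu hu' =>
    h.eq_link (s' := (starTwist hΩ).flipAntipode Q.S)
      (a' := (starTwist hΩ).gammaElt Q.S (Q.twistα Ω)) (inter u hu)
      (by rw [value, hu', Units.mul_inv_cancel_right])
  rw [← Units.mul_left_inj Ω⁻¹]
  refine (key _ (fun x => ?_) ?_).trans (key _ (fun x => ?_) ?_).symm
  -- S(x) is carried leftwards: past w⁻¹ it becomes S̃(x), past Ω the co-product becomes a
  -- conjugate, past (F₀†)⁻¹ it is flipped, and w ⊗ w restores S ⊗ S.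
  · rw [mul_assoc _ _ (Q.comul _), mul_assoc _ _ (Q.comul _), ← map_mul, hwS, map_mul,
      ← mul_assoc _ (Q.comul _) (Q.comul _), mul_assoc _ (Ω : Tensor2 H) (Q.comul _), hstar,
      ← mul_assoc _ (star _) (Ω : Tensor2 H), hF'', S_Sinv]
    simp only [mul_assoc]
    rw [← mul_assoc _ (star (Q.flipSinv _)), hw.mul_star_flipSinv, hΩ.star_comul, star_star,
      mul_assoc]
  -- Here α_Ω = w S⁻¹(β)†, so the same route leads to Δ(β) = δ F_δ; its factor F_δ, flipped and
  -- conjugated, cancels (F₀†)⁻¹.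
  · rw [mul_assoc _ _ (Q.comul _), mul_assoc _ _ (Q.comul _), ← map_mul, ← hw.alpha,
      Units.inv_mul_cancel_left, mul_assoc _ (Ω : Tensor2 H) (Q.comul _), hstar,
      ← mul_assoc _ (star _) (Ω : Tensor2 H), hF'', S_Sinv, ← hFβ, flipSinv_mul, star_mul]
    simp only [mul_assoc]
    have hF₀ : star (Q.flipSinv F) * (↑(star (Q.flipSinvUnit F))⁻¹ : Tensor2 H) = 1 :=
      (star (Q.flipSinvUnit F)).mul_inv
    rw [← mul_assoc (star (Q.flipSinv F)), hF₀, one_mul, hw.alpha,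
      ← hw.mul_star_flipSinv_delta hΩ, mul_assoc]
  · rw [twistComul_apply, flipS_mul, flipS_mul, mul_assoc, hF]
    simp only [mul_assoc]
    rw [← mul_assoc (Q.flipS Ω) (Q.flipS _), ← flipS_mul, Units.inv_mul, flipS_one, one_mul]
  · exact (IsTwisted.gammaElt_mul Q.isAntipode_S (isTwisted_starTwist hΩ) hΩ.isTwist hF hFα).symm

/-- The explicit form of the canonical element twisted by the second Drinfeld twist. -/
theorem star_inv_flipSinv_mul_inv
    (h : ((w : H) ⊗ₜ[ℂ] (w : H)) *
      (↑(star (Q.flipSinvUnit F))⁻¹ * Ω * Q.comul (↑w⁻¹ : H)) =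
      Q.flipS (↑Ω⁻¹ : Tensor2 H) * F) :
    (↑((star (Q.flipSinvUnit F))⁻¹ * Ω * (Q.flipSinvUnit F)⁻¹) : Tensor2 H) =
      ((↑w⁻¹ : H) ⊗ₜ[ℂ] (↑w⁻¹ : H)) * Q.flipS (↑Ω⁻¹ : Tensor2 H) * F * Q.comul (w : H) *
        (↑(Q.flipSinvUnit F)⁻¹ : Tensor2 H) := by
  rw [mul_assoc _ (Q.flipS _) (F : Tensor2 H), ← h, tmul_self_inv_mul,
    mul_assoc _ (Q.comul _) (Q.comul _), comul_inv_mul, mul_one, Units.val_mul, Units.val_mul]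

/-- The explicit form of the canonical element twisted by the Drinfeld twist. -/
theorem IsConjugator.star_inv_mul_inv (hw : Q.IsConjugator Ω w)
    (hF : ∀ x, F * Q.comul (Q.S x) = Q.flipS (Q.comul x) * F)
    (h : ((w : H) ⊗ₜ[ℂ] (w : H)) *
      (↑(star (Q.flipSinvUnit F))⁻¹ * Ω * Q.comul (↑w⁻¹ : H)) =
      Q.flipS (↑Ω⁻¹ : Tensor2 H) * F) :
    (↑((star F)⁻¹ * Ω * F⁻¹) : Tensor2 H) =
      (Q.Sinv (↑w⁻¹ : H) ⊗ₜ[ℂ] Q.Sinv (↑w⁻¹ : H)) * Q.flipSinv (↑Ω⁻¹ : Tensor2 H) *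
        Q.flipSinvUnit F * Q.comul (Q.Sinv (w : H)) * (↑F⁻¹ : Tensor2 H) := by
  -- Conjugation by w ⊗ w trades (F₀†)⁻¹ for the flipped (F_δ†)⁻¹, which allows the relation to be
  -- solved for F_δ.
  have hstar : ((w : H) ⊗ₜ[ℂ] (w : H)) * (↑(star (Q.flipSinvUnit F))⁻¹ : Tensor2 H) =
      Q.flipS (↑(star F)⁻¹ : Tensor2 H) * ((w : H) ⊗ₜ[ℂ] (w : H)) := by
    rw [← star_inv, ← star_inv]
    exact hw.mul_star_flipSinv (↑F⁻¹ : Tensor2 H)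
  have hw' : ((w : H) ⊗ₜ[ℂ] (w : H)) * ((↑w⁻¹ : H) ⊗ₜ[ℂ] (↑w⁻¹ : H)) = 1 := by
    rw [Algebra.TensorProduct.tmul_mul_tmul, Units.mul_inv, ← Algebra.TensorProduct.one_def]
  have h₁ : Q.flipS (↑(star F)⁻¹ : Tensor2 H) =
      Q.flipS (↑Ω⁻¹ : Tensor2 H) * F * Q.comul (w : H) * (↑Ω⁻¹ : Tensor2 H) *
        ((↑w⁻¹ : H) ⊗ₜ[ℂ] (↑w⁻¹ : H)) := by
    rw [← h]
    simp only [mul_assoc]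
    rw [← mul_assoc (Q.comul _) (Q.comul _), comul_inv_mul, one_mul, Units.mul_inv_cancel_left,
      ← mul_assoc _ (↑(star (Q.flipSinvUnit F))⁻¹ : Tensor2 H), hstar, mul_assoc, hw', mul_one]
  have h₂ := congrArg Q.flipSinv h₁
  -- Taken at S⁻¹(w), this turns the flipped Δ(w) to the left of F₀ into Δ(S⁻¹(w)) to its right.
  have h₃ := flipSinv_comul_mul hF (Q.Sinv w)
  rw [S_Sinv] at h₃
  rw [flipSinv_flipS, flipSinv_mul, flipSinv_mul, flipSinv_mul, flipSinv_mul, flipSinv_flipS,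
    ← mul_assoc _ (Q.flipSinv F), h₃] at h₂
  rw [Units.val_mul, Units.val_mul, h₂, flipSinv_tmul]
  simp only [mul_assoc]
  rw [Units.inv_mul_cancel_left]
  rfl

end QuasiHopf

end

end StarQuasiHopf

end

theorem mainTheorem12 {H : Type*} [Ring H] [Algebra ℂ H] [StarRing H] [StarModule ℂ H]
    (Q : QuasiHopf H) (Ω : (Tensor2 H)ˣ) (hΩ : Q.IsStarCanonical Ω) :
    ∃ (Fδ F₀ Ω' Ω₀ : (Tensor2 H)ˣ) (w : Hˣ),
      (Fδ : Tensor2 H) = Q.drinfeldTwist ∧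
      (F₀ : Tensor2 H) = Q.secondDrinfeldTwist ∧
      Q.IsConjugator Ω w ∧ (∀ w' : Hˣ, Q.IsConjugator Ω w' → w' = w) ∧
      Ω' = (star Fδ)⁻¹ * Ω * Fδ⁻¹ ∧
      Ω₀ = (star F₀)⁻¹ * Ω * F₀⁻¹ ∧
      StarRelations (twistComul Q.comul Fδ) (twistCoassoc Q.comul Q.coassoc Fδ) Ω' ∧
      StarRelations (twistComul Q.comul F₀) (twistCoassoc Q.comul Q.coassoc F₀) Ω₀ ∧
      (Q.counit Q.α = 1 → IsTwist Q.counit Fδ ∧ IsTwist Q.counit F₀ ∧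
        IsTwist Q.counit Ω' ∧ IsTwist Q.counit Ω₀) ∧
      (Ω' : Tensor2 H) =
        (Q.Sinv (↑w⁻¹ : H) ⊗ₜ[ℂ] Q.Sinv (↑w⁻¹ : H)) * both Q.Sinv (tensorFlip (↑Ω⁻¹ : Tensor2 H)) *
          (F₀ : Tensor2 H) * Q.comul (Q.Sinv (w : H)) * (↑Fδ⁻¹ : Tensor2 H) ∧
      (Ω₀ : Tensor2 H) =
        ((↑w⁻¹ : H) ⊗ₜ[ℂ] (↑w⁻¹ : H)) * both Q.S (tensorFlip (↑Ω⁻¹ : Tensor2 H)) *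
          (Fδ : Tensor2 H) * Q.comul (w : H) * (↑F₀⁻¹ : Tensor2 H) := by
  obtain ⟨F, hFdef, hF, hFα, hFβ⟩ := Q.exists_drinfeldTwist
  obtain ⟨w, hw, hw'⟩ := QuasiHopf.existsUnique_isConjugator hΩ
  have h := hw.star_inv_flipSinv hΩ hF hFα hFβ
  have twist : ∀ F : (Tensor2 H)ˣ, IsTwist Q.counit F →
      IsTwist Q.counit ((star F)⁻¹ * Ω * F⁻¹) := fun F hF =>
    ((hF.star hΩ.counit_star).inv.mul hΩ.isTwist).mul hF.inv
  refine ⟨F, Q.flipSinvUnit F, _, _, w, hFdef, congrArg Q.flipSinv hFdef, hw, hw', rfl, rfl,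
    hΩ.relations.twist _, hΩ.relations.twist _, fun hα => ?_, hw.star_inv_mul_inv hF h,
    QuasiHopf.star_inv_flipSinv_mul_inv h⟩
  have hT := QuasiHopf.isTwist_drinfeldTwist hα hF hFα
  have hT' := QuasiHopf.IsTwist.flipSinvUnit hα hT
  exact ⟨hT, hT', twist _ hT, twist _ hT'⟩
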